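/- Let $r,a,\beta>0$, $\lambda\in\mathbb R\setminus\{0\}$, and let $s$ be one of: (I) $s(x)=x$; (II) $s(x)=\frac1r\sin(rx)$; (III) $s(x)=\frac a\pi\sinh(\pi x/a)$; (IV) $s(x)=\frac1r e^{ra/4}\vartheta_1(rx\,|\,ira/\pi)$. Put $\rho=0,1,1,3$ in the cases (I), (II), (III), (IV), respectively; $\omega_0=0$; $\omega_1=\pi/r$ in (II), (IV) and $\omega_1=ia$ in (III); $\omega_2=ia$, $\omega_3=-\omega_1-\omega_2$; $(\xi_0,\xi_1,\xi_2,\xi_3)=(0,0,-1,1)$; $\Omega=\sum_{\nu=0}^{\rho}\mathbb Z\omega_\nu$; $|\omega|=\sum_{\nu=0}^{\rho}\omega_\nu$. Let $g_0,\dots,g_{2\rho+1}\in\mathbb R$, $|g|=\sum_\nu g_\nu$, $\Lambda=\{1,-1,1/\lambda,-1/\lambda\}$, $N\ge 0$, $m\in\Lambda^N$, $|m|=\sum_J m_J$, and $B=2\lambda|m|+|g|-\frac12(\rho+1)(\lambda+1)$. Assume that no nonzero integer multiple of $i\beta/\mu$, $\mu\in\Lambda$, lies in $\Omega$, and that $i(1-\lambda)\beta\notin\Omega$.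 Put $d(g,\mu)=g$ if $\mu\in\{1,1/\lambda\}$ and $d(g,\mu)=g-\frac{\lambda+1}2$ otherwise, $$f_\pm(x;\mu,\mu')=\frac{s\bigl(x\mp i(\mu-\mu')(\lambda\mu\mu'-1)\beta/4\mu\mu'\mp i\lambda\mu'\beta\bigr)}{s\bigl(x\mp i(\mu-\mu')(\lambda\mu\mu'-1)\beta/4\mu\mu'\bigr)},$$ $$V_J^\pm(X)=\frac{\prod_{\nu=0}^{2\rho+1}s(\pm X_J-i\,d(g_\nu,m_J)\beta)}{s(\pm2X_J)\,s(\pm2X_J-i\beta/m_J)}\prod_{K\ne J}\prod_{\delta=\pm}f_\pm(X_J+\delta X_K;m_J,m_K),$$ and, with $A_J^{\mp}=\frac i4[\lambda(m_J\mp1)+\frac1{m_J}\pm1]\beta$, $$V^0(X)=-\frac14\Bigl(\prod_{\nu=1}^\rho s(\tfrac{\omega_\nu}2)\Bigr)^2\sum_{\nu=0}^\rho\frac{e^{-r\xi_\nu B\beta}}{\prod_{\mu\ne\nu}s(\frac{\omega_\nu-\omega_\mu}2)}\Bigl(\frac{\prod_{\mu=0}^{2\rho+1}s(\frac{\omega_\nu+i\beta}2-ig_\mu\beta)}{\prod_{\mu=0}^{\rho}s(\frac{\omega_\nu-\omega_\mu+i(1-\lambda)\beta}2)}\prod_{\delta=\pm}\prod_J\frac{s(\delta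 X_J+\frac{\omega_\nu}2+A_J^--i\lambda m_J\beta)}{s(\delta X_J+\frac{\omega_\nu}2+A_J^-)}+\frac{\prod_{\mu=0}^{2\rho+1}s(\frac{\omega_\nu+i\lambda\beta}2-ig_\mu\beta)}{\prod_{\mu=0}^{\rho}s(\frac{\omega_\nu-\omega_\mu+i(\lambda-1)\beta}2)}\prod_{\delta=\pm}\prod_J\frac{s(\delta X_J+\frac{\omega_\nu}2+A_J^+-i\lambda m_J\beta)}{s(\delta X_J+\frac{\omega_\nu}2+A_J^+)}\Bigr).$$ The generalized Koornwinder–van Diejen operator is $$H=\sum_{\varepsilon=\pm}\sum_{J=1}^N s(i\lambda m_J\beta)\,V_J^{\varepsilon}(X)^{1/2}\exp\Bigl(-\varepsilon\frac{i\beta}{m_J}\frac{\partial}{\partial X_J}\Bigr)V_J^{-\varepsilon}(X)^{1/2}+V^0(X),$$ where $\exp(-\varepsilon\frac{i\beta}{m_J}\partial_{X_J})$ replaces $X_J$ by $X_J-\varepsilon i\beta/m_J$. For every $\alpha\in\mathbb C$ with $\Re\alpha\ne0$ let $G(\cdot\,;\alpha)$ be any meromorphic function with $G(x+\frac{i\alpha}2;\alpha)/G(x-\frac{i\alpha}2;\alpha)=c\,s(x)$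 for some constant $c=c(\alpha)\neq0$, and let $$\Phi(X)=\prod_J\psi(X_J;m_J)\prod_{J<K}\prod_{\varepsilon,\varepsilon'=\pm}\phi(\varepsilon X_J+\varepsilon'X_K;m_J,m_K),$$ $$\psi(x;\mu)=\Bigl(\frac{G(2x+\frac{i\beta}{2\mu};\frac\beta\mu)\,G(-2x+\frac{i\beta}{2\mu};\frac\beta\mu)}{\prod_{\nu=0}^{2\rho+1}G(x+\frac{i\beta}{2\mu}-i\,d(g_\nu,\mu)\beta;\frac\beta\mu)\,G(-x+\frac{i\beta}{2\mu}-i\,d(g_\nu,\mu)\beta;\frac\beta\mu)}\Bigr)^{1/2},$$ and let $\phi(x;\mu,\mu')$ be $\bigl(G(x+\frac{i\beta}{2\mu};\frac\beta\mu)/G(x-i\lambda\mu\beta+\frac{i\beta}{2\mu};\frac\beta\mu)\bigr)^{1/2}$ if $\mu'=\mu$, $G(x-\frac{i\lambda\mu\beta}2;\frac\beta\mu)$ if $\mu'=-\mu$, $s(x)^{1/2}$ if $\mu'=\frac1{\lambda\mu}$, and $s(x-\frac{i\lambda\mu\beta}2+\frac{i\beta}{2\mu})^{-1/2}$ if $\mu'=-\frac1{\lambda\mu}$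 (the first case that applies). Let $U\subseteq\mathbb C^N$ be a nonempty open set of regular points: at each $X\in U$ the coefficients $V^0$, $V_J^\pm$ have no singularity at the arguments at which the equation below evaluates them, and $\Phi^2$ is regular and nonzero at $X$ and at the points obtained from $X$ by replacing one $X_J$ by $X_J\pm i\beta/m_J$. Let $\Phi$ and $(V_J^+)^{1/2}$ be any continuous branches of the square roots of $\Phi^2$ and $V_J^+$ at the arguments occurring in the equation. Consider the assertion that, for suitable continuous branches of $(V_J^-)^{1/2}$ at the arguments occurring in the equation, $$\Bigl(H-\Bigl[\tfrac12\prod_{\nu=1}^{\rho}s(\tfrac{\omega_\nu}2)\Bigr]^2 s\bigl(i\beta B-|\omega|\bigr)\Bigr)\Phi(X)=0\qquad\text{for all }X\in U.\tag{$*$}$$ In the rational (I), trigonometric (II) and hyperbolic (III) cases, $(*)$ holds. In the elliptic case (IV), $(*)$ holds if the balancing condition $$2\lambda\sum_J m_J+\sum_{\nu=0}^7 g_\nu-2(\lambda+1)=0$$ is satisfied; conversely, if $N\ge1$ and $(*)$ holds, then the balancing condition is satisfied. -/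

import Mathlib

open scoped Topology

namespace Koornwinder

noncomputable section

/-- The four cases (I)-(IV). -/
inductive Kind
  | rational
  | trigonometric
  | hyperbolic
  | elliptic

/-- The number `ρ`: the half-periods are `ω_ν / 2` with `0 ≤ ν ≤ ρ`. -/
def Kind.rho : Kind → ℕ
  | .rational => 0
  | .trigonometric => 1
  | .hyperbolic => 1
  | .elliptic => 3

/-- The parameters of the model: the case, the real numbers `r`, `a` entering `s`, the relativistic
deformation parameter `β`, and the real couplings `λ` and `g_0, …, g_{2ρ+1}`. -/
structure Model where
  kind : Kind
  r : ℝ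
  a : ℝ
  beta : ℝ
  lam : ℝ
  g : Fin (2 * kind.rho + 2) → ℝ

/-- The odd Jacobi theta function
`ϑ₁(z | τ) = -i ∑_{n ∈ ℤ} (-1)^n exp(iπτ (n + 1/2)²) exp((2n+1) i z)
           = 2 ∑_{n ≥ 0} (-1)^n exp(iπτ (n + 1/2)²) sin((2n+1) z)`,
through Mathlib's two-variable theta function `∑_{n ∈ ℤ} exp(2πi n w + πi n² τ)`. -/
def theta1 (z τ : ℂ) : ℂ :=
  -Complex.I * Complex.exp (Real.pi * Complex.I * τ / 4 + Complex.I * z) *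
    jacobiTheta₂ (z / Real.pi + 1 / 2 + τ / 2) τ

/-- `G` is a Gamma function for the step `α`: a meromorphic solution of
`G(x + iα/2) / G(x - iα/2) = c s(x)` for some nonzero constant `c`, as an identity of meromorphic
functions, that is, off a closed discrete set. (The identity forces `G` not to vanish
identically.) -/
def IsGammaFunction (s : ℂ → ℂ) (α : ℂ) (G : ℂ → ℂ) : Prop :=
  Meromorphic G ∧ ∃ c : ℂ, c ≠ 0 ∧ ∀ᶠ x in Filter.codiscrete ℂ,
    G (x + Complex.I * α / 2) / G (x - Complex.I * α / 2) = c * s x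

/-- `R` is a continuous branch of the square root of `F` on `D`. -/
def IsSqrtBranch {N : ℕ} (F : (Fin N → ℂ) → ℂ) (D : Set (Fin N → ℂ)) (R : (Fin N → ℂ) → ℂ) : Prop :=
  ContinuousOn R D ∧ ∀ X ∈ D, R X ^ 2 = F X

namespace Model

variable (M : Model)

/-- The function `s(x)`. -/
def s (x : ℂ) : ℂ :=
  match M.kind with
  | .rational => x
  | .trigonometric => 1 / M.r * Complex.sin (M.r * x)
  | .hyperbolic => M.a / Real.pi * Complex.sinh (Real.pi * x / M.a)
  | .elliptic =>
      1 / M.r * Complex.exp (M.r * M.a / 4) * theta1 (M.r * x) (Complex.I * M.r * M.a / Real.pi)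

/-- `ω_1`. -/
def omega1 : ℂ :=
  match M.kind with
  | .hyperbolic => Complex.I * M.a
  | _ => Real.pi / M.r

/-- `ω_0, ω_1, ω_2, ω_3`; only those with index at most `ρ` are used. -/
def omega : ℕ → ℂ
  | 0 => 0
  | 1 => M.omega1
  | 2 => Complex.I * M.a
  | _ => -M.omega1 - Complex.I * M.a

/-- `ξ_0, ξ_1, ξ_2, ξ_3`. -/
def xi : ℕ → ℝ
  | 0 => 0
  | 1 => 0
  | 2 => -1
  | _ => 1

/-- The group `Ω` generated by the `ω_ν`, `0 ≤ ν ≤ ρ`. -/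
def Omega : AddSubgroup ℂ :=
  AddSubgroup.closure {z | ∃ ν ≤ M.kind.rho, z = M.omega ν}

/-- The set `Λ` of admissible masses. -/
def masses : Set ℝ :=
  {1, -1, -1 / M.lam, 1 / M.lam}

/-- `d(g, m)`. -/
def d (g m : ℝ) : ℝ :=
  if m = 1 ∨ m = 1 / M.lam then g else g - (M.lam + 1) / 2

/-- `f_ε(x; m, m')` for `ε = ±1`. -/
def f (ε : ℤ) (x : ℂ) (m m' : ℝ) : ℂ :=
  M.s (x - ε * Complex.I * (m - m') * (M.lam * m * m' - 1) * M.beta / (4 * m * m')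
      - ε * Complex.I * M.lam * m' * M.beta) /
    M.s (x - ε * Complex.I * (m - m') * (M.lam * m * m' - 1) * M.beta / (4 * m * m'))

variable {N : ℕ} (m : Fin N → ℝ)

/-- The coefficient `V^ε_J(X; m)` for `ε = ±1`. -/
def V (ε : ℤ) (J : Fin N) (X : Fin N → ℂ) : ℂ :=
  (∏ ν, M.s (ε * X J - Complex.I * M.d (M.g ν) (m J) * M.beta)) /
      (M.s (ε * 2 * X J) * M.s (ε * 2 * X J - Complex.I * M.beta / m J)) *
    ∏ K ∈ Finset.univ.erase J, ∏ δ ∈ ({1, -1} : Finset ℤ), M.f ε (X J + δ * X K) (m J) (m K)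

/-- `2λ ∑_J m_J + ∑_ν g_ν - (ρ+1)(λ+1)/2`. -/
def balance : ℝ :=
  2 * M.lam * ∑ J, m J + ∑ ν, M.g ν - ((M.kind.rho : ℝ) + 1) * (M.lam + 1) / 2

/-- `∏_{ν=1}^{ρ} s(ω_ν / 2)`. -/
def halfPeriodProd : ℂ :=
  ∏ ν ∈ Finset.Icc 1 M.kind.rho, M.s (M.omega ν / 2)

/-- The coefficient `V^0(X; m)`. -/
def V0 (X : Fin N → ℂ) : ℂ :=
  -(1 / 4) * M.halfPeriodProd ^ 2 *
    ∑ ν ∈ Finset.range (M.kind.rho + 1),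
      Complex.exp (-M.r * xi ν * M.balance m * M.beta) /
          (∏ μ ∈ (Finset.range (M.kind.rho + 1)).erase ν, M.s ((M.omega ν - M.omega μ) / 2)) *
        ((∏ κ, M.s (M.omega ν / 2 + Complex.I * M.beta / 2 - Complex.I * M.g κ * M.beta)) /
            (∏ μ ∈ Finset.range (M.kind.rho + 1),
              M.s ((M.omega ν - M.omega μ + Complex.I * (1 - M.lam) * M.beta) / 2)) *
            (∏ δ ∈ ({1, -1} : Finset ℤ), ∏ J,
              M.s (δ * X J + M.omega ν / 2
                  + Complex.I / 4 * (M.lam * (m J - 1) + 1 / m J + 1) * M.beta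
                  - Complex.I * M.lam * m J * M.beta) /
                M.s (δ * X J + M.omega ν / 2
                  + Complex.I / 4 * (M.lam * (m J - 1) + 1 / m J + 1) * M.beta))
          + (∏ κ, M.s (M.omega ν / 2 + Complex.I * M.lam * M.beta / 2
                - Complex.I * M.g κ * M.beta)) /
            (∏ μ ∈ Finset.range (M.kind.rho + 1),
              M.s ((M.omega ν - M.omega μ + Complex.I * (M.lam - 1) * M.beta) / 2)) *
            (∏ δ ∈ ({1, -1} : Finset ℤ), ∏ J,
              M.s (δ * X J + M.omega ν / 2
                  + Complex.I / 4 * (M.lam * (m J + 1) + 1 / m J - 1) * M.beta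
                  - Complex.I * M.lam * m J * M.beta) /
                M.s (δ * X J + M.omega ν / 2
                  + Complex.I / 4 * (M.lam * (m J + 1) + 1 / m J - 1) * M.beta)))

/-- The argument shift of `exp(-ε i (β / m_J) ∂/∂X_J)`: replace `X_J` by `X_J - ε i β / m_J`. -/
def shift (ε : ℤ) (J : Fin N) (X : Fin N → ℂ) : Fin N → ℂ :=
  Function.update X J (X J - ε * Complex.I * M.beta / m J)

/-- The operator `H(X; m)` applied to `Φ`, where `Rp J` and `Rm J` are the chosen square roots of
`V^+_J` and `V^-_J`. -/
def H (Rp Rm : Fin N → (Fin N → ℂ) → ℂ) (Φ : (Fin N → ℂ) → ℂ) (X : Fin N → ℂ) : ℂ :=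
  ∑ J, M.s (Complex.I * M.lam * m J * M.beta) *
      (Rp J X * (Rm J (M.shift m 1 J X) * Φ (M.shift m 1 J X))
        + Rm J X * (Rp J (M.shift m (-1) J X) * Φ (M.shift m (-1) J X)))
    + M.V0 m X * Φ X

/-- The eigenvalue. -/
def eigenvalue : ℂ :=
  (M.halfPeriodProd / 2) ^ 2 *
    M.s (Complex.I * M.beta * M.balance m - ∑ ν ∈ Finset.range (M.kind.rho + 1), M.omega ν)

variable (G : ℂ → ℂ → ℂ)

/-- The square of `ψ(x; m)`. -/
def psiSq (x : ℂ) (m : ℝ) : ℂ :=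
  (G (2 * x + Complex.I * M.beta / (2 * m)) (M.beta / m) *
      G (-2 * x + Complex.I * M.beta / (2 * m)) (M.beta / m)) /
    ∏ ν, (G (x + Complex.I * M.beta / (2 * m) - Complex.I * M.d (M.g ν) m * M.beta) (M.beta / m) *
      G (-x + Complex.I * M.beta / (2 * m) - Complex.I * M.d (M.g ν) m * M.beta) (M.beta / m))

/-- The square of `φ(x; m, m')`. -/
def phiSq (x : ℂ) (m m' : ℝ) : ℂ :=
  if m' = m then
    G (x + Complex.I * M.beta / (2 * m)) (M.beta / m) /
      G (x - Complex.I * M.lam * m * M.beta + Complex.I * M.beta / (2 * m)) (M.beta / m)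
  else if m' = -m then
    G (x - Complex.I * M.lam * m * M.beta / 2) (M.beta / m) ^ 2
  else if m' = 1 / (M.lam * m) then
    M.s x
  else
    (M.s (x - Complex.I * M.lam * m * M.beta / 2 + Complex.I * M.beta / (2 * m)))⁻¹

/-- The square of `Φ(X; m)`, a single-valued meromorphic function. -/
def PhiSq (X : Fin N → ℂ) : ℂ :=
  (∏ J, M.psiSq G (X J) (m J)) *
    ∏ J, ∏ K ∈ Finset.univ.filter (fun K => J < K),
      ∏ ε ∈ ({1, -1} : Finset ℤ), ∏ ε' ∈ ({1, -1} : Finset ℤ),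
        M.phiSq G (ε * X J + ε' * X K) (m J) (m K)

/-- `X` is a regular point of the eigenvalue equation: the coefficients have no singularity at the
arguments where the equation evaluates them, and `Φ²` is regular and nonzero at `X` and at the
shifted arguments. (With the convention `1 / 0 = 0`, a pole is a point of discontinuity.) -/
structure Regular (X : Fin N → ℂ) : Prop where
  potential : ContinuousAt (M.V0 m) X
  coeff : ∀ J, ∀ ε ∈ ({1, -1} : Finset ℤ), ContinuousAt (M.V m ε J) X
  coeff_shift : ∀ J, ∀ ε ∈ ({1, -1} : Finset ℤ), ContinuousAt (M.V m (-ε) J) (M.shift m ε J X)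
  phi : ContinuousAt (M.PhiSq m G) X ∧ M.PhiSq m G X ≠ 0
  phi_shift : ∀ J, ∀ ε ∈ ({1, -1} : Finset ℤ),
    ContinuousAt (M.PhiSq m G) (M.shift m ε J X) ∧ M.PhiSq m G (M.shift m ε J X) ≠ 0

/-- All points of `U` and all their shifts: the arguments of `Φ` in the equation on `U`. -/
def shiftClosure (U : Set (Fin N → ℂ)) : Set (Fin N → ℂ) :=
  U ∪ ⋃ J, (M.shift m 1 J '' U ∪ M.shift m (-1) J '' U)

/-- The source identity `(H - E) Φ = 0` on `U`, for the branches `Φ` and `Rp J` of the square roots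
of `Φ²` and `V^+_J`, and suitable continuous branches of the square roots of the `V^-_J` on the
arguments where the equation evaluates them. -/
def SourceIdentity (U : Set (Fin N → ℂ)) (Φ : (Fin N → ℂ) → ℂ)
    (Rp : Fin N → (Fin N → ℂ) → ℂ) : Prop :=
  ∃ Rm : Fin N → (Fin N → ℂ) → ℂ,
    (∀ J, IsSqrtBranch (M.V m (-1) J) (U ∪ M.shift m 1 J '' U) (Rm J)) ∧
    ∀ X ∈ U, M.H m Rp Rm Φ X - M.eigenvalue m * Φ X = 0

end Model

end

end Koornwinder

/-! ### Theta functions: product formula, parity, quasi-periodicity, addition formula. -/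

namespace Koornwinder

/-! The proof reduces the eigenvalue equation to an identity between coefficients. The function Φ²
is built so that V_J^+ Φ² at X equals V_J^- Φ² at the point with X_J moved by -iβ/m_J
(`detailed_balance`). This relation dictates a branch of the square root of V_J^-; with it every
hopping term becomes V_J^± Φ, and dividing by Φ leaves Σ_J s(iλm_Jβ)(V_J^+ + V_J^-) + V^0 = E
(`sum_V_add_V0`).

The latter is a single partial fraction expansion. Its nodes are ±X_J shifted by -iβ(λm_J +
1/m_J)/4, together with ω_ν/2 ± i(λ-1)β/4. The terms at the former give V_J^±, those at the latter
give V^0, and the value of the expansion gives E. The masses enter only through λμ + 1/μ = ±(λ+1)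
and λμ - 1/μ = ±(λ-1), which hold on Λ: the first unifies the cases of d(g,μ), the second lets the
duplication formula collapse the half-period factors.

The expansion (`nodeSum_eq`) follows by induction on the number of nodes from Weierstrass'
three-term relation. If s(x+y)s(x-y) = A(x) - A(y), as in cases (I)-(III), it is unconditional; in
the theta case the nodes and the zeros of the numerator must have equal sums, and since there Σω_ν =
0 this is B = 0, the balancing condition.

The functional equations of G hold only off discrete sets. They are carried to N variables along
linear forms through the residual filter, and then to every regular point by Baire density and
continuity.

For the converse, translate one X_J by ia. The coefficient V_J^+ is multiplied by q = exp(-2rβB),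
V_J^- by 1/q, and all other terms are unchanged. Detailed balance fixes the hopping terms up to
sign, so a signed form of the coefficient identity holds at three successive translates. If B ≠ 0,
then 1, q, 1/q are distinct and V_J^+ would have to vanish at a point where it does not. -/

theorem hasSum_mul_int {f g : ℤ → ℂ} {a b : ℂ} (hf : HasSum f a) (hg : HasSum g b) :
    HasSum (fun p : ℤ × ℤ => f p.1 * g p.2) (a * b) :=
  hf.mul hg (summable_mul_of_summable_norm hf.summable.norm hg.summable.norm)

/-- The product of two theta functions, split along the two cosets of the lattice
`{(p + q, p - q)}` in `ℤ × ℤ`. -/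
theorem jacobiTheta₂_mul (u v : ℂ) {τ : ℂ} (hτ : 0 < τ.im) :
    jacobiTheta₂ u τ * jacobiTheta₂ v τ =
      jacobiTheta₂ (u + v) (2 * τ) * jacobiTheta₂ (u - v) (2 * τ) +
        Complex.exp (2 * Real.pi * Complex.I * u + Real.pi * Complex.I * τ) *
          (jacobiTheta₂ (u + v + τ) (2 * τ) * jacobiTheta₂ (u - v + τ) (2 * τ)) := by
  have hprod : ∀ (x y : ℂ) {σ : ℂ}, 0 < σ.im →
      HasSum (fun p : ℤ × ℤ => jacobiTheta₂_term p.1 x σ * jacobiTheta₂_term p.2 y σ)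
        (jacobiTheta₂ x σ * jacobiTheta₂ y σ) := by
    intro x y σ hσ
    have h := hasSum_mul_int (hasSum_jacobiTheta₂_term x hσ) (hasSum_jacobiTheta₂_term y hσ)
    exact h
  have h2τ : 0 < (2 * τ).im := by simpa using hτ
  set F : ℤ × ℤ → ℂ := fun p => jacobiTheta₂_term p.1 u τ * jacobiTheta₂_term p.2 v τ with hF
  have heven : HasSum (fun p : ℤ × ℤ => if Even (p.1 + p.2) then F p else 0)
      (jacobiTheta₂ (u + v) (2 * τ) * jacobiTheta₂ (u - v) (2 * τ)) := by
    have hinj : Function.Injective (fun p : ℤ × ℤ => (p.1 + p.2, p.1 - p.2)) := by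
      rintro ⟨a, b⟩ ⟨c, d⟩ h
      simp only [Prod.mk.injEq] at h ⊢
      omega
    refine (hinj.hasSum_iff ?_).1 ?_
    · rintro ⟨a, b⟩ h
      rw [if_neg]
      rintro ⟨k, hk⟩
      exact h ⟨(k, a - k), by ext <;> simp only <;> simp only at hk <;> omega⟩
    · convert hprod (u + v) (u - v) h2τ using 2 with p
      have : Even (p.1 + p.2 + (p.1 - p.2)) := ⟨p.1, by ring⟩
      simp only [Function.comp, this, if_true, hF, jacobiTheta₂_term, ← Complex.exp_add]
      congr 1
      push_cast
      ring
  have hodd : HasSum (fun p : ℤ × ℤ => if Even (p.1 + p.2) then 0 else F p)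
      (Complex.exp (2 * Real.pi * Complex.I * u + Real.pi * Complex.I * τ) *
          (jacobiTheta₂ (u + v + τ) (2 * τ) * jacobiTheta₂ (u - v + τ) (2 * τ))) := by
    have hinj : Function.Injective (fun p : ℤ × ℤ => (p.1 + p.2 + 1, p.1 - p.2)) := by
      rintro ⟨a, b⟩ ⟨c, d⟩ h
      simp only [Prod.mk.injEq] at h ⊢
      omega
    refine (hinj.hasSum_iff ?_).1 ?_
    · rintro ⟨a, b⟩ h
      rw [if_pos]
      by_contra hne
      obtain ⟨k, hk⟩ := Int.not_even_iff_odd.1 hne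
      exact h ⟨(k, a - k - 1), by ext <;> simp only <;> simp only at hk <;> omega⟩
    · have h := (hprod (u + v + τ) (u - v + τ) h2τ).mul_left
        (Complex.exp (2 * Real.pi * Complex.I * u + Real.pi * Complex.I * τ))
      suffices e : ∀ p : ℤ × ℤ, Complex.exp (2 * Real.pi * Complex.I * u + Real.pi * Complex.I * τ) *
          (jacobiTheta₂_term p.1 (u + v + τ) (2 * τ) * jacobiTheta₂_term p.2 (u - v + τ) (2 * τ)) =
          ((fun p : ℤ × ℤ => if Even (p.1 + p.2) then 0 else F p) ∘
            fun p : ℤ × ℤ => (p.1 + p.2 + 1, p.1 - p.2)) p by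
        rw [funext e] at h
        exact h
      intro p
      have : ¬ Even (p.1 + p.2 + 1 + (p.1 - p.2)) :=
        Int.not_even_iff_odd.2 ⟨p.1, by ring⟩
      simp only [Function.comp, this, if_false, hF, jacobiTheta₂_term, ← Complex.exp_add]
      congr 1
      push_cast
      ring
  refine (hprod u v hτ).unique ?_
  convert heven.add hodd using 2 with p
  simp only [hF]
  split_ifs <;> simp

section Theta

variable {z τ : ℂ}

theorem theta1_neg (z τ : ℂ) : theta1 (-z) τ = -theta1 z τ := by
  have h1 : jacobiTheta₂ (-z / Real.pi + 1 / 2 + τ / 2) τ =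
      jacobiTheta₂ (z / Real.pi + 1 / 2 + τ / 2 - 1 - τ) τ := by
    rw [← jacobiTheta₂_neg_left]; congr 1; ring
  have h2 := jacobiTheta₂_add_left' (z / Real.pi + 1 / 2 + τ / 2 - 1 - τ) τ
  have h3 := jacobiTheta₂_add_left (z / Real.pi + 1 / 2 + τ / 2 - 1) τ
  rw [sub_add_cancel] at h2 h3
  rw [theta1, theta1, h1, h3, h2]
  have hpi : (Real.pi : ℂ) ≠ 0 := by exact_mod_cast Real.pi_ne_zero
  have h4 : Complex.exp (Real.pi * Complex.I * τ / 4 + Complex.I * z) *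
      Complex.exp (-Real.pi * Complex.I * (τ + 2 * (z / Real.pi + 1 / 2 + τ / 2 - 1 - τ))) =
      - Complex.exp (Real.pi * Complex.I * τ / 4 + Complex.I * -z) := by
    rw [← Complex.exp_add, ← Complex.exp_antiperiodic]
    congr 1
    field_simp
    ring
  linear_combination -Complex.I * jacobiTheta₂ (z / Real.pi + 1 / 2 + τ / 2 - 1 - τ) τ * h4

theorem theta1_add_pi (z τ : ℂ) : theta1 (z + Real.pi) τ = -theta1 z τ := by
  have hpi : (Real.pi : ℂ) ≠ 0 := by exact_mod_cast Real.pi_ne_zero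
  have h1 : (z + Real.pi) / Real.pi + 1 / 2 + τ / 2 = z / Real.pi + 1 / 2 + τ / 2 + 1 := by
    field_simp
    ring
  have h2 : Complex.exp (Real.pi * Complex.I * τ / 4 + Complex.I * (z + Real.pi)) =
      -Complex.exp (Real.pi * Complex.I * τ / 4 + Complex.I * z) := by
    rw [← Complex.exp_antiperiodic]
    congr 1
    ring
  rw [theta1, theta1, h1, jacobiTheta₂_add_left, h2]
  ring

theorem theta1_add_pi_mul (z τ : ℂ) :
    theta1 (z + Real.pi * τ) τ =
      -Complex.exp (-(Real.pi * Complex.I * τ) - 2 * Complex.I * z) * theta1 z τ := by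
  have hpi : (Real.pi : ℂ) ≠ 0 := by exact_mod_cast Real.pi_ne_zero
  have h1 : (z + Real.pi * τ) / Real.pi + 1 / 2 + τ / 2 = z / Real.pi + 1 / 2 + τ / 2 + τ := by
    field_simp
    ring
  have h2 : Complex.exp (Real.pi * Complex.I * τ / 4 + Complex.I * (z + Real.pi * τ)) *
      Complex.exp (-Real.pi * Complex.I * (τ + 2 * (z / Real.pi + 1 / 2 + τ / 2))) =
      -Complex.exp (-(Real.pi * Complex.I * τ) - 2 * Complex.I * z) *
        Complex.exp (Real.pi * Complex.I * τ / 4 + Complex.I * z) := by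
    rw [neg_mul (Complex.exp _), ← Complex.exp_add, ← Complex.exp_add, ← Complex.exp_antiperiodic,
      Complex.exp_eq_exp_iff_exists_int]
    refine ⟨-1 , ?_⟩
    field_simp
    push_cast
    ring
  rw [theta1, theta1, h1, jacobiTheta₂_add_left']
  linear_combination -Complex.I * jacobiTheta₂ (z / Real.pi + 1 / 2 + τ / 2) τ * h2

theorem differentiable_theta1 (hτ : 0 < τ.im) : Differentiable ℂ (fun z => theta1 z τ) := by
  intro z
  unfold theta1
  have h : DifferentiableAt ℂ (fun z : ℂ => jacobiTheta₂ (z / Real.pi + 1 / 2 + τ / 2) τ) z :=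
    (differentiableAt_jacobiTheta₂_fst _ hτ).comp z (by fun_prop)
  exact DifferentiableAt.mul (by fun_prop) h

/-- For purely imaginary modulus every term of the series at 0 is positive. This is what shows that
`theta1`, and hence the elliptic s, is not identically zero. -/
theorem jacobiTheta₂_zero_I_mul_ne_zero {t : ℝ} (ht : 0 < t) :
    jacobiTheta₂ 0 (Complex.I * t) ≠ 0 := by
  have hτ : 0 < (Complex.I * t : ℂ).im := by simpa using ht
  have h := hasSum_jacobiTheta₂_term 0 hτ
  have hre : ∀ n : ℤ, (jacobiTheta₂_term n 0 (Complex.I * t)).re = Real.exp (-(Real.pi * n ^ 2 * t)) := by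
    intro n
    rw [jacobiTheta₂_term, ← Complex.exp_ofReal_re]
    congr 2
    push_cast
    linear_combination (Real.pi * n ^ 2 * t : ℂ) * Complex.I_sq
  have h' := Complex.hasSum_re h
  simp only [hre] at h'
  have hpos : 0 < (jacobiTheta₂ 0 (Complex.I * t)).re :=
    h'.tsum_eq ▸ h'.summable.tsum_pos (fun _ => (Real.exp_pos _).le) 0 (Real.exp_pos _)
  intro h0
  simp [h0] at hpos

theorem exists_theta1_ne_zero {t : ℝ} (ht : 0 < t) : ∃ z, theta1 z (Complex.I * t) ≠ 0 := by
  have hpi : (Real.pi : ℂ) ≠ 0 := by exact_mod_cast Real.pi_ne_zero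
  refine ⟨-(Real.pi * (1 / 2 + Complex.I * t / 2)), ?_⟩
  have : (-(Real.pi * (1 / 2 + Complex.I * t / 2)) / Real.pi + 1 / 2 + Complex.I * t / 2 : ℂ) = 0 := by
    field_simp
    ring
  rw [theta1, this]
  exact mul_ne_zero (mul_ne_zero (by simp) (Complex.exp_ne_zero _))
    (jacobiTheta₂_zero_I_mul_ne_zero ht)

/-- In the product formula the sum of the two arguments involves only x and their difference only y,
so the product is a 2×2 determinant in two functions of one variable. This is the shape required by
`weierstrass_of_det`. -/
theorem theta1_add_mul_theta1_sub (x y : ℂ) (hτ : 0 < τ.im) :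
    theta1 (x + y) τ * theta1 (x - y) τ =
      -Complex.exp (Real.pi * Complex.I * τ / 2) *
        (Complex.exp (2 * Complex.I * x) * jacobiTheta₂ (2 * x / Real.pi + τ) (2 * τ) *
            jacobiTheta₂ (2 * y / Real.pi) (2 * τ) -
          jacobiTheta₂ (2 * x / Real.pi) (2 * τ) *
            (Complex.exp (2 * Complex.I * y) * jacobiTheta₂ (2 * y / Real.pi + τ) (2 * τ))) := by
  have hpi : (Real.pi : ℂ) ≠ 0 := by exact_mod_cast Real.pi_ne_zero
  have h := jacobiTheta₂_mul ((x + y) / Real.pi + 1 / 2 + τ / 2)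
    ((x - y) / Real.pi + 1 / 2 + τ / 2) hτ
  have e1 : (x + y) / Real.pi + 1 / 2 + τ / 2 + ((x - y) / Real.pi + 1 / 2 + τ / 2) =
      2 * x / Real.pi + τ + 1 := by ring
  have e2 : (x + y) / Real.pi + 1 / 2 + τ / 2 - ((x - y) / Real.pi + 1 / 2 + τ / 2) =
      2 * y / Real.pi := by ring
  have e3 : 2 * x / Real.pi + τ + 1 + τ = 2 * x / Real.pi + 2 * τ + 1 := by ring
  rw [e1, e2, e3, jacobiTheta₂_add_left, jacobiTheta₂_add_left, jacobiTheta₂_add_left'] at h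
  have h1 : Complex.exp (Real.pi * Complex.I * τ / 4 + Complex.I * (x + y)) *
      Complex.exp (Real.pi * Complex.I * τ / 4 + Complex.I * (x - y)) =
      Complex.exp (Real.pi * Complex.I * τ / 2) * Complex.exp (2 * Complex.I * x) := by
    rw [← Complex.exp_add, ← Complex.exp_add]; congr 1; ring
  have h2 : Complex.exp (2 * Complex.I * x) *
      (Complex.exp (2 * Real.pi * Complex.I * ((x + y) / Real.pi + 1 / 2 + τ / 2) +
        Real.pi * Complex.I * τ) *
      Complex.exp (-Real.pi * Complex.I * (2 * τ + 2 * (2 * x / Real.pi)))) =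
      -Complex.exp (2 * Complex.I * y) := by
    rw [← Complex.exp_antiperiodic, ← Complex.exp_add, ← Complex.exp_add]
    congr 1
    field_simp
    ring
  rw [theta1, theta1]
  linear_combination (-Complex.exp (Real.pi * Complex.I * τ / 2) * Complex.exp (2 * Complex.I * x)) * h
    - jacobiTheta₂ ((x + y) / Real.pi + 1 / 2 + τ / 2) τ *
      jacobiTheta₂ ((x - y) / Real.pi + 1 / 2 + τ / 2) τ * h1
    - Complex.exp (Real.pi * Complex.I * τ / 2) * jacobiTheta₂ (2 * x / Real.pi) (2 * τ) *
      jacobiTheta₂ (2 * y / Real.pi + τ) (2 * τ) * h2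
    + Complex.exp (Real.pi * Complex.I * τ / 4 + Complex.I * (x + y)) *
      Complex.exp (Real.pi * Complex.I * τ / 4 + Complex.I * (x - y)) *
      jacobiTheta₂ ((x + y) / Real.pi + 1 / 2 + τ / 2) τ *
      jacobiTheta₂ ((x - y) / Real.pi + 1 / 2 + τ / 2) τ * Complex.I_sq

end Theta

/-! ### The three-term relation and the zeros of its quasi-periodic solutions. -/

/-- The functions `s` with `s (x + y) s (x - y) = A x B y - B x A y` for some `A` and `B` satisfy
Weierstrass' three-term relation. -/
theorem weierstrass_of_det {s A B : ℂ → ℂ}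
    (h : ∀ x y, s (x + y) * s (x - y) = A x * B y - B x * A y) (x y u v : ℂ) :
    s (x + y) * s (x - y) * (s (u + v) * s (u - v)) +
      s (y + u) * s (y - u) * (s (x + v) * s (x - v)) +
      s (u + x) * s (u - x) * (s (y + v) * s (y - v)) = 0 := by
  -- What remains is the Plücker relation between the 2×2 minors of a 2×4 matrix.
  simp only [h]
  ring

theorem eventually_ne_zero_of_differentiable {s : ℂ → ℂ} (hs : Differentiable ℂ s)
    (hne : ∃ z, s z ≠ 0) (c : ℂ) : ∀ᶠ z in 𝓝[≠] c, s z ≠ 0 := by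
  have han : AnalyticOnNhd ℂ s Set.univ := fun z _ => hs.analyticAt z
  rcases (han c trivial).eventually_eq_zero_or_eventually_ne_zero with h | h
  · obtain ⟨z, hz⟩ := hne
    exact absurd (han.eqOn_zero_of_preconnected_of_eventuallyEq_zero isPreconnected_univ
      (Set.mem_univ c) h (Set.mem_univ z)) hz
  · exact h

/-- The zero set of an odd entire function satisfying the three-term relation and quasi-periodic
with respect to `p` and `q` in the manner of `ϑ₁` is contained in the period lattice. -/
theorem exists_eq_of_eq_zero_of_quasiperiodic {s : ℂ → ℂ} (hs : Differentiable ℂ s)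
    (hne : ∃ z, s z ≠ 0)
    (hW : ∀ x y u v : ℂ, s (x + y) * s (x - y) * (s (u + v) * s (u - v)) +
      s (y + u) * s (y - u) * (s (x + v) * s (x - v)) +
      s (u + x) * s (u - x) * (s (y + v) * s (y - v)) = 0)
    (hodd : ∀ x, s (-x) = -s x) {p q c : ℂ} (hp0 : p ≠ 0) (hp : ∀ x, s (x + p) = -s x)
    (hq : ∀ x, s (x + q) = -Complex.exp (c - 2 * Complex.I * (Real.pi / p) * x) * s x)
    {z₀ : ℂ} (hz₀ : s z₀ = 0) : ∃ k l : ℤ, z₀ = k * p + l * q := by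
  set h : ℂ → ℂ := fun z => s (z + z₀) with hh
  have hpi : (Real.pi : ℂ) ≠ 0 := by exact_mod_cast Real.pi_ne_zero
  have hdh : Differentiable ℂ h := hs.comp (by fun_prop : Differentiable ℂ fun z => z + z₀)
  -- The arguments of the three-term relation are chosen with u - x = z₀, so that one of the three
  -- products vanishes.
  have key : ∀ z w t, h (z + t) * h (w - t) * (s z * s w) =
      s (z + t) * s (w - t) * (h z * h w) := by
    intro z w t
    have := hW ((z + w) / 2) ((z - w) / 2 + t) ((z + w) / 2 + z₀) ((z - w) / 2)
    have e1 : (z + w) / 2 + ((z - w) / 2 + t) = z + t := by ring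
    have e2 : (z + w) / 2 - ((z - w) / 2 + t) = w - t := by ring
    have e3 : (z + w) / 2 + z₀ + (z - w) / 2 = z + z₀ := by ring
    have e4 : (z + w) / 2 + z₀ - (z - w) / 2 = w + z₀ := by ring
    have e5 : (z - w) / 2 + t + ((z + w) / 2 + z₀) = z + t + z₀ := by ring
    have e6 : (z - w) / 2 + t - ((z + w) / 2 + z₀) = -(w - t + z₀) := by ring
    have e7 : (z + w) / 2 + (z - w) / 2 = z := by ring
    have e8 : (z + w) / 2 - (z - w) / 2 = w := by ring
    have e9 : (z + w) / 2 + z₀ - (z + w) / 2 = z₀ := by ring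
    rw [e1, e2, e3, e4, e5, e6, e7, e8, e9, hodd, hz₀] at this
    simp only [hh]
    linear_combination -this
  obtain ⟨w, hw⟩ : ∃ w, s w ≠ 0 ∧ h w ≠ 0 := by
    refine ((eventually_ne_zero_of_differentiable hs hne 0).and
      (eventually_ne_zero_of_differentiable hdh ?_ 0)).exists
    obtain ⟨z, hz⟩ := hne
    exact ⟨z - z₀, by simpa [hh] using hz⟩
  obtain ⟨hsw, hhw⟩ := hw
  set κ : ℂ := deriv h w / h w - deriv s w / s w with hκ
  -- Differentiating `key` in t at 0 shows that the logarithmic derivatives of h and s differ by the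
  -- constant κ. The relation is kept free of denominators so that it holds at zeros too.
  have hder : ∀ z, deriv h z * s z - h z * deriv s z = κ * h z * s z := by
    intro z
    have hd : ∀ (f : ℂ → ℂ), Differentiable ℂ f → HasDerivAt (fun t => f (z + t) * f (w - t))
        (deriv f z * f w - f z * deriv f w) 0 := by
      intro f hf
      have h1 : HasDerivAt (fun t => f (z + t)) (deriv f z) 0 := by
        have : HasDerivAt f (deriv f z) (z + 0) := by simpa using (hf z).hasDerivAt
        simpa using this.comp_const_add z 0
      have h2 : HasDerivAt (fun t => f (w - t)) (-deriv f w) 0 := by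
        have : HasDerivAt f (deriv f w) (w - 0) := by simpa using (hf w).hasDerivAt
        simpa using this.comp_const_sub w 0
      refine (h1.mul h2).congr_deriv ?_
      simp only [add_zero, sub_zero]
      ring
    have h1 := (hd h hdh).mul_const (s z * s w)
    have h2 := (hd s hs).mul_const (h z * h w)
    have := h1.unique (by simpa only [key] using h2)
    rw [hκ]
    field_simp
    linear_combination this
  -- Hence h is s times an exponential: first near w, where s does not vanish, then everywhere by
  -- the identity theorem.
  obtain ⟨C, hC⟩ : ∃ C, ∀ z, h z = C * Complex.exp (κ * z) * s z := by
    refine ⟨h w / (Complex.exp (κ * w) * s w), ?_⟩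
    set C := h w / (Complex.exp (κ * w) * s w)
    have hnear : ∀ᶠ z in 𝓝 w, s z ≠ 0 := (hs w).continuousAt.eventually_ne hsw
    obtain ⟨ε, hε, hball⟩ := Metric.eventually_nhds_iff_ball.1 hnear
    have hconst : ∀ z ∈ Metric.ball w ε, h z / (Complex.exp (κ * z) * s z) = C := by
      intro z hz
      have hd : ∀ z ∈ Metric.ball w ε,
          HasDerivAt (fun z => h z / (Complex.exp (κ * z) * s z)) 0 z := by
        intro z hz
        have h1 : HasDerivAt (fun z => Complex.exp (κ * z) * s z)
            (Complex.exp (κ * z) * κ * s z + Complex.exp (κ * z) * deriv s z) z :=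
          (by simpa using ((hasDerivAt_id z).const_mul κ).cexp :
            HasDerivAt (fun z => Complex.exp (κ * z)) (Complex.exp (κ * z) * κ) z).mul
            (hs z).hasDerivAt
        refine ((hdh z).hasDerivAt.div h1
          (mul_ne_zero (Complex.exp_ne_zero _) (hball z hz))).congr_deriv ?_
        rw [div_eq_zero_iff]
        left
        linear_combination Complex.exp (κ * z) * hder z
      exact Metric.isOpen_ball.is_const_of_deriv_eq_zero (convex_ball w ε).isPreconnected
        (fun z hz => (hd z hz).differentiableAt.differentiableWithinAt)
        (fun z hz => (hd z hz).deriv) hz (Metric.mem_ball_self hε)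
    have hdiff : Differentiable ℂ fun z => h z - C * Complex.exp (κ * z) * s z := by fun_prop
    have hev : (fun z => h z - C * Complex.exp (κ * z) * s z) =ᶠ[𝓝 w] 0 := by
      filter_upwards [Metric.ball_mem_nhds w hε] with z hz
      rw [← hconst z hz]
      have := hball z hz
      have := Complex.exp_ne_zero (κ * z)
      simp only [Pi.zero_apply]
      field_simp
      ring
    intro z
    exact sub_eq_zero.1 (AnalyticOnNhd.eqOn_zero_of_preconnected_of_eventuallyEq_zero
      (fun z _ => hdiff.analyticAt z) isPreconnected_univ (Set.mem_univ w) hev (Set.mem_univ z))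
  have hC0 : C ≠ 0 := by
    rintro rfl
    exact hhw (by simpa using hC w)
  -- Both h and s change sign under translation by p, which forces κp ∈ 2πiℤ. Translation by q then
  -- determines z₀ modulo p, since the multiplier of h there contains z₀.
  have hp1 : Complex.exp (κ * p) = 1 := by
    have h1 := hC (w + p)
    have h2 : h (w + p) = -h w := by
      simp only [hh]
      rw [← hp]
      congr 1
      ring
    rw [h2, hp, mul_add κ, Complex.exp_add, hC w] at h1
    have h3 : C * Complex.exp (κ * w) * s w * (Complex.exp (κ * p) - 1) = 0 := by
      linear_combination h1
    simpa [hC0, hsw, sub_eq_zero, Complex.exp_ne_zero] using h3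
  obtain ⟨k, hk⟩ := Complex.exp_eq_one_iff.1 hp1
  have hq1 : Complex.exp (κ * q + 2 * Complex.I * (Real.pi / p) * z₀) = 1 := by
    have h1 := hC (w + q)
    have h2 : h (w + q) = -Complex.exp (c - 2 * Complex.I * (Real.pi / p) * (w + z₀)) * h w := by
      simp only [hh]
      rw [← hq]
      congr 1
      ring
    have h3 : Complex.exp (c - 2 * Complex.I * (Real.pi / p) * w) =
        Complex.exp (c - 2 * Complex.I * (Real.pi / p) * (w + z₀)) *
          Complex.exp (2 * Complex.I * (Real.pi / p) * z₀) := by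
      rw [← Complex.exp_add]
      congr 1
      ring
    rw [h2, hq, mul_add κ, Complex.exp_add, hC w, h3] at h1
    rw [Complex.exp_add]
    have h4 : C * Complex.exp (κ * w) * s w *
        Complex.exp (c - 2 * Complex.I * (Real.pi / p) * (w + z₀)) *
        (Complex.exp (κ * q) * Complex.exp (2 * Complex.I * (Real.pi / p) * z₀) - 1) = 0 := by
      linear_combination h1
    simpa [hC0, hsw, sub_eq_zero, Complex.exp_ne_zero] using h4
  obtain ⟨l, hl⟩ := Complex.exp_eq_one_iff.1 hq1
  refine ⟨l, -k, ?_⟩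
  have hκ' : κ = k * (2 * Real.pi * Complex.I) / p := by
    field_simp
    linear_combination hk
  rw [hκ'] at hl
  field_simp at hl
  have h2I : (2 * Complex.I : ℂ) ≠ 0 := by simp
  push_cast
  linear_combination hl
end Koornwinder

/-! ### The function s in the four cases: zeros, half-periods, duplication. -/

namespace Koornwinder.Model

variable {M : Model}

theorem rho_eq_of_ne_elliptic : M.kind ≠ Kind.elliptic → M.kind.rho ≤ 1 := by
  cases M.kind <;> simp [Kind.rho]

theorem s_rational (h : M.kind = .rational) (x : ℂ) : M.s x = x := by simp [s, h]

theorem s_trigonometric (h : M.kind = .trigonometric) (x : ℂ) :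
    M.s x = 1 / M.r * Complex.sin (M.r * x) := by simp [s, h]

theorem s_hyperbolic (h : M.kind = .hyperbolic) (x : ℂ) :
    M.s x = M.a / Real.pi * Complex.sinh (Real.pi * x / M.a) := by simp [s, h]

theorem s_elliptic (h : M.kind = .elliptic) (x : ℂ) :
    M.s x = 1 / M.r * Complex.exp (M.r * M.a / 4) *
      theta1 (M.r * x) (Complex.I * M.r * M.a / Real.pi) := by simp [s, h]

theorem nome_im_pos (hr : 0 < M.r) (ha : 0 < M.a) :
    0 < (Complex.I * M.r * M.a / Real.pi : ℂ).im := by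
  have : (Complex.I * M.r * M.a / Real.pi : ℂ) = ((M.r * M.a / Real.pi : ℝ) : ℂ) * Complex.I := by
    push_cast
    ring
  rw [this, Complex.im_ofReal_mul, Complex.I_im, mul_one]
  positivity

theorem s_neg (x : ℂ) : M.s (-x) = -M.s x := by
  cases h : M.kind
  · simp [s_rational h]
  · simp [s_trigonometric h]
  · simp [s_hyperbolic h, neg_div]
  · simp [s_elliptic h, theta1_neg]

theorem differentiable_s (hr : 0 < M.r) (ha : 0 < M.a) : Differentiable ℂ M.s := by
  cases h : M.kind
  · rw [funext (s_rational h)]; fun_prop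
  · rw [funext (s_trigonometric h)]; fun_prop
  · rw [funext (s_hyperbolic h)]; fun_prop
  · rw [funext (s_elliptic h)]
    exact ((differentiable_theta1 (nome_im_pos hr ha)).comp
      (by fun_prop : Differentiable ℂ fun x : ℂ => (M.r : ℂ) * x)).const_mul _

theorem exists_s_ne_zero (hr : 0 < M.r) (ha : 0 < M.a) : ∃ x, M.s x ≠ 0 := by
  have hr' : (M.r : ℂ) ≠ 0 := by exact_mod_cast hr.ne'
  have ha' : (M.a : ℂ) ≠ 0 := by exact_mod_cast ha.ne'
  have hpi : (Real.pi : ℂ) ≠ 0 := by exact_mod_cast Real.pi_ne_zero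
  cases h : M.kind
  · exact ⟨1, by simp [s_rational h]⟩
  · refine ⟨Real.pi / 2 / M.r, ?_⟩
    rw [s_trigonometric h, mul_div_cancel₀ _ hr', Complex.sin_pi_div_two]
    simp [hr']
  · refine ⟨Real.pi / 2 * Complex.I / Real.pi * M.a, ?_⟩
    rw [s_hyperbolic h]
    have : (Real.pi * (Real.pi / 2 * Complex.I / Real.pi * M.a) / M.a : ℂ) =
      Real.pi / 2 * Complex.I := by field_simp
    rw [this, Complex.sinh_mul_I, Complex.sin_pi_div_two]
    simp [ha', hpi]
  · obtain ⟨z, hz⟩ := exists_theta1_ne_zero (t := M.r * M.a / Real.pi) (by positivity)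
    refine ⟨z / M.r, ?_⟩
    rw [s_elliptic h, mul_div_cancel₀ _ hr']
    have : (Complex.I * M.r * M.a / Real.pi : ℂ) = Complex.I * ((M.r * M.a / Real.pi : ℝ) : ℂ) := by
      push_cast
      ring
    rw [this]
    exact mul_ne_zero (mul_ne_zero (by simp [hr']) (Complex.exp_ne_zero _)) hz

/-- The addition formula here has second function B = 1. This stronger form frees the partial
fraction identity from any condition on the sums, hence cases (I)-(III) from the balancing
condition. -/
theorem s_additive (h : M.kind ≠ .elliptic) :
    ∃ A : ℂ → ℂ, ∀ x y, M.s (x + y) * M.s (x - y) = A x - A y := by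
  cases hk : M.kind
  · exact ⟨fun x => x ^ 2, fun x y => by simp only [s_rational hk]; ring⟩
  · refine ⟨fun x => (1 / M.r * Complex.sin (M.r * x)) ^ 2, fun x y => ?_⟩
    simp only [s_trigonometric hk, mul_add, mul_sub, Complex.sin_add, Complex.sin_sub]
    have h1 := Complex.sin_sq_add_cos_sq (M.r * x)
    have h2 := Complex.sin_sq_add_cos_sq (M.r * y)
    linear_combination (1 / M.r : ℂ) ^ 2 * (Complex.sin (M.r * x) ^ 2 * h2 -
      Complex.sin (M.r * y) ^ 2 * h1)
  · refine ⟨fun x => (M.a / Real.pi * Complex.sinh (Real.pi * x / M.a)) ^ 2, fun x y => ?_⟩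
    simp only [s_hyperbolic hk, mul_add, mul_sub, add_div, sub_div, Complex.sinh_add,
      Complex.sinh_sub]
    have h1 := Complex.cosh_sq_sub_sinh_sq (Real.pi * x / M.a)
    have h2 := Complex.cosh_sq_sub_sinh_sq (Real.pi * y / M.a)
    linear_combination (M.a / Real.pi : ℂ) ^ 2 * (Complex.sinh (Real.pi * x / M.a) ^ 2 * h2 -
      Complex.sinh (Real.pi * y / M.a) ^ 2 * h1)
  · exact absurd hk h

theorem s_weierstrass (hr : 0 < M.r) (ha : 0 < M.a) (x y u v : ℂ) :
    M.s (x + y) * M.s (x - y) * (M.s (u + v) * M.s (u - v)) +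
      M.s (y + u) * M.s (y - u) * (M.s (x + v) * M.s (x - v)) +
      M.s (u + x) * M.s (u - x) * (M.s (y + v) * M.s (y - v)) = 0 := by
  by_cases h : M.kind = .elliptic
  · set τ : ℂ := Complex.I * M.r * M.a / Real.pi with hτ
    refine weierstrass_of_det
      (A := fun x => -(1 / M.r * Complex.exp (M.r * M.a / 4)) ^ 2 *
        Complex.exp (Real.pi * Complex.I * τ / 2) * (Complex.exp (2 * Complex.I * (M.r * x)) *
          jacobiTheta₂ (2 * (M.r * x) / Real.pi + τ) (2 * τ)))
      (B := fun x => jacobiTheta₂ (2 * (M.r * x) / Real.pi) (2 * τ)) (fun x y => ?_) x y u v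
    rw [s_elliptic h, s_elliptic h, mul_add, mul_sub, ← hτ]
    linear_combination (1 / M.r * Complex.exp (M.r * M.a / 4)) ^ 2 *
      theta1_add_mul_theta1_sub (M.r * x) (M.r * y) (nome_im_pos hr ha)
  · obtain ⟨A, hA⟩ := s_additive h
    exact weierstrass_of_det (A := A) (B := fun _ => 1) (fun x y => by rw [hA]; ring) x y u v

section Elliptic

variable (h : M.kind = .elliptic)
include h

theorem s_add_pi_div (hr : 0 < M.r) (x : ℂ) : M.s (x + Real.pi / M.r) = -M.s x := by
  have hr' : (M.r : ℂ) ≠ 0 := by exact_mod_cast hr.ne'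
  rw [s_elliptic h, s_elliptic h, mul_add, mul_div_cancel₀ _ hr', theta1_add_pi]
  ring

theorem s_add_I_mul (x : ℂ) : M.s (x + Complex.I * M.a) =
    -Complex.exp (M.r * M.a - 2 * Complex.I * M.r * x) * M.s x := by
  have hpi : (Real.pi : ℂ) ≠ 0 := by exact_mod_cast Real.pi_ne_zero
  have e : (M.r * (x + Complex.I * M.a) : ℂ) =
      M.r * x + Real.pi * (Complex.I * M.r * M.a / Real.pi) := by
    field_simp
  have e2 : (-(Real.pi * Complex.I * (Complex.I * M.r * M.a / Real.pi)) -
      2 * Complex.I * (M.r * x) : ℂ) = M.r * M.a - 2 * Complex.I * M.r * x := by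
    field_simp
    linear_combination (-M.a * M.r : ℂ) * Complex.I_sq
  rw [s_elliptic h, s_elliptic h, e, theta1_add_pi_mul, e2]
  ring

theorem s_eq_zero_elliptic (hr : 0 < M.r) (ha : 0 < M.a) {z : ℂ} (hz : M.s z = 0) :
    ∃ k l : ℤ, z = k * (Real.pi / M.r) + l * (Complex.I * M.a) := by
  have hr' : (M.r : ℂ) ≠ 0 := by exact_mod_cast hr.ne'
  have hpi : (Real.pi : ℂ) ≠ 0 := by exact_mod_cast Real.pi_ne_zero
  refine exists_eq_of_eq_zero_of_quasiperiodic (c := M.r * M.a) (differentiable_s hr ha)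
    (exists_s_ne_zero hr ha) (s_weierstrass hr ha) s_neg (div_ne_zero hpi hr') (s_add_pi_div h hr)
    (fun x => ?_) hz
  rw [s_add_I_mul h]
  congr 3
  field_simp

end Elliptic

theorem omega_mem_Omega {ν : ℕ} (hν : ν ≤ M.kind.rho) : M.omega ν ∈ M.Omega :=
  AddSubgroup.subset_closure ⟨ν, hν, rfl⟩

theorem mem_Omega_of_s_eq_zero (hr : 0 < M.r) (ha : 0 < M.a) {z : ℂ} (hz : M.s z = 0) :
    z ∈ M.Omega := by
  have hr' : (M.r : ℂ) ≠ 0 := by exact_mod_cast hr.ne'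
  have ha' : (M.a : ℂ) ≠ 0 := by exact_mod_cast ha.ne'
  have hpi : (Real.pi : ℂ) ≠ 0 := by exact_mod_cast Real.pi_ne_zero
  cases h : M.kind
  · rw [s_rational h] at hz
    exact hz ▸ M.Omega.zero_mem
  · rw [s_trigonometric h] at hz
    have : Complex.sin (M.r * z) = 0 := by simpa [hr'] using hz
    obtain ⟨k, hk⟩ := Complex.sin_eq_zero_iff.1 this
    have : z = k • M.omega 1 := by
      simp only [omega, omega1, h, zsmul_eq_mul]
      field_simp
      linear_combination hk
    exact this ▸ M.Omega.zsmul_mem (omega_mem_Omega (by simp [h, Kind.rho])) k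
  · rw [s_hyperbolic h] at hz
    have : Complex.sinh (Real.pi * z / M.a) = 0 := by simpa [ha', hpi] using hz
    have : Complex.sin (Real.pi * z / M.a * Complex.I) = 0 := by
      rw [Complex.sin_mul_I, this, zero_mul]
    obtain ⟨k, hk⟩ := Complex.sin_eq_zero_iff.1 this
    have : z = (-k) • M.omega 1 := by
      simp only [omega, omega1, h, zsmul_eq_mul]
      push_cast
      field_simp at hk
      linear_combination -Complex.I * hk + z * Complex.I_sq
    exact this ▸ M.Omega.zsmul_mem (omega_mem_Omega (by simp [h, Kind.rho])) (-k)
  · obtain ⟨k, l, hkl⟩ := s_eq_zero_elliptic h hr ha hz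
    have : z = k • M.omega 1 + l • M.omega 2 := by
      simp only [omega, omega1, h, zsmul_eq_mul, hkl]
    exact this ▸ M.Omega.add_mem
      (M.Omega.zsmul_mem (omega_mem_Omega (by simp [h, Kind.rho])) k)
      (M.Omega.zsmul_mem (omega_mem_Omega (by simp [h, Kind.rho])) l)

/-- The half-periods are pairwise incongruent modulo the zeros of `s`. -/
theorem s_half_omega_sub_ne_zero (hr : 0 < M.r) (ha : 0 < M.a) {μ ν : ℕ} (hμ : μ ≤ M.kind.rho)
    (hν : ν ≤ M.kind.rho) (hμν : ν ≠ μ) : M.s ((M.omega ν - M.omega μ) / 2) ≠ 0 := by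
  have hr' : (M.r : ℂ) ≠ 0 := by exact_mod_cast hr.ne'
  have ha' : (M.a : ℂ) ≠ 0 := by exact_mod_cast ha.ne'
  have hpi : (Real.pi : ℂ) ≠ 0 := by exact_mod_cast Real.pi_ne_zero
  cases h : M.kind
  · simp only [h, Kind.rho] at hμ hν
    omega
  · have h1 : M.s (Real.pi / M.r / 2) ≠ 0 := by
      have : (M.r * (Real.pi / M.r / 2) : ℂ) = Real.pi / 2 := by field_simp
      rw [s_trigonometric h, this, Complex.sin_pi_div_two]
      simp [hr']
    simp only [h, Kind.rho] at hμ hν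
    interval_cases μ <;> interval_cases ν <;> simp_all [omega, omega1, neg_div, s_neg]
  · have h1 : M.s (Complex.I * M.a / 2) ≠ 0 := by
      have : (Real.pi * (Complex.I * M.a / 2) / M.a : ℂ) = Real.pi / 2 * Complex.I := by field_simp
      rw [s_hyperbolic h, this, Complex.sinh_mul_I, Complex.sin_pi_div_two]
      simp [ha', hpi]
    simp only [h, Kind.rho] at hμ hν
    interval_cases μ <;> interval_cases ν <;> simp_all [omega, omega1, neg_div, s_neg]
  -- Zeros lie in the period lattice, whose two generators are linearly independent over ℝ; half of
  -- a lattice vector is therefore a zero only if both coordinates are even.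
  · have hne : ∀ e f : ℤ, M.s ((e * (Real.pi / M.r) + f * (Complex.I * M.a)) / 2) = 0 →
        Even e ∧ Even f := by
      intro e f h0
      obtain ⟨k, l, hkl⟩ := s_eq_zero_elliptic h hr ha h0
      have hd : ((e : ℂ) - 2 * k) * (Real.pi / M.r) + (f - 2 * l) * (Complex.I * M.a) = 0 := by
        linear_combination 2 * hkl
      have hd' : (((e - 2 * k : ℤ) * (Real.pi / M.r) : ℝ) : ℂ) +
          (((f - 2 * l : ℤ) * M.a : ℝ) : ℂ) * Complex.I = 0 := by
        push_cast
        linear_combination hd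
      have hre := congrArg Complex.re hd'
      have him := congrArg Complex.im hd'
      simp only [Complex.add_re, Complex.ofReal_re, Complex.re_ofReal_mul, Complex.I_re, mul_zero,
        add_zero, Complex.zero_re, Complex.add_im, Complex.ofReal_im, Complex.im_ofReal_mul,
        Complex.I_im, mul_one, zero_add, Complex.zero_im] at hre him
      have h1 : e - 2 * k = 0 := by
        have : Real.pi / M.r ≠ 0 := by positivity
        exact_mod_cast (mul_eq_zero.1 hre).resolve_right this
      have h2 : f - 2 * l = 0 := by
        exact_mod_cast (mul_eq_zero.1 him).resolve_right ha.ne'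
      exact ⟨⟨k, by omega⟩, ⟨l, by omega⟩⟩
    -- The coordinates (0,0), (1,0), (0,1), (-1,-1) of the ω_ν are pairwise distinct modulo 2.
    have hrep : ∀ κ : ℕ, ∃ e f : ℤ, M.omega κ = e * (Real.pi / M.r) + f * (Complex.I * M.a) ∧
        (κ = 0 → e = 0 ∧ f = 0) ∧ (κ = 1 → e = 1 ∧ f = 0) ∧ (κ = 2 → e = 0 ∧ f = 1) ∧
        (κ = 3 → e = -1 ∧ f = -1) := by
      intro κ
      match κ with
      | 0 => exact ⟨0, 0, by simp [omega]⟩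
      | 1 => exact ⟨1, 0, by simp [omega, omega1, h]⟩
      | 2 => exact ⟨0, 1, by simp [omega]⟩
      | n + 3 => exact ⟨-1, -1, by simp [omega, omega1, h]; ring⟩
    intro h0
    obtain ⟨e, f, hκ, h1⟩ := hrep ν
    obtain ⟨e', f', hκ', h1'⟩ := hrep μ
    have : (M.omega ν - M.omega μ) / 2 =
        (((e - e' : ℤ) : ℂ) * (Real.pi / M.r) + ((f - f' : ℤ) : ℂ) * (Complex.I * M.a)) / 2 := by
      rw [hκ, hκ']
      push_cast
      ring
    rw [this] at h0
    obtain ⟨⟨k, hk⟩, ⟨l, hl⟩⟩ := hne _ _ h0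
    simp only [h, Kind.rho] at hμ hν
    omega

theorem halfPeriodProd_ne_zero (hr : 0 < M.r) (ha : 0 < M.a) : M.halfPeriodProd ≠ 0 := by
  refine Finset.prod_ne_zero_iff.2 fun ν hν => ?_
  rw [Finset.mem_Icc] at hν
  have := s_half_omega_sub_ne_zero hr ha (μ := 0) (Nat.zero_le _) hν.2 (by omega)
  simpa [omega] using this

/-- The duplication formula for `s`. -/
theorem halfPeriodProd_mul_s_two_mul (hr : 0 < M.r) (ha : 0 < M.a) : ∃ σ : ℂ, σ ^ 2 = 1 ∧ ∀ x,
    M.halfPeriodProd * M.s (2 * x) =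
      2 * σ * ∏ ν ∈ Finset.range (M.kind.rho + 1), M.s (x - M.omega ν / 2) := by
  have hr' : (M.r : ℂ) ≠ 0 := by exact_mod_cast hr.ne'
  have ha' : (M.a : ℂ) ≠ 0 := by exact_mod_cast ha.ne'
  have hpi : (Real.pi : ℂ) ≠ 0 := by exact_mod_cast Real.pi_ne_zero
  cases h : M.kind
  · refine ⟨1, by norm_num, fun x => ?_⟩
    simp [halfPeriodProd, h, Kind.rho, omega, s_rational h]
  · refine ⟨-1, by norm_num, fun x => ?_⟩
    have e1 : (M.r * (x - Real.pi / M.r / 2) : ℂ) = M.r * x - Real.pi / 2 := by field_simp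
    have e2 : (M.r * (Real.pi / M.r / 2) : ℂ) = Real.pi / 2 := by field_simp
    have e3 : (M.r * (2 * x) : ℂ) = 2 * (M.r * x) := by ring
    simp only [halfPeriodProd, h, Kind.rho, omega, omega1, s_trigonometric h, Finset.Icc_self,
      Finset.prod_singleton, Finset.prod_range_succ, Finset.range_zero, Finset.prod_empty, e1, e2, e3,
      Complex.sin_pi_div_two, Complex.sin_sub_pi_div_two, Complex.sin_two_mul, zero_div, sub_zero]
    ring
  · refine ⟨-1, by norm_num, fun x => ?_⟩
    have e1 : (Real.pi * (x - Complex.I * M.a / 2) / M.a : ℂ) =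
      Real.pi * x / M.a - Real.pi / 2 * Complex.I := by field_simp
    have e2 : (Real.pi * (Complex.I * M.a / 2) / M.a : ℂ) = Real.pi / 2 * Complex.I := by field_simp
    have e3 : (Real.pi * (2 * x) / M.a : ℂ) = 2 * (Real.pi * x / M.a) := by ring
    simp only [halfPeriodProd, h, Kind.rho, omega, omega1, s_hyperbolic h, Finset.Icc_self,
      Finset.prod_singleton, Finset.prod_range_succ, Finset.range_zero, Finset.prod_empty, e1, e2, e3,
      Complex.sinh_mul_I, Complex.cosh_mul_I, Complex.sinh_sub, Complex.sinh_two_mul, zero_div,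
      sub_zero, Complex.sin_pi_div_two, Complex.cos_pi_div_two]
    ring
  · refine ⟨-1, by norm_num, fun x => ?_⟩
    set p : ℂ := Real.pi / M.r with hp
    set q : ℂ := Complex.I * M.a with hq
    -- With these arguments the first product is s(2x) times the values at the three half-periods,
    -- the second is the product over all ω_ν, and the third equals the second after
    -- quasi-periodicity. This gives the factor 2 and the sign -1.
    have hW := s_weierstrass hr ha (x + p / 2 / 2) (x - p / 2 / 2) (-(p / 2) / 2)
      (q / 2 + p / 2 / 2)
    have e1 : x + p / 2 / 2 + (x - p / 2 / 2) = 2 * x := by ring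
    have e2 : x + p / 2 / 2 - (x - p / 2 / 2) = p / 2 := by ring
    have e3 : -(p / 2) / 2 + (q / 2 + p / 2 / 2) = q / 2 := by ring
    have e4 : -(p / 2) / 2 - (q / 2 + p / 2 / 2) = (-p - q) / 2 := by ring
    have e5 : x - p / 2 / 2 + -(p / 2) / 2 = x - p / 2 := by ring
    have e6 : x - p / 2 / 2 - -(p / 2) / 2 = x := by ring
    have e7 : x + p / 2 / 2 + (q / 2 + p / 2 / 2) = x - (-p - q) / 2 := by ring
    have e8 : x + p / 2 / 2 - (q / 2 + p / 2 / 2) = x - q / 2 := by ring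
    have e9 : -(p / 2) / 2 + (x + p / 2 / 2) = x := by ring
    have e10 : -(p / 2) / 2 - (x + p / 2 / 2) = -(x - p / 2 + p) := by ring
    have e11 : x - p / 2 / 2 + (q / 2 + p / 2 / 2) = x - q / 2 + q := by ring
    have e12 : x - p / 2 / 2 - (q / 2 + p / 2 / 2) = x - p / 2 - q / 2 := by ring
    have e13 : x - (-p - q) / 2 = (x - p / 2 - q / 2) + q + p := by ring
    rw [e1, e2, e3, e4, e5, e6, e7, e8, e9, e10, e11, e12, s_neg, hp, s_add_pi_div h hr, hq,
      s_add_I_mul h, ← hp, ← hq] at hW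
    have h13 : M.s (x - (-p - q) / 2) =
        Complex.exp (M.r * M.a - 2 * Complex.I * M.r * (x - p / 2 - q / 2)) *
          M.s (x - p / 2 - q / 2) := by
      rw [e13, hp, s_add_pi_div h hr, hq, s_add_I_mul h]
      ring
    have h14 : Complex.exp (M.r * M.a - 2 * Complex.I * M.r * (x - p / 2 - q / 2)) =
        -Complex.exp (M.r * M.a - 2 * Complex.I * M.r * (x - q / 2)) := by
      rw [← Complex.exp_antiperiodic]
      congr 1
      rw [hp]
      field_simp
      ring
    have hhp : M.halfPeriodProd = M.s (p / 2) * M.s (q / 2) * M.s ((-p - q) / 2) := by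
      simp [halfPeriodProd, h, Kind.rho, Finset.prod_Icc_succ_top, omega, omega1, hp, hq]
    have hprod : ∏ ν ∈ Finset.range (Kind.elliptic.rho + 1), M.s (x - M.omega ν / 2) =
        M.s x * M.s (x - p / 2) * M.s (x - q / 2) * M.s (x - (-p - q) / 2) := by
      simp [h, Kind.rho, Finset.prod_range_succ, omega, omega1, hp, hq]
    rw [hhp, hprod]
    rw [h14] at h13
    linear_combination hW + M.s x * M.s (x - p / 2) * M.s (x - q / 2) * h13

end Koornwinder.Model

/-! ### The partial fraction identity. -/

namespace Koornwinder

section Interpolation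

variable {ι : Type*} [DecidableEq ι]

/-- The Lagrange-type sum over the nodes `x i`, `i ∈ S`, of the numerator with zeros `b j`. -/
noncomputable def nodeSum (s : ℂ → ℂ) (x b : ι → ℂ) (S : Finset ι) : ℂ :=
  ∑ i ∈ S, (∏ j ∈ S, s (x i - b j)) / ∏ j ∈ S.erase i, s (x i - x j)

/-- `s (x + y) s (x - y)` has the form `A x - A y`, as for the sine function. -/
def IsAdditive (s : ℂ → ℂ) : Prop :=
  ∃ A : ℂ → ℂ, ∀ x y, s (x + y) * s (x - y) = A x - A y

variable {s : ℂ → ℂ} {x b : ι → ℂ} {S : Finset ι}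

theorem IsAdditive.mul_sub_mul (h : IsAdditive s) (p q b b' : ℂ) :
    s (p - b) * s (p - b') - s (q - b) * s (q - b') = s (p - q) * s (p + q - b - b') := by
  obtain ⟨A, hA⟩ := h
  have h1 := hA (p - (b + b') / 2) ((b' - b) / 2)
  have h2 := hA (q - (b + b') / 2) ((b' - b) / 2)
  have h3 := hA (p - (b + b') / 2) (q - (b + b') / 2)
  have e1 : p - (b + b') / 2 + (b' - b) / 2 = p - b := by ring
  have e2 : p - (b + b') / 2 - (b' - b) / 2 = p - b' := by ring
  have e3 : q - (b + b') / 2 + (b' - b) / 2 = q - b := by ring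
  have e4 : q - (b + b') / 2 - (b' - b) / 2 = q - b' := by ring
  have e5 : p - (b + b') / 2 + (q - (b + b') / 2) = p + q - b - b' := by ring
  have e6 : p - (b + b') / 2 - (q - (b + b') / 2) = p - q := by ring
  rw [e1, e2] at h1
  rw [e3, e4] at h2
  rw [e5, e6] at h3
  linear_combination h1 - h2 - h3

/-- When a zero of the numerator sits at a node, the term of that node vanishes and every other term
loses a common factor. This is the reduction step of the induction. -/
theorem nodeSum_of_eq (hs0 : s 0 = 0) (hx : ∀ i ∈ S, ∀ j ∈ S, i ≠ j → s (x i - x j) ≠ 0)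
    {l : ι} (hl : l ∈ S) (hb : b l = x l) :
    nodeSum s x b S = nodeSum s x b (S.erase l) := by
  rw [nodeSum, nodeSum, ← Finset.add_sum_erase _ _ hl,
    Finset.prod_eq_zero hl (by rw [hb, sub_self, hs0]), zero_div, zero_add]
  refine Finset.sum_congr rfl fun i hi => ?_
  rw [Finset.mem_erase] at hi
  rw [← Finset.mul_prod_erase S _ hl,
    ← Finset.mul_prod_erase (S.erase i) _ (Finset.mem_erase.2 ⟨hi.1.symm, hl⟩), hb,
    Finset.erase_right_comm, mul_div_mul_left _ _ (hx i hi.2 l hl hi.1)]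

/-- Interpolation form of Weierstrass' relation: among products of two factors with prescribed sum
of zeros, any one is a combination of a product vanishing at q and a product vanishing at p. The
coefficients do not depend on z. -/
theorem three_term
    (hW : ∀ x y u v : ℂ, s (x + y) * s (x - y) * (s (u + v) * s (u - v)) +
      s (y + u) * s (y - u) * (s (x + v) * s (x - v)) +
      s (u + x) * s (u - x) * (s (y + v) * s (y - v)) = 0)
    (hodd : ∀ x, s (-x) = -s x) (z p q b b' : ℂ) :
    s (z - b) * s (z - b') * (s (p - q) * s (p + q - b - b')) =
      s (p - b) * s (p - b') * (s (z - q) * s (z - (b + b' - q))) -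
        s (q - b) * s (q - b') * (s (z - p) * s (z - (b + b' - p))) := by
  have h := hW (z - (b + b') / 2) ((b' - b) / 2) (p - (b + b') / 2) (q - (b + b') / 2)
  have e1 : z - (b + b') / 2 + (b' - b) / 2 = z - b := by ring
  have e2 : z - (b + b') / 2 - (b' - b) / 2 = z - b' := by ring
  have e3 : p - (b + b') / 2 + (q - (b + b') / 2) = p + q - b - b' := by ring
  have e4 : p - (b + b') / 2 - (q - (b + b') / 2) = p - q := by ring
  have e5 : (b' - b) / 2 + (p - (b + b') / 2) = p - b := by ring
  have e6 : (b' - b) / 2 - (p - (b + b') / 2) = -(p - b') := by ring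
  have e7 : z - (b + b') / 2 + (q - (b + b') / 2) = z - (b + b' - q) := by ring
  have e8 : z - (b + b') / 2 - (q - (b + b') / 2) = z - q := by ring
  have e9 : p - (b + b') / 2 + (z - (b + b') / 2) = z - (b + b' - p) := by ring
  have e10 : p - (b + b') / 2 - (z - (b + b') / 2) = -(z - p) := by ring
  have e11 : (b' - b) / 2 + (q - (b + b') / 2) = q - b := by ring
  have e12 : (b' - b) / 2 - (q - (b + b') / 2) = -(q - b') := by ring
  rw [e1, e2, e3, e4, e5, e6, e7, e8, e9, e10, e11, e12, hodd, hodd, hodd] at h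
  linear_combination h

theorem prod_update_update {k l : ι} (hk : k ∈ S) (hl : l ∈ S) (hkl : k ≠ l) (u v z : ℂ) :
    ∏ j ∈ S, s (z - Function.update (Function.update b k u) l v j) =
      s (z - u) * s (z - v) * ∏ j ∈ (S.erase k).erase l, s (z - b j) := by
  rw [← Finset.mul_prod_erase S _ hk,
    ← Finset.mul_prod_erase (S.erase k) _ (Finset.mem_erase.2 ⟨hkl.symm, hl⟩), ← mul_assoc]
  congr 1
  · simp [hkl]
  · refine Finset.prod_congr rfl fun j hj => ?_
    simp only [Finset.mem_erase] at hj
    rw [Function.update_of_ne hj.1, Function.update_of_ne hj.2.1]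

/-- The numerators are exchanged termwise by `three_term`, whose coefficients are the same for all
nodes. The sum of all zeros is preserved, so the exchange respects the balanced case. -/
theorem mul_nodeSum
    (hW : ∀ x y u v : ℂ, s (x + y) * s (x - y) * (s (u + v) * s (u - v)) +
      s (y + u) * s (y - u) * (s (x + v) * s (x - v)) +
      s (u + x) * s (u - x) * (s (y + v) * s (y - v)) = 0)
    (hodd : ∀ x, s (-x) = -s x) {k l : ι} (hk : k ∈ S) (hl : l ∈ S) (hkl : k ≠ l) (p q : ℂ) :
    s (p - q) * s (p + q - b k - b l) * nodeSum s x b S =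
      s (p - b k) * s (p - b l) *
          nodeSum s x (Function.update (Function.update b k (b k + b l - q)) l q) S -
        s (q - b k) * s (q - b l) *
          nodeSum s x (Function.update (Function.update b k p) l (b k + b l - p)) S := by
  simp only [nodeSum, Finset.mul_sum, ← Finset.sum_sub_distrib]
  refine Finset.sum_congr rfl fun i _ => ?_
  rw [prod_update_update hk hl hkl, prod_update_update hk hl hkl]
  have h1 := prod_update_update (s := s) (b := b) hk hl hkl (b k) (b l) (x i)
  rw [Function.update_eq_self, Function.update_eq_self] at h1
  rw [h1]
  have := three_term hW hodd (x i) p q (b k) (b l)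
  simp only [div_eq_mul_inv]
  linear_combination (∏ j ∈ (S.erase k).erase l, s (x i - b j)) *
    (∏ j ∈ S.erase i, s (x i - x j))⁻¹ * this

theorem sum_update_update {k l : ι} (hk : k ∈ S) (hl : l ∈ S) (hkl : k ≠ l) (u v : ℂ) :
    ∑ j ∈ S, Function.update (Function.update b k u) l v j = ∑ j ∈ S, b j - b k - b l + u + v := by
  rw [← Finset.add_sum_erase S _ hk, ← Finset.add_sum_erase S b hk,
    ← Finset.add_sum_erase (S.erase k) _ (Finset.mem_erase.2 ⟨hkl.symm, hl⟩),
    ← Finset.add_sum_erase (S.erase k) b (Finset.mem_erase.2 ⟨hkl.symm, hl⟩)]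
  have : ∑ j ∈ (S.erase k).erase l, Function.update (Function.update b k u) l v j =
      ∑ j ∈ (S.erase k).erase l, b j := Finset.sum_congr rfl fun j hj => by
    simp only [Finset.mem_erase] at hj
    rw [Function.update_of_ne hj.1, Function.update_of_ne hj.2.1]
  rw [this]
  simp [hkl]
  ring

/-- The partial fraction identity for odd entire functions satisfying the three-term relation. -/
theorem nodeSum_eq (hs : Differentiable ℂ s) (hne : ∃ z, s z ≠ 0)
    (hW : ∀ x y u v : ℂ, s (x + y) * s (x - y) * (s (u + v) * s (u - v)) +
      s (y + u) * s (y - u) * (s (x + v) * s (x - v)) +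
      s (u + x) * s (u - x) * (s (y + v) * s (y - v)) = 0)
    (hodd : ∀ x, s (-x) = -s x) (hx : ∀ i ∈ S, ∀ j ∈ S, i ≠ j → s (x i - x j) ≠ 0)
    (hb : IsAdditive s ∨ ∑ j ∈ S, x j = ∑ j ∈ S, b j) :
    nodeSum s x b S = s (∑ j ∈ S, x j - ∑ j ∈ S, b j) := by
  have hs0 : s 0 = 0 := by
    have := hodd 0
    rw [neg_zero] at this
    linear_combination this / 2
  obtain ⟨n, hn⟩ : ∃ n, S.card = n := ⟨_, rfl⟩
  induction n generalizing S b with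
  | zero => simp [nodeSum, Finset.card_eq_zero.1 hn, hs0]
  | succ n ih =>
    match n with
    | 0 =>
      obtain ⟨k, rfl⟩ := Finset.card_eq_one.1 hn
      simp [nodeSum]
    | 1 =>
      obtain ⟨k, l, hkl, rfl⟩ := Finset.card_eq_two.1 hn
      have hkl' := hx k (by simp) l (by simp) hkl
      have e1 : ({k, l} : Finset ι).erase k = {l} := by
        ext j
        simp only [Finset.mem_erase, Finset.mem_insert, Finset.mem_singleton]
        grind
      have e2 : ({k, l} : Finset ι).erase l = {k} := by
        ext j
        simp only [Finset.mem_erase, Finset.mem_insert, Finset.mem_singleton]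
        grind
      have e3 : s (x l - x k) = -s (x k - x l) := by rw [← hodd, neg_sub]
      rw [nodeSum, Finset.sum_pair hkl, e1, e2, Finset.prod_pair hkl, Finset.prod_pair hkl,
        Finset.prod_singleton, Finset.prod_singleton, e3, Finset.sum_pair hkl, Finset.sum_pair hkl]
      rw [div_neg, ← sub_eq_add_neg, ← sub_div, div_eq_iff hkl']
      rcases hb with h | h
      · rw [h.mul_sub_mul, mul_comm]
        congr 2
        ring
      · rw [Finset.sum_pair hkl, Finset.sum_pair hkl] at h
        have h1 : x k - b l = -(x l - b k) := by linear_combination h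
        have h2 : x k - b k = -(x l - b l) := by linear_combination h
        rw [h, sub_self, hs0, h1, h2, hodd, hodd]
        ring
    -- With p = x_k and q = x_l, both sums on the right of `mul_nodeSum` have a zero at a node, so
    -- the induction hypothesis applies. The factor s(x_k + x_l - b_k - b_l) on the left may vanish,
    -- and a third node w is needed to perturb it away; hence one and two nodes are treated
    -- separately.
    | n + 2 =>
      obtain ⟨k, hk, l, hl, w, hw, hkl, hkw, hlw⟩ := Finset.two_lt_card.1 (by omega : 2 < S.card)
      have hgen : ∀ b : ι → ℂ, IsAdditive s ∨ ∑ j ∈ S, x j = ∑ j ∈ S, b j →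
          s (x k + x l - b k - b l) ≠ 0 →
          nodeSum s x b S = s (∑ j ∈ S, x j - ∑ j ∈ S, b j) := by
        intro b hb hc
        have hmul := mul_nodeSum (x := x) (b := b) hW hodd hk hl hkl (x k) (x l)
        have herase : ∀ b' : ι → ℂ, ∑ j ∈ S, b' j = ∑ j ∈ S, b j → ∀ c ∈ S, b' c = x c →
            nodeSum s x b' S = s (∑ j ∈ S, x j - ∑ j ∈ S, b j) := by
          intro b' hb' c hc hcx
          have e1 := Finset.add_sum_erase S x hc
          have e2 := Finset.add_sum_erase S b' hc
          rw [nodeSum_of_eq hs0 hx hc hcx, ih (S := S.erase c)]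
          · congr 1
            rw [← hb', ← e1, ← e2, hcx]
            ring
          · exact fun i hi j hj => hx i (Finset.mem_of_mem_erase hi) j (Finset.mem_of_mem_erase hj)
          · refine hb.imp_right fun h => ?_
            linear_combination h - hb' + e1 - e2 + hcx
          · rw [Finset.card_erase_of_mem hc, hn]
            rfl
        have h1 := herase (Function.update (Function.update b k (b k + b l - x l)) l (x l))
          (by rw [sum_update_update hk hl hkl]; ring) l hl (by simp)
        have h2 := herase (Function.update (Function.update b k (x k)) l (b k + b l - x k))
          (by rw [sum_update_update hk hl hkl]; ring) k hk (by simp [hkl])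
        rw [h1, h2] at hmul
        have hkl' := hx k hk l hl hkl
        refine mul_left_cancel₀ (mul_ne_zero hkl' hc) ?_
        rw [hmul]
        -- The additive addition formula supplies exactly the coefficient to be cancelled; in the
        -- balanced case both sides are multiples of s(0) = 0.
        rcases hb with h | h
        · rw [← h.mul_sub_mul]
          ring
        · rw [h, sub_self, hs0]
          ring
      -- Moving b_k and b_w in opposite directions changes b_k + b_l while keeping the total sum;
      -- the degenerate case is then the limit t → 0.
      set b' : ℂ → ι → ℂ := fun t =>
        Function.update (Function.update b k (b k + t)) w (b w - t) with hb'
      have hsum : ∀ t, ∑ j ∈ S, b' t j = ∑ j ∈ S, b j := fun t => by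
        rw [hb', sum_update_update hk hw hkw]
        ring
      have hb0 : b' 0 = b := by simp [hb']
      have hcont : Continuous fun t => nodeSum s x (b' t) S := by
        refine continuous_finsetSum _ fun i _ => Continuous.div_const ?_ _
        refine continuous_finsetProd _ fun j _ => hs.continuous.comp ?_
        refine continuous_const.sub ?_
        have : Continuous b' := by fun_prop
        exact (continuous_apply j).comp this
      have hne' : ∀ᶠ t in 𝓝[≠] (0 : ℂ), nodeSum s x (b' t) S = s (∑ j ∈ S, x j - ∑ j ∈ S, b j) := by
        have h1 := eventually_ne_zero_of_differentiable
          (s := fun t => s (x k + x l - b k - b l - t)) (hs.comp (by fun_prop)) (by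
            obtain ⟨z, hz⟩ := hne
            exact ⟨x k + x l - b k - b l - z, by simpa using hz⟩) 0
        filter_upwards [h1] with t ht
        rw [hgen (b' t) (by rwa [hsum]), hsum]
        convert ht using 2
        simp [hb', hkw, hlw, hkl.symm]
        ring
      have hlim : Filter.Tendsto (fun t => nodeSum s x (b' t) S) (𝓝[≠] 0)
          (𝓝 (nodeSum s x (b' 0) S)) := hcont.continuousAt.tendsto.mono_left nhdsWithin_le_nhds
      rw [hb0] at hlim
      exact tendsto_nhds_unique (hlim.congr' hne') tendsto_const_nhds

variable {κ : Type*}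

/-- The partial fraction identity with separate index sets for the nodes and the zeros. -/
theorem sum_prod_div_prod_erase {b : κ → ℂ} {T : Finset κ} (hs : Differentiable ℂ s)
    (hne : ∃ z, s z ≠ 0)
    (hW : ∀ x y u v : ℂ, s (x + y) * s (x - y) * (s (u + v) * s (u - v)) +
      s (y + u) * s (y - u) * (s (x + v) * s (x - v)) +
      s (u + x) * s (u - x) * (s (y + v) * s (y - v)) = 0)
    (hodd : ∀ x, s (-x) = -s x) (hx : ∀ i ∈ S, ∀ j ∈ S, i ≠ j → s (x i - x j) ≠ 0)
    (hcard : S.card = T.card) (hb : IsAdditive s ∨ ∑ j ∈ S, x j = ∑ j ∈ T, b j) :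
    ∑ i ∈ S, (∏ j ∈ T, s (x i - b j)) / ∏ j ∈ S.erase i, s (x i - x j) =
      s (∑ j ∈ S, x j - ∑ j ∈ T, b j) := by
  let e := Finset.equivOfCardEq hcard
  set b' : ι → ℂ := fun i => if h : i ∈ S then b (e ⟨i, h⟩) else 0 with hb'
  have hbe : ∀ i : S, b' i = b (e i) := fun i => by simp [hb']
  have hsum : ∑ j ∈ S, b' j = ∑ j ∈ T, b j := by
    rw [← Finset.sum_coe_sort S, ← Finset.sum_coe_sort T]
    simp only [hbe]
    exact e.sum_comp fun j => b j
  have hprod : ∀ z, ∏ j ∈ S, s (z - b' j) = ∏ j ∈ T, s (z - b j) := fun z => by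
    rw [← Finset.prod_coe_sort S, ← Finset.prod_coe_sort T]
    simp only [hbe]
    exact e.prod_comp fun j => s (z - b j)
  have := nodeSum_eq (b := b') hs hne hW hodd hx (by rwa [hsum])
  rw [hsum] at this
  simpa only [nodeSum, hprod] using this

end Interpolation

end Koornwinder

/-! ### The coefficients as terms of one partial fraction expansion. -/

namespace Koornwinder.Model

variable {M : Model} {N : ℕ} {m : Fin N → ℝ}

theorem mass_ne_zero (hlam : M.lam ≠ 0) {μ : ℝ} (hμ : μ ∈ M.masses) : μ ≠ 0 := by
  rcases hμ with rfl | rfl | rfl | rfl <;> simp [hlam]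

/-- On Λ the quantity λμ + 1/μ is λ + 1 for μ = 1, 1/λ and -(λ + 1) for the other two masses, which
merges the two cases of d into one formula. -/
theorem d_eq (hlam : M.lam ≠ 0) {μ : ℝ} (hμ : μ ∈ M.masses) (g : ℝ) :
    M.d g μ = g + (M.lam * μ + 1 / μ) / 4 - (M.lam + 1) / 4 := by
  unfold d
  split_ifs with h
  · rcases h with rfl | rfl <;> field_simp <;> ring
  · rw [not_or] at h
    rcases hμ with rfl | rfl | rfl | rfl
    · exact absurd rfl h.1
    · ring
    · field_simp
      ring
    · exact absurd rfl h.2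

/-- Half of the shift `(β/4) (λ μ + 1/μ)` by which a variable of mass `μ` enters the nodes. -/
noncomputable def nodeShift (M : Model) (μ : ℝ) : ℂ :=
  Complex.I * (M.lam * μ + 1 / μ) * M.beta / 4

theorem f_neg_one (x : ℂ) (μ μ' : ℝ) : M.f (-1) x μ μ' = M.f 1 (-x) μ μ' := by
  unfold f
  rw [← neg_div_neg_eq, ← s_neg, ← s_neg]
  congr 2 <;> push_cast <;> ring

/-- The shift (μ-μ')(λμμ'-1)/μμ' is the difference of λμ + 1/μ and λμ' + 1/μ'. Attaching one
half-shift to each particle thus makes the arguments of f differences of nodes and zeros. -/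
theorem f_one {μ μ' : ℝ} (hμ : μ ≠ 0) (hμ' : μ' ≠ 0) (x : ℂ) :
    M.f 1 x μ μ' =
      M.s (x - M.nodeShift μ + M.nodeShift μ' - Complex.I * M.lam * μ' * M.beta) /
        M.s (x - M.nodeShift μ + M.nodeShift μ') := by
  have h : (μ : ℂ) ≠ 0 := by exact_mod_cast hμ
  have h' : (μ' : ℂ) ≠ 0 := by exact_mod_cast hμ'
  have e : x - ((1 : ℤ) : ℂ) * Complex.I * (μ - μ') * (M.lam * μ * μ' - 1) * M.beta / (4 * μ * μ') =
      x - M.nodeShift μ + M.nodeShift μ' := by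
    unfold nodeShift
    field_simp
    push_cast
    ring
  unfold f
  rw [e]
  congr 2
  push_cast
  ring

theorem V_neg_one (J : Fin N) (X : Fin N → ℂ) : M.V m (-1) J X = M.V m 1 J (-X) := by
  have e1 : ((-1 : ℤ) : ℂ) * X J = ((1 : ℤ) : ℂ) * -X J := by push_cast; ring
  have e2 : ((-1 : ℤ) : ℂ) * 2 * X J = ((1 : ℤ) : ℂ) * 2 * -X J := by push_cast; ring
  unfold V
  simp only [f_neg_one, Pi.neg_apply, e1, e2]
  congr 1
  refine Finset.prod_congr rfl fun K _ => Finset.prod_congr rfl fun δ _ => ?_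
  congr 1
  ring

/-- For masses in Λ one has λμ - 1/μ = ±(λ - 1), so the two offsets on the left are 1/μ and λμ in
some order. Hence half-period nodes common to all particles produce denominators depending on the
mass. -/
theorem s_mul_s_of_mass (hlam : M.lam ≠ 0) {μ : ℝ} (hμ : μ ∈ M.masses) (x : ℂ) :
    M.s (2 * (x - M.nodeShift μ + Complex.I * (M.lam - 1) * M.beta / 4)) *
        M.s (2 * (x - M.nodeShift μ - Complex.I * (M.lam - 1) * M.beta / 4)) =
      M.s (2 * x - Complex.I * M.beta / μ) *
        M.s (2 * x - Complex.I * M.lam * μ * M.beta) := by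
  have h : (M.lam : ℂ) ≠ 0 := by exact_mod_cast hlam
  unfold nodeShift
  rcases hμ with rfl | rfl | rfl | rfl
  · congr 2 <;> push_cast <;> ring
  · rw [mul_comm]; congr 2 <;> push_cast <;> ring
  · congr 2 <;> push_cast <;> field_simp <;> ring
  · rw [mul_comm]; congr 2 <;> push_cast <;> field_simp <;> ring

/-- The sign in the duplication formula depends on the case, but disappears because the formula is
used twice. -/
theorem prod_s_mul_prod_s (hr : 0 < M.r) (ha : 0 < M.a) (x y : ℂ) :
    (∏ ν ∈ Finset.range (M.kind.rho + 1), M.s (x - M.omega ν / 2)) *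
        ∏ ν ∈ Finset.range (M.kind.rho + 1), M.s (y - M.omega ν / 2) =
      M.halfPeriodProd ^ 2 / 4 * (M.s (2 * x) * M.s (2 * y)) := by
  obtain ⟨σ, hσ, h⟩ := M.halfPeriodProd_mul_s_two_mul hr ha
  have hx := h x
  have hy := h y
  linear_combination -(1 / 4 : ℂ) * M.halfPeriodProd * M.s (2 * y) * hx -
    (1 / 2 : ℂ) * σ * (∏ ν ∈ Finset.range (M.kind.rho + 1), M.s (x - M.omega ν / 2)) * hy -
    (∏ ν ∈ Finset.range (M.kind.rho + 1), M.s (x - M.omega ν / 2)) *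
    (∏ ν ∈ Finset.range (M.kind.rho + 1), M.s (y - M.omega ν / 2)) * hσ

/-- The nodes of the partial fraction identity behind the source identity. -/
noncomputable def node (M : Model) (m : Fin N → ℝ) (X : Fin N → ℂ) :
    (ℕ ⊕ ℕ) ⊕ (Fin N ⊕ Fin N) → ℂ :=
  Sum.elim
    (Sum.elim (fun ν => M.omega ν / 2 - Complex.I * (M.lam - 1) * M.beta / 4)
      (fun ν => M.omega ν / 2 + Complex.I * (M.lam - 1) * M.beta / 4))
    (Sum.elim (fun J => X J - M.nodeShift (m J)) (fun J => -X J - M.nodeShift (m J)))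

/-- The index set of the nodes. -/
def nodeIndex (M : Model) (N : ℕ) : Finset ((ℕ ⊕ ℕ) ⊕ (Fin N ⊕ Fin N)) :=
  ((Finset.range (M.kind.rho + 1)).disjSum (Finset.range (M.kind.rho + 1))).disjSum
    (Finset.univ.disjSum Finset.univ)

/-- The zeros of the numerator in the partial fraction identity behind the source identity. -/
noncomputable def numZero (M : Model) (m : Fin N → ℝ) (X : Fin N → ℂ) :
    Fin (2 * M.kind.rho + 2) ⊕ (Fin N ⊕ Fin N) → ℂ :=
  Sum.elim (fun κ => Complex.I * M.g κ * M.beta - Complex.I * (M.lam + 1) * M.beta / 4)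
    (Sum.elim (fun J => X J - M.nodeShift (m J) + Complex.I * M.lam * m J * M.beta)
      (fun J => -X J - M.nodeShift (m J) + Complex.I * M.lam * m J * M.beta))

theorem disjSum_erase_inl {α β : Type*} [DecidableEq α] [DecidableEq β] (A : Finset α)
    (B : Finset β) (a : α) : (A.disjSum B).erase (Sum.inl a) = (A.erase a).disjSum B := by
  ext (x | x) <;> simp

theorem disjSum_erase_inr {α β : Type*} [DecidableEq α] [DecidableEq β] (A : Finset α)
    (B : Finset β) (b : β) : (A.disjSum B).erase (Sum.inr b) = A.disjSum (B.erase b) := by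
  ext (x | x) <;> simp

/-- The particle's own zero contributes -s(iλm_Jβ). The half-period nodes contribute s(2X_J -
iβ/m_J) s(2X_J - iλm_Jβ), and the second factor cancels against the mirror zero; the mirror node
gives s(2X_J). These are the denominators of V_J^+. -/
theorem node_term_particle (hr : 0 < M.r) (ha : 0 < M.a) (hlam : M.lam ≠ 0)
    (hm : ∀ J, m J ∈ M.masses) (X : Fin N → ℂ) (J : Fin N) {z : ℂ}
    (hz : z = X J - M.nodeShift (m J))
    (h1 : ∏ ν ∈ Finset.range (M.kind.rho + 1),
      M.s (z - (M.omega ν / 2 - Complex.I * (M.lam - 1) * M.beta / 4)) ≠ 0)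
    (h2 : ∏ ν ∈ Finset.range (M.kind.rho + 1),
      M.s (z - (M.omega ν / 2 + Complex.I * (M.lam - 1) * M.beta / 4)) ≠ 0) :
    ((∏ κ, M.s (z - (Complex.I * M.g κ * M.beta - Complex.I * (M.lam + 1) * M.beta / 4))) *
      ((∏ K, M.s (z - (X K - M.nodeShift (m K) + Complex.I * M.lam * m K * M.beta))) *
        ∏ K, M.s (z - (-X K - M.nodeShift (m K) + Complex.I * M.lam * m K * M.beta)))) /
      (((∏ ν ∈ Finset.range (M.kind.rho + 1),
          M.s (z - (M.omega ν / 2 - Complex.I * (M.lam - 1) * M.beta / 4))) *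
        ∏ ν ∈ Finset.range (M.kind.rho + 1),
          M.s (z - (M.omega ν / 2 + Complex.I * (M.lam - 1) * M.beta / 4))) *
        ((∏ K ∈ Finset.univ.erase J, M.s (z - (X K - M.nodeShift (m K)))) *
          ∏ K, M.s (z - (-X K - M.nodeShift (m K))))) =
      -(4 / M.halfPeriodProd ^ 2) * (M.s (Complex.I * M.lam * m J * M.beta) * M.V m 1 J X) := by
  have hhp := halfPeriodProd_ne_zero hr ha
  have hden : (∏ ν ∈ Finset.range (M.kind.rho + 1),
      M.s (z - (M.omega ν / 2 - Complex.I * (M.lam - 1) * M.beta / 4))) *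
      (∏ ν ∈ Finset.range (M.kind.rho + 1),
      M.s (z - (M.omega ν / 2 + Complex.I * (M.lam - 1) * M.beta / 4))) =
      M.halfPeriodProd ^ 2 / 4 * (M.s (2 * X J - Complex.I * M.beta / m J) *
        M.s (2 * X J - Complex.I * M.lam * m J * M.beta)) := by
    rw [← s_mul_s_of_mass hlam (hm J), ← hz, ← prod_s_mul_prod_s hr ha]
    congr 1 <;> refine Finset.prod_congr rfl fun ν _ => ?_ <;> congr 1 <;> ring
  have hden0 := mul_ne_zero h1 h2
  rw [hden] at hden0 ⊢
  have hs2 : M.s (2 * X J - Complex.I * M.lam * m J * M.beta) ≠ 0 :=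
    right_ne_zero_of_mul (right_ne_zero_of_mul hden0)
  have hnum : ∀ κ, M.s (z - (Complex.I * M.g κ * M.beta - Complex.I * (M.lam + 1) * M.beta / 4)) =
      M.s (((1 : ℤ) : ℂ) * X J - Complex.I * M.d (M.g κ) (m J) * M.beta) := by
    intro κ
    rw [hz, d_eq hlam (hm J), nodeShift]
    congr 1
    push_cast
    ring
  have hprod : ∏ K ∈ Finset.univ.erase J, ∏ δ ∈ ({1, -1} : Finset ℤ),
      M.f 1 (X J + δ * X K) (m J) (m K) =
      (∏ K ∈ Finset.univ.erase J,
        M.s (z - (X K - M.nodeShift (m K) + Complex.I * M.lam * m K * M.beta))) *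
      (∏ K ∈ Finset.univ.erase J,
        M.s (z - (-X K - M.nodeShift (m K) + Complex.I * M.lam * m K * M.beta))) /
      ((∏ K ∈ Finset.univ.erase J, M.s (z - (X K - M.nodeShift (m K)))) *
        (∏ K ∈ Finset.univ.erase J, M.s (z - (-X K - M.nodeShift (m K))))) := by
    rw [← Finset.prod_mul_distrib, ← Finset.prod_mul_distrib, ← Finset.prod_div_distrib]
    refine Finset.prod_congr rfl fun K _ => ?_
    rw [Finset.prod_pair (by norm_num), f_one (mass_ne_zero hlam (hm J)) (mass_ne_zero hlam (hm K)),
      f_one (mass_ne_zero hlam (hm J)) (mass_ne_zero hlam (hm K)), hz, div_mul_div_comm, mul_comm,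
      mul_comm (M.s (_ + _))]
    congr 3 <;> push_cast <;> ring
  rw [← Finset.mul_prod_erase _ _ (Finset.mem_univ J),
    ← Finset.mul_prod_erase Finset.univ
      (fun K => M.s (z - (-X K - M.nodeShift (m K) + Complex.I * M.lam * m K * M.beta)))
      (Finset.mem_univ J),
    ← Finset.mul_prod_erase Finset.univ (fun K => M.s (z - (-X K - M.nodeShift (m K))))
      (Finset.mem_univ J), V, hprod]
  simp only [hnum]
  have e1 : z - (X J - M.nodeShift (m J) + Complex.I * M.lam * m J * M.beta) =
      -(Complex.I * M.lam * m J * M.beta) := by rw [hz]; ring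
  have e2 : z - (-X J - M.nodeShift (m J) + Complex.I * M.lam * m J * M.beta) =
      2 * X J - Complex.I * M.lam * m J * M.beta := by rw [hz]; ring
  have e3 : z - (-X J - M.nodeShift (m J)) = 2 * X J := by rw [hz]; ring
  have e4 : ((1 : ℤ) : ℂ) * 2 * X J = 2 * X J := by push_cast; ring
  rw [e1, e2, e3, e4, s_neg]
  generalize M.s (2 * X J - Complex.I * M.lam * m J * M.beta) = S at hs2 ⊢
  generalize ∏ K ∈ Finset.univ.erase J, M.s (z - (X K - M.nodeShift (m K))) = P₁
  generalize ∏ K ∈ Finset.univ.erase J, M.s (z - (-X K - M.nodeShift (m K))) = P₂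
  generalize M.s (2 * X J) = Q₁
  generalize M.s (2 * X J - Complex.I * M.beta / m J) = Q₂
  -- Only S is really cancelled. All other denominators match formally, so they may vanish under the
  -- convention 1/0 = 0.
  simp only [div_eq_mul_inv, mul_inv, inv_inv]
  linear_combination (-(4 * (M.halfPeriodProd ^ 2)⁻¹ * Q₁⁻¹ * Q₂⁻¹ * P₁⁻¹ * P₂⁻¹ *
    M.s (Complex.I * M.lam * m J * M.beta) *
    (∏ κ, M.s (((1 : ℤ) : ℂ) * X J - Complex.I * M.d (M.g κ) (m J) * M.beta)) *
    (∏ K ∈ Finset.univ.erase J,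
      M.s (z - (X K - M.nodeShift (m K) + Complex.I * M.lam * m K * M.beta))) *
    (∏ K ∈ Finset.univ.erase J,
      M.s (z - (-X K - M.nodeShift (m K) + Complex.I * M.lam * m K * M.beta)))) : ℂ) *
    mul_inv_cancel₀ hs2

theorem prod_sign_div (X : Fin N → ℂ) (w : ℂ) :
    (∏ δ ∈ ({1, -1} : Finset ℤ), ∏ J, M.s (δ * X J + w + M.nodeShift (m J)
        - Complex.I * M.lam * m J * M.beta) / M.s (δ * X J + w + M.nodeShift (m J))) =
      ((∏ J, M.s (w - (X J - M.nodeShift (m J) + Complex.I * M.lam * m J * M.beta))) *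
        ∏ J, M.s (w - (-X J - M.nodeShift (m J) + Complex.I * M.lam * m J * M.beta))) /
      ((∏ J, M.s (w - (X J - M.nodeShift (m J)))) * ∏ J, M.s (w - (-X J - M.nodeShift (m J)))) := by
  rw [Finset.prod_pair (by norm_num), Finset.prod_div_distrib, Finset.prod_div_distrib,
    div_mul_div_comm, mul_comm, mul_comm (∏ J, M.s (_ + _))]
  congr 2 <;> refine Finset.prod_congr rfl fun J _ => ?_ <;> congr 1 <;> push_cast <;> ring

/-- The offsets ∓i(λ-1)β/4 of the half-period nodes, combined with the half-shifts of the particles,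
are A_J^∓. Thus V^0 is the contribution of these nodes once its exponential weights are trivial. -/
theorem V0_eq (X : Fin N → ℂ)
    (hexp : ∀ ν ∈ Finset.range (M.kind.rho + 1),
      Complex.exp (-M.r * xi ν * M.balance m * M.beta) = 1) :
    M.V0 m X = -(1 / 4) * M.halfPeriodProd ^ 2 *
      ((∑ i ∈ Finset.range (M.kind.rho + 1),
        (∏ j ∈ Finset.univ.disjSum (Finset.univ.disjSum Finset.univ),
          M.s (M.node m X (Sum.inl (Sum.inl i)) - M.numZero m X j)) /
        ∏ j ∈ (M.nodeIndex N).erase (Sum.inl (Sum.inl i)),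
          M.s (M.node m X (Sum.inl (Sum.inl i)) - M.node m X j)) +
      ∑ i ∈ Finset.range (M.kind.rho + 1),
        (∏ j ∈ Finset.univ.disjSum (Finset.univ.disjSum Finset.univ),
          M.s (M.node m X (Sum.inl (Sum.inr i)) - M.numZero m X j)) /
        ∏ j ∈ (M.nodeIndex N).erase (Sum.inl (Sum.inr i)),
          M.s (M.node m X (Sum.inl (Sum.inr i)) - M.node m X j)) := by
  rw [V0, ← Finset.sum_add_distrib]
  congr 1
  refine Finset.sum_congr rfl fun ν hν => ?_
  rw [hexp ν hν, nodeIndex, disjSum_erase_inl, disjSum_erase_inl, disjSum_erase_inl,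
    disjSum_erase_inr]
  simp only [Finset.prod_disjSum, node, numZero, Sum.elim_inl, Sum.elim_inr]
  set z₁ : ℂ := M.omega ν / 2 - Complex.I * (M.lam - 1) * M.beta / 4 with hz₁
  set z₂ : ℂ := M.omega ν / 2 + Complex.I * (M.lam - 1) * M.beta / 4 with hz₂
  have a1 := prod_sign_div (M := M) (m := m) X z₁
  have a2 := prod_sign_div (M := M) (m := m) X z₂
  have b1 : ∀ (δ : ℤ) (J : Fin N), δ * X J + M.omega ν / 2
      + Complex.I / 4 * (M.lam * (m J - 1) + 1 / m J + 1) * M.beta =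
      δ * X J + z₁ + M.nodeShift (m J) := fun δ J => by
    rw [hz₁, nodeShift]; ring
  have b2 : ∀ (δ : ℤ) (J : Fin N), δ * X J + M.omega ν / 2
      + Complex.I / 4 * (M.lam * (m J + 1) + 1 / m J - 1) * M.beta =
      δ * X J + z₂ + M.nodeShift (m J) := fun δ J => by
    rw [hz₂, nodeShift]; ring
  simp only [b1, b2, a1, a2]
  have c1 : ∀ κ, M.omega ν / 2 + Complex.I * M.beta / 2 - Complex.I * M.g κ * M.beta =
      z₁ - (Complex.I * M.g κ * M.beta - Complex.I * (M.lam + 1) * M.beta / 4) := fun κ => by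
    rw [hz₁]; ring
  have c2 : ∀ κ, M.omega ν / 2 + Complex.I * M.lam * M.beta / 2 - Complex.I * M.g κ * M.beta =
      z₂ - (Complex.I * M.g κ * M.beta - Complex.I * (M.lam + 1) * M.beta / 4) := fun κ => by
    rw [hz₂]; ring
  have d1 : ∀ μ, z₁ - (M.omega μ / 2 - Complex.I * (M.lam - 1) * M.beta / 4) =
      (M.omega ν - M.omega μ) / 2 := fun μ => by rw [hz₁]; ring
  have d2 : ∀ μ, z₂ - (M.omega μ / 2 + Complex.I * (M.lam - 1) * M.beta / 4) =
      (M.omega ν - M.omega μ) / 2 := fun μ => by rw [hz₂]; ring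
  have e1 : ∀ μ, z₁ - (M.omega μ / 2 + Complex.I * (M.lam - 1) * M.beta / 4) =
      (M.omega ν - M.omega μ + Complex.I * (1 - M.lam) * M.beta) / 2 := fun μ => by rw [hz₁]; ring
  have e2 : ∀ μ, z₂ - (M.omega μ / 2 - Complex.I * (M.lam - 1) * M.beta / 4) =
      (M.omega ν - M.omega μ + Complex.I * (M.lam - 1) * M.beta) / 2 := fun μ => by rw [hz₂]; ring
  simp only [c1, c2, d1, d2, e1, e2]
  simp only [div_eq_mul_inv, mul_inv]
  ring

theorem sum_node_sub_sum_numZero (X : Fin N → ℂ) :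
    ∑ j ∈ M.nodeIndex N, M.node m X j -
      ∑ j ∈ Finset.univ.disjSum (Finset.univ.disjSum Finset.univ), M.numZero m X j =
      -(Complex.I * M.beta * M.balance m - ∑ ν ∈ Finset.range (M.kind.rho + 1), M.omega ν) := by
  simp only [nodeIndex, Finset.sum_disjSum, node, numZero, Sum.elim_inl, Sum.elim_inr, balance,
    Finset.sum_add_distrib, Finset.sum_sub_distrib, Finset.sum_const, Finset.card_range,
    Finset.card_univ, Fintype.card_fin, ← Finset.sum_div, nsmul_eq_mul, Finset.sum_neg_distrib]
  push_cast
  simp only [← Finset.mul_sum, ← Finset.sum_mul]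
  ring

/-- The source identity in the form of an identity between the coefficients. -/
theorem sum_V_add_V0 (hr : 0 < M.r) (ha : 0 < M.a) (hlam : M.lam ≠ 0)
    (hm : ∀ J, m J ∈ M.masses) (hbal : M.kind ≠ .elliptic ∨ M.balance m = 0) (X : Fin N → ℂ)
    (hX : ∀ i ∈ M.nodeIndex N, ∀ j ∈ M.nodeIndex N, i ≠ j → M.s (M.node m X i - M.node m X j) ≠ 0) :
    ∑ J, M.s (Complex.I * M.lam * m J * M.beta) * (M.V m 1 J X + M.V m (-1) J X) + M.V0 m X =
      M.eigenvalue m := by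
  have hhp := halfPeriodProd_ne_zero hr ha
  -- Either ρ ≤ 1 and only ξ_0 = ξ_1 = 0 occur, or B = 0.
  have hexp : ∀ ν ∈ Finset.range (M.kind.rho + 1),
      Complex.exp (-M.r * xi ν * M.balance m * M.beta) = 1 := by
    intro ν hν
    rcases hbal with h | h
    · have := rho_eq_of_ne_elliptic h
      have : ν ≤ 1 := by
        rw [Finset.mem_range] at hν
        omega
      interval_cases ν <;> simp [xi]
    · simp [h]
  have hsum := sum_node_sub_sum_numZero (M := M) (m := m) X
  have hpf := sum_prod_div_prod_erase (s := M.s) (x := M.node m X) (S := M.nodeIndex N)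
    (b := M.numZero m X) (T := Finset.univ.disjSum (Finset.univ.disjSum Finset.univ))
    (differentiable_s hr ha) (exists_s_ne_zero hr ha) (s_weierstrass hr ha) s_neg hX
    (by simp [nodeIndex]; ring) (by
      by_cases hk : M.kind = .elliptic
      · right
        have hb := hbal.resolve_left (not_not_intro hk)
        rw [hb] at hsum
        have : ∑ ν ∈ Finset.range (M.kind.rho + 1), M.omega ν = 0 := by
          simp [hk, Kind.rho, Finset.sum_range_succ, omega, omega1]
        simpa [this, sub_eq_zero] using hsum
      · exact Or.inl (s_additive hk))
  rw [hsum, s_neg] at hpf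
  rw [V0_eq X hexp, eigenvalue]
  have hinl : ∀ (i : ℕ ⊕ ℕ), i ∈ (Finset.range (M.kind.rho + 1)).disjSum
      (Finset.range (M.kind.rho + 1)) → (Sum.inl i : (ℕ ⊕ ℕ) ⊕ (Fin N ⊕ Fin N)) ∈ M.nodeIndex N :=
    fun i hi => Finset.inl_mem_disjSum.2 hi
  have hinr : ∀ i : Fin N ⊕ Fin N, (Sum.inr i : (ℕ ⊕ ℕ) ⊕ (Fin N ⊕ Fin N)) ∈ M.nodeIndex N :=
    fun i => Finset.inr_mem_disjSum.2 (by cases i <;> simp)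
  have hplus : ∀ J, (∏ j ∈ Finset.univ.disjSum (Finset.univ.disjSum Finset.univ),
          M.s (M.node m X (Sum.inr (Sum.inl J)) - M.numZero m X j)) /
        ∏ j ∈ (M.nodeIndex N).erase (Sum.inr (Sum.inl J)),
          M.s (M.node m X (Sum.inr (Sum.inl J)) - M.node m X j) =
      -(4 / M.halfPeriodProd ^ 2) * (M.s (Complex.I * M.lam * m J * M.beta) * M.V m 1 J X) := by
    intro J
    rw [← node_term_particle hr ha hlam hm X J (z := M.node m X (Sum.inr (Sum.inl J))) rfl]
    · rw [nodeIndex, disjSum_erase_inr, disjSum_erase_inl]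
      simp only [Finset.prod_disjSum, numZero, node, Sum.elim_inl, Sum.elim_inr]
    · exact Finset.prod_ne_zero_iff.2 fun ν hν =>
        hX _ (hinr _) _ (hinl (Sum.inl ν) (Finset.inl_mem_disjSum.2 hν)) (by simp)
    · exact Finset.prod_ne_zero_iff.2 fun ν hν =>
        hX _ (hinr _) _ (hinl (Sum.inr ν) (Finset.inr_mem_disjSum.2 hν)) (by simp)
  have hminus : ∀ J, (∏ j ∈ Finset.univ.disjSum (Finset.univ.disjSum Finset.univ),
          M.s (M.node m X (Sum.inr (Sum.inr J)) - M.numZero m X j)) /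
        ∏ j ∈ (M.nodeIndex N).erase (Sum.inr (Sum.inr J)),
          M.s (M.node m X (Sum.inr (Sum.inr J)) - M.node m X j) =
      -(4 / M.halfPeriodProd ^ 2) * (M.s (Complex.I * M.lam * m J * M.beta) * M.V m (-1) J X) := by
    intro J
    -- Replacing X by -X permutes the nodes and zeros by exchanging mirror images, so the mirror
    -- nodes need no separate computation.
    rw [V_neg_one,
      ← node_term_particle hr ha hlam hm (-X) J (z := M.node m X (Sum.inr (Sum.inr J))) rfl]
    · rw [nodeIndex, disjSum_erase_inr, disjSum_erase_inr]
      simp only [Finset.prod_disjSum, numZero, node, Sum.elim_inl, Sum.elim_inr, Pi.neg_apply,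
        neg_neg]
      congr 1
      · congr 1
        rw [mul_comm]
      · congr 1
        rw [mul_comm]
    · exact Finset.prod_ne_zero_iff.2 fun ν hν =>
        hX _ (hinr _) _ (hinl (Sum.inl ν) (Finset.inl_mem_disjSum.2 hν)) (by simp)
    · exact Finset.prod_ne_zero_iff.2 fun ν hν =>
        hX _ (hinr _) _ (hinl (Sum.inr ν) (Finset.inr_mem_disjSum.2 hν)) (by simp)
  have hsplit : ∀ F : (ℕ ⊕ ℕ) ⊕ (Fin N ⊕ Fin N) → ℂ, ∑ i ∈ M.nodeIndex N, F i =
      (∑ i ∈ Finset.range (M.kind.rho + 1), F (Sum.inl (Sum.inl i)) +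
        ∑ i ∈ Finset.range (M.kind.rho + 1), F (Sum.inl (Sum.inr i))) +
      (∑ J, F (Sum.inr (Sum.inl J)) + ∑ J, F (Sum.inr (Sum.inr J))) := fun F => by
    simp only [nodeIndex, Finset.sum_disjSum]
  rw [hsplit] at hpf
  simp only [hplus, hminus, ← Finset.mul_sum] at hpf
  simp only [mul_add, Finset.sum_add_distrib]
  generalize ∑ J, M.s (Complex.I * M.lam * m J * M.beta) * M.V m 1 J X = S₁ at hpf ⊢
  generalize ∑ J, M.s (Complex.I * M.lam * m J * M.beta) * M.V m (-1) J X = S₂ at hpf ⊢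
  field_simp at hpf
  linear_combination -(1 / 4 : ℂ) * hpf

end Koornwinder.Model

/-! ### Generic points, and the one-particle factor of detailed balance. -/

namespace Koornwinder

/-- Residual sets pull back along nonzero linear forms, survive finite intersections and are dense.
They therefore carry identities valid off discrete subsets of ℂ to generic points of ℂ^N. -/
theorem codiscrete_mem_residual {S : Set ℂ} (hS : S ∈ Filter.codiscrete ℂ) : S ∈ residual ℂ := by
  refine residual_of_dense_open (mem_codiscrete'.1 hS).1 fun x => ?_
  have h1 : S ∈ 𝓝[≠] x := by
    have := mem_codiscrete.1 hS x
    rwa [Filter.disjoint_principal_right, compl_compl] at this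
  rw [mem_closure_iff_nhdsWithin_neBot]
  exact Filter.NeBot.mono (inferInstance : (𝓝[≠] x).NeBot)
    (le_inf nhdsWithin_le_nhds (Filter.le_principal_iff.2 h1))

theorem tendsto_residual_of_linear {E : Type*} [NormedAddCommGroup E] [NormedSpace ℂ E]
    [CompleteSpace E] (L : E →L[ℂ] ℂ) {v : E} (hL : L v ≠ 0) (c : ℂ) :
    Filter.Tendsto (fun x => L x + c) (residual E) (residual ℂ) := by
  have hsurj : Function.Surjective L := fun z => ⟨(z / L v) • v, by simp [hL]⟩
  exact tendsto_residual_of_isOpenMap (by fun_prop)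
    ((Homeomorph.addRight c).isOpenMap.comp (L.isOpenMap hsurj))

theorem tendsto_residual_affine {a : ℂ} (ha : a ≠ 0) (b : ℂ) :
    Filter.Tendsto (fun z => a * z + b) (residual ℂ) (residual ℂ) :=
  tendsto_residual_of_linear (a • ContinuousLinearMap.id ℂ ℂ) (v := 1) (by simpa using ha) b

variable {N : ℕ}

theorem tendsto_residual_coord {a : ℂ} (ha : a ≠ 0) (J : Fin N) (b : ℂ) :
    Filter.Tendsto (fun X : Fin N → ℂ => a * X J + b) (residual (Fin N → ℂ)) (residual ℂ) :=
  tendsto_residual_of_linear (a • ContinuousLinearMap.proj (R := ℂ) (φ := fun _ : Fin N => ℂ) J)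
    (v := Pi.single J 1) (by simpa using ha) b

theorem tendsto_residual_coord_add {J K : Fin N} (hJK : K ≠ J) {a : ℂ} (ha : a ≠ 0) (a' b : ℂ) :
    Filter.Tendsto (fun X : Fin N → ℂ => a * X J + a' * X K + b) (residual (Fin N → ℂ))
      (residual ℂ) :=
  tendsto_residual_of_linear (a • ContinuousLinearMap.proj (R := ℂ) (φ := fun _ : Fin N => ℂ) J +
    a' • ContinuousLinearMap.proj (R := ℂ) (φ := fun _ : Fin N => ℂ) K)
    (v := Pi.single J 1) (by simpa [hJK] using ha) b

/-- Moving one particle J₀ alters only the pairs containing it. The factor u K accompanies the pair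
of J₀ and K, whichever of the two indices is smaller. -/
theorem prod_pairs_mul {g g' : Fin N → Fin N → ℂ} {u u' : Fin N → ℂ} (J₀ : Fin N)
    (h₀ : ∀ J K, J ≠ J₀ → K ≠ J₀ → g J K = g' J K)
    (h₁ : ∀ K, J₀ < K → u K * g J₀ K = u' K * g' J₀ K)
    (h₂ : ∀ K, K < J₀ → u K * g K J₀ = u' K * g' K J₀) :
    (∏ K ∈ Finset.univ.erase J₀, u K) *
        ∏ J, ∏ K ∈ Finset.univ.filter (fun K => J < K), g J K =
      (∏ K ∈ Finset.univ.erase J₀, u' K) *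
        ∏ J, ∏ K ∈ Finset.univ.filter (fun K => J < K), g' J K := by
  have key : ∀ (u : Fin N → ℂ), ∏ K ∈ Finset.univ.erase J₀, u K =
      ∏ J, ∏ K ∈ Finset.univ.filter (fun K => J < K),
        if J = J₀ then u K else if K = J₀ then u J else 1 := by
    intro u
    rw [← Finset.mul_prod_erase _ _ (Finset.mem_univ J₀)]
    have h1 : ∏ K ∈ Finset.univ.filter (fun K => J₀ < K),
        (if J₀ = J₀ then u K else if K = J₀ then u J₀ else 1) =
        ∏ K ∈ Finset.univ.erase J₀, if J₀ < K then u K else 1 := by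
      simp only [if_true]
      rw [← Finset.prod_filter]
      refine Finset.prod_congr ?_ fun _ _ => rfl
      ext K
      simp only [Finset.mem_filter, Finset.mem_erase, Finset.mem_univ, true_and, and_true]
      exact ⟨fun h => ⟨h.ne', h⟩, fun h => h.2⟩
    rw [h1, ← Finset.prod_mul_distrib]
    refine Finset.prod_congr rfl fun K hK => ?_
    have hne := Finset.ne_of_mem_erase hK
    have h2 : ∏ L ∈ Finset.univ.filter (fun L => K < L),
        (if K = J₀ then u L else if L = J₀ then u K else 1) = if K < J₀ then u K else 1 := by
      simp only [hne, if_false]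
      rw [Finset.prod_ite_eq']
      simp
    rw [h2]
    rcases lt_or_gt_of_ne hne with h | h
    · simp [h, h.not_gt]
    · simp [h, h.not_gt]
  rw [key u, key u', ← Finset.prod_mul_distrib, ← Finset.prod_mul_distrib]
  refine Finset.prod_congr rfl fun J _ => ?_
  rw [← Finset.prod_mul_distrib, ← Finset.prod_mul_distrib]
  refine Finset.prod_congr rfl fun K hK => ?_
  have hlt : J < K := (Finset.mem_filter.1 hK).2
  by_cases hJ : J = J₀
  · subst hJ
    simpa using h₁ K hlt
  · by_cases hK' : K = J₀
    · subst hK'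
      simpa [hJ] using h₂ J hlt
    · simp [hJ, hK', h₀ J K hJ hK']

namespace Model

variable {M : Model} {m : Fin N → ℝ} {G : ℂ → ℂ → ℂ}

theorem eventually_s_ne_zero (hr : 0 < M.r) (ha : 0 < M.a) : ∀ᶠ z in residual ℂ, M.s z ≠ 0 := by
  obtain ⟨z, hz⟩ := exists_s_ne_zero hr ha
  exact codiscrete_mem_residual (AnalyticOnNhd.preimage_zero_mem_codiscrete
    (fun z _ => (differentiable_s hr ha).analyticAt z) hz)

theorem eventually_gamma (hr : 0 < M.r) (ha : 0 < M.a)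
    (hG : ∀ α : ℂ, α.re ≠ 0 → IsGammaFunction M.s α (fun x => G x α)) {μ : ℝ} (hμ : μ ≠ 0)
    (hbeta : 0 < M.beta) : ∃ c : ℂ, c ≠ 0 ∧ ∀ᶠ x in residual ℂ, M.s x ≠ 0 ∧
      G (x - Complex.I * (M.beta / μ) / 2) (M.beta / μ) ≠ 0 ∧
      G (x + Complex.I * (M.beta / μ) / 2) (M.beta / μ) =
        c * M.s x * G (x - Complex.I * (M.beta / μ) / 2) (M.beta / μ) := by
  have hre : ((M.beta / μ : ℂ)).re ≠ 0 := by
    rw [← Complex.ofReal_div, Complex.ofReal_re]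
    exact div_ne_zero hbeta.ne' hμ
  obtain ⟨-, c, hc, h⟩ := hG _ hre
  refine ⟨c, hc, ?_⟩
  filter_upwards [eventually_s_ne_zero hr ha, codiscrete_mem_residual h] with x hx hx'
  -- Under the convention 1/0 = 0, a zero of the denominator would force c s(x) = 0.
  have hne : G (x - Complex.I * (M.beta / μ) / 2) (M.beta / μ) ≠ 0 := by
    intro h0
    simp only [h0, div_zero] at hx'
    exact mul_ne_zero hc hx hx'.symm
  exact ⟨hx, hne, (div_eq_iff hne).1 hx'⟩

/-- The part of `V^ε` depending on the external couplings. -/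
noncomputable def ext (M : Model) (μ : ℝ) (x : ℂ) : ℂ :=
  (∏ ν, M.s (x - Complex.I * M.d (M.g ν) μ * M.beta)) /
    (M.s (2 * x) * M.s (2 * x - Complex.I * M.beta / μ))

theorem psiSq_neg (μ : ℝ) (x : ℂ) : M.psiSq G (-x) μ = M.psiSq G x μ := by
  unfold psiSq
  congr 1
  · rw [mul_comm]
    congr 2 <;> ring
  · refine Finset.prod_congr rfl fun ν _ => ?_
    rw [mul_comm, neg_neg]

/-- The functional equation of G cancels the external factor and leaves a function K invariant under
x ↦ iβ/μ - x. Since ψ² is even, the reflected equation is the right-hand side. -/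
theorem eventually_ext_mul_psiSq (hr : 0 < M.r) (ha : 0 < M.a) (hbeta : 0 < M.beta)
    (hG : ∀ α : ℂ, α.re ≠ 0 → IsGammaFunction M.s α (fun x => G x α)) {μ : ℝ} (hμ : μ ≠ 0) :
    ∀ᶠ x in residual ℂ, M.ext μ x * M.psiSq G x μ =
      M.ext μ (-(x - Complex.I * M.beta / μ)) * M.psiSq G (x - Complex.I * M.beta / μ) μ := by
  obtain ⟨c, hc, hev⟩ := eventually_gamma hr ha hG hμ hbeta
  have hμ' : (μ : ℂ) ≠ 0 := by exact_mod_cast hμ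
  set α : ℂ := M.beta / μ with hα
  set K : ℂ → ℂ := fun x => c ^ 2 * (G (2 * x - 3 * Complex.I * α / 2) α *
    G (-2 * x + Complex.I * α / 2) α) / ∏ ν, (c * (
      G (x - Complex.I * α / 2 - Complex.I * M.d (M.g ν) μ * M.beta) α *
      G (-x + Complex.I * α / 2 - Complex.I * M.d (M.g ν) μ * M.beta) α)) with hK
  have hKsymm : ∀ x, K (-(x - Complex.I * α)) = K x := by
    intro x
    simp only [hK]
    congr 1
    · rw [mul_comm (G _ _)]
      congr 3 <;> ring
    · refine Finset.prod_congr rfl fun ν _ => ?_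
      rw [mul_comm (G _ _)]
      congr 3 <;> ring
  have e1 : ∀ x : ℂ, Complex.I * M.beta / μ = Complex.I * α := fun x => by rw [hα]; ring
  have e2 : (Complex.I * M.beta / (2 * μ) : ℂ) = Complex.I * α / 2 := by
    rw [hα]; field_simp
  have hmain : ∀ᶠ x in residual ℂ, M.ext μ x * M.psiSq G x μ = K x := by
    have h1 := (tendsto_residual_affine (a := 2) two_ne_zero 0).eventually hev
    have h2 := (tendsto_residual_affine (a := 2) two_ne_zero (-(Complex.I * α))).eventually hev
    have h3 : ∀ᶠ x in residual ℂ, ∀ ν, M.s (x - Complex.I * M.d (M.g ν) μ * M.beta) ≠ 0 ∧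
        G (x - Complex.I * M.d (M.g ν) μ * M.beta - Complex.I * α / 2) α ≠ 0 ∧
        G (x - Complex.I * M.d (M.g ν) μ * M.beta + Complex.I * α / 2) α =
        c * M.s (x - Complex.I * M.d (M.g ν) μ * M.beta) *
          G (x - Complex.I * M.d (M.g ν) μ * M.beta - Complex.I * α / 2) α := by
      rw [Filter.eventually_all]
      intro ν
      have := (tendsto_residual_affine (a := 1) one_ne_zero
        (-(Complex.I * M.d (M.g ν) μ * M.beta))).eventually hev
      simpa only [one_mul, ← sub_eq_add_neg] using this
    filter_upwards [h1, h2, h3] with x hx1 hx2 hx3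
    simp only [add_zero, ← sub_eq_add_neg] at hx1 hx2
    have a1 : 2 * x - Complex.I * α + Complex.I * α / 2 = 2 * x - Complex.I * α / 2 := by ring
    have a2 : 2 * x - Complex.I * α - Complex.I * α / 2 = 2 * x - 3 * Complex.I * α / 2 := by ring
    rw [a1, a2] at hx2
    simp only [hK, ext, psiSq, e1 x, e2, ← hα]
    rw [hx1.2.2, hx2.2.2]
    have hden : ∏ ν, (G (x + Complex.I * α / 2 - Complex.I * M.d (M.g ν) μ * M.beta) α *
        G (-x + Complex.I * α / 2 - Complex.I * M.d (M.g ν) μ * M.beta) α) =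
        (∏ ν, M.s (x - Complex.I * M.d (M.g ν) μ * M.beta)) * ∏ ν, (c * (
      G (x - Complex.I * α / 2 - Complex.I * M.d (M.g ν) μ * M.beta) α *
      G (-x + Complex.I * α / 2 - Complex.I * M.d (M.g ν) μ * M.beta) α)) := by
      rw [← Finset.prod_mul_distrib]
      refine Finset.prod_congr rfl fun ν _ => ?_
      have b1 : x + Complex.I * α / 2 - Complex.I * M.d (M.g ν) μ * M.beta =
        x - Complex.I * M.d (M.g ν) μ * M.beta + Complex.I * α / 2 := by ring
      have b2 : x - Complex.I * α / 2 - Complex.I * M.d (M.g ν) μ * M.beta =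
        x - Complex.I * M.d (M.g ν) μ * M.beta - Complex.I * α / 2 := by ring
      rw [b1, b2, (hx3 ν).2.2]
      ring
    rw [hden]
    have hP : (∏ ν, M.s (x - Complex.I * M.d (M.g ν) μ * M.beta)) ≠ 0 :=
      Finset.prod_ne_zero_iff.2 fun ν _ => (hx3 ν).1
    have s1 := hx1.1
    have s2 := hx2.1
    generalize (∏ ν, M.s (x - Complex.I * M.d (M.g ν) μ * M.beta)) = P at hP ⊢
    generalize (∏ ν, (c * (
      G (x - Complex.I * α / 2 - Complex.I * M.d (M.g ν) μ * M.beta) α *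
      G (-x + Complex.I * α / 2 - Complex.I * M.d (M.g ν) μ * M.beta) α))) = Q
    rw [div_mul_div_comm, ← mul_div_mul_left _ Q (mul_ne_zero hP (mul_ne_zero s1 s2))]
    congr 1 <;> ring
  have hmain' := (tendsto_residual_affine (a := -1) (by norm_num) (Complex.I * α)).eventually hmain
  filter_upwards [hmain, hmain'] with x hx hx'
  have e3 : -1 * x + Complex.I * α = -(x - Complex.I * α) := by ring
  rw [e3, hKsymm, psiSq_neg] at hx'
  rw [e1 x, hx, hx']

end Model

end Koornwinder

/-! ### The two-particle factors of detailed balance. -/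

namespace Koornwinder.Model

variable {N : ℕ} {M : Model} {m : Fin N → ℝ} {G : ℂ → ℂ → ℂ}

/-- The last branch in the definition of `phiSq` is therefore exactly the case μ' = -1/(λμ). -/
theorem mass_cases (hlam : M.lam ≠ 0) {μ μ' : ℝ} (hμ : μ ∈ M.masses) (hμ' : μ' ∈ M.masses) :
    μ' = μ ∨ μ' = -μ ∨ μ' = 1 / (M.lam * μ) ∨ μ' = -1 / (M.lam * μ) := by
  have h3 : M.lam * -1 = -M.lam := by ring
  rcases hμ with rfl | rfl | rfl | rfl <;> rcases hμ' with rfl | rfl | rfl | rfl <;>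
    simp [h3, neg_div, div_neg, mul_inv_cancel₀ hlam]

/-- Half of detailed balance, up to a multiplier κ invariant under x ↦ iβ/μ - x, which drops out
once φ²(x) is paired with φ²(-x). Both orders of the masses are needed: Φ contains each pair once,
the moved particle can be either member, and for μ' = -μ the factor φ² changes with the order. -/
theorem eventually_f_mul_phiSq (hr : 0 < M.r) (ha : 0 < M.a) (hbeta : 0 < M.beta)
    (hlam : M.lam ≠ 0) (hG : ∀ α : ℂ, α.re ≠ 0 → IsGammaFunction M.s α (fun x => G x α))
    {μ μ' : ℝ} (hμ : μ ∈ M.masses) (hμ' : μ' ∈ M.masses) :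
    (∃ κ : ℂ → ℂ, (∀ x, κ (-(x - Complex.I * M.beta / μ)) = κ x) ∧ ∀ᶠ x in residual ℂ,
      M.f 1 x μ μ' * M.phiSq G x μ μ' =
        κ x * M.phiSq G (x - Complex.I * M.beta / μ) μ μ') ∧
    (∃ κ : ℂ → ℂ, (∀ x, κ (-(x - Complex.I * M.beta / μ)) = κ x) ∧ ∀ᶠ x in residual ℂ,
      M.f 1 x μ μ' * M.phiSq G x μ' μ =
        κ x * M.phiSq G (x - Complex.I * M.beta / μ) μ' μ) := by
  have hμ0 := mass_ne_zero hlam hμ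
  have hμ0' := mass_ne_zero hlam hμ'
  have hμc : (μ : ℂ) ≠ 0 := by exact_mod_cast hμ0
  have hlc : (M.lam : ℂ) ≠ 0 := by exact_mod_cast hlam
  set α : ℂ := M.beta / μ with hα
  set L : ℂ := Complex.I * M.lam * μ * M.beta with hL
  have e1 : (Complex.I * M.beta / μ : ℂ) = Complex.I * α := by rw [hα]; ring
  have e2 : (Complex.I * M.beta / (2 * μ) : ℂ) = Complex.I * α / 2 := by
    rw [hα]; field_simp
  have hs := eventually_s_ne_zero hr ha
  by_cases c1 : μ' = μ
  · subst c1
    obtain ⟨c, hc, hev⟩ := eventually_gamma hr ha hG hμ0 hbeta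
    rw [← hα] at hev
    have h : ∃ κ : ℂ → ℂ, (∀ x, κ (-(x - Complex.I * M.beta / μ')) = κ x) ∧
        ∀ᶠ x in residual ℂ, M.f 1 x μ' μ' * M.phiSq G x μ' μ' =
        κ x * M.phiSq G (x - Complex.I * M.beta / μ') μ' μ' := by
      refine ⟨fun _ => 1, fun _ => rfl, ?_⟩
      have h2 := (tendsto_residual_affine (a := 1) one_ne_zero (-L)).eventually hev
      filter_upwards [hev, h2] with x hx hx2
      simp only [one_mul, ← sub_eq_add_neg] at hx2
      rw [f_one hμ0 hμ0, phiSq, phiSq, if_pos rfl, if_pos rfl, e1, e2, ← hL, sub_add_cancel,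
        hx.2.2, hx2.2.2]
      have a1 : x - Complex.I * α + Complex.I * α / 2 = x - Complex.I * α / 2 := by ring
      have a2 : x - Complex.I * α - L + Complex.I * α / 2 = x - L - Complex.I * α / 2 := by ring
      rw [← hα, a1, a2]
      have := hx.1
      have := hx2.1
      have := hx2.2.1
      field_simp
    exact ⟨h, h⟩
  have c1' : μ ≠ μ' := fun h => c1 h.symm
  by_cases c2 : μ' = -μ
  · have c2' : μ = -μ' := by rw [c2, neg_neg]
    have hf : ∀ x, M.f 1 x μ μ' =
        M.s (x - Complex.I * α / 2 + L / 2) / M.s (x - Complex.I * α / 2 - L / 2) := by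
      intro x
      rw [f_one hμ0 hμ0', c2, nodeShift, nodeShift, hL, hα]
      congr 2 <;> push_cast <;> field_simp <;> ring
    have hden := (tendsto_residual_affine (a := 1) one_ne_zero
      (-(Complex.I * α / 2 + L / 2))).eventually hs
    constructor
    · obtain ⟨c, hc, hev⟩ := eventually_gamma hr ha hG hμ0 hbeta
      rw [← hα] at hev
      refine ⟨fun x => c ^ 2 * (M.s (x - Complex.I * α / 2 + L / 2) *
        M.s (x - Complex.I * α / 2 - L / 2)), fun x => ?_, ?_⟩
      · rw [e1]
        have a1 : -(x - Complex.I * α) - Complex.I * α / 2 + L / 2 =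
          -(x - Complex.I * α / 2 - L / 2) := by ring
        have a2 : -(x - Complex.I * α) - Complex.I * α / 2 - L / 2 =
          -(x - Complex.I * α / 2 + L / 2) := by ring
        simp only [a1, a2, s_neg]
        ring
      · have h2 := (tendsto_residual_affine (a := 1) one_ne_zero
          (-(Complex.I * α / 2 + L / 2))).eventually hev
        filter_upwards [hden, h2] with x hx hx2
        simp only [one_mul, ← sub_eq_add_neg] at hx hx2
        have a0 : x - (Complex.I * α / 2 + L / 2) = x - Complex.I * α / 2 - L / 2 := by ring
        have a1 : x - Complex.I * α / 2 - L / 2 + Complex.I * α / 2 = x - L / 2 := by ring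
        have a2 : x - Complex.I * α / 2 - L / 2 - Complex.I * α / 2 = x - Complex.I * α - L / 2 := by
          ring
        rw [a0] at hx hx2
        rw [a1, a2] at hx2
        rw [hf, phiSq, phiSq, if_neg c1, if_neg c1, if_pos c2, if_pos c2, e1, ← hL, ← hα, hx2.2.2]
        field_simp
    · obtain ⟨c, hc, hev⟩ := eventually_gamma hr ha hG hμ0' hbeta
      -- With the masses exchanged the Gamma function has the opposite step, so its functional
      -- equation runs backwards and κ acquires a reciprocal.
      have hα' : (M.beta / μ' : ℂ) = -α := by
        rw [c2, hα]; push_cast; rw [div_neg]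
      have hL' : (Complex.I * M.lam * μ' * M.beta : ℂ) = -L := by
        rw [c2, hL]; push_cast; ring
      rw [hα'] at hev
      refine ⟨fun x => (c ^ 2 * (M.s (x - Complex.I * α / 2 + L / 2) *
        M.s (x - Complex.I * α / 2 - L / 2)))⁻¹, fun x => ?_, ?_⟩
      · rw [e1]
        have a1 : -(x - Complex.I * α) - Complex.I * α / 2 + L / 2 =
          -(x - Complex.I * α / 2 - L / 2) := by ring
        have a2 : -(x - Complex.I * α) - Complex.I * α / 2 - L / 2 =
          -(x - Complex.I * α / 2 + L / 2) := by ring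
        simp only [a1, a2, s_neg]
        congr 1
        ring
      · have h2 := (tendsto_residual_affine (a := 1) one_ne_zero
          (-(Complex.I * α / 2 - L / 2))).eventually hev
        filter_upwards [hden, h2] with x hx hx2
        simp only [one_mul, ← sub_eq_add_neg] at hx hx2
        have a0 : x - (Complex.I * α / 2 + L / 2) = x - Complex.I * α / 2 - L / 2 := by ring
        have a0' : x - (Complex.I * α / 2 - L / 2) = x - Complex.I * α / 2 + L / 2 := by ring
        have a1 : x - Complex.I * α / 2 + L / 2 - Complex.I * -α / 2 = x - -L / 2 := by ring
        have a2 : x - Complex.I * α / 2 + L / 2 + Complex.I * -α / 2 = x - Complex.I * α - -L / 2 := by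
          ring
        rw [a0] at hx
        rw [a0', a1, a2] at hx2
        rw [hf, phiSq, phiSq, if_neg c1', if_neg c1', if_pos c2', if_pos c2', e1, hL', hα',
          hx2.2.2]
        have := hx2.1
        field_simp
  have c2' : ¬ μ = -μ' := fun h => c2 (by rw [h, neg_neg])
  have hlast : ∃ κ : ℂ → ℂ, (∀ x, κ (-(x - Complex.I * M.beta / μ)) = κ x) ∧
      ∀ᶠ x in residual ℂ, M.f 1 x μ μ' * M.phiSq G x μ μ' =
        κ x * M.phiSq G (x - Complex.I * M.beta / μ) μ μ' := by
    refine ⟨fun _ => 1, fun _ => rfl, ?_⟩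
    by_cases c3 : μ' = 1 / (M.lam * μ)
    · have hf : ∀ x, M.f 1 x μ μ' = M.s (x - Complex.I * α) / M.s x := by
        intro x
        rw [f_one hμ0 hμ0', c3, nodeShift, nodeShift, hα]
        congr 2 <;> push_cast <;> field_simp <;> ring
      filter_upwards [hs] with x hx
      rw [hf, phiSq, phiSq, if_neg c1, if_neg c1, if_neg c2, if_neg c2, if_pos c3, if_pos c3, e1]
      field_simp
    · have c4 : μ' = -1 / (M.lam * μ) :=
        (((mass_cases hlam hμ hμ').resolve_left c1).resolve_left c2).resolve_left c3
      have hf : ∀ x, M.f 1 x μ μ' =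
          M.s (x - L / 2 + Complex.I * α / 2) / M.s (x - L / 2 - Complex.I * α / 2) := by
        intro x
        rw [f_one hμ0 hμ0', c4, nodeShift, nodeShift, hα, hL]
        congr 2 <;> push_cast <;> field_simp <;> ring
      have h2 := (tendsto_residual_affine (a := 1) one_ne_zero
        (-(L / 2 - Complex.I * α / 2))).eventually hs
      filter_upwards [h2] with x hx
      have a0 : 1 * x + -(L / 2 - Complex.I * α / 2) = x - L / 2 + Complex.I * α / 2 := by ring
      have a1 : x - Complex.I * α - L / 2 + Complex.I * α / 2 = x - L / 2 - Complex.I * α / 2 := by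
        ring
      rw [a0] at hx
      rw [hf, phiSq, phiSq, if_neg c1, if_neg c1, if_neg c2, if_neg c2, if_neg c3, if_neg c3, e1,
        e2, ← hL, a1, one_mul, div_mul_eq_mul_div, mul_inv_cancel₀ hx, one_div]
  refine ⟨hlast, ?_⟩
  have hsymm : ∀ x, M.phiSq G x μ' μ = M.phiSq G x μ μ' := by
    intro x
    have c3 : μ' = 1 / (M.lam * μ) ↔ μ = 1 / (M.lam * μ') := by
      rw [eq_div_iff (mul_ne_zero hlam hμ0), eq_div_iff (mul_ne_zero hlam hμ0')]
      constructor <;> intro h <;> linear_combination h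
    rw [phiSq, phiSq, if_neg c1, if_neg c1', if_neg c2, if_neg c2']
    by_cases h3 : μ' = 1 / (M.lam * μ)
    · rw [if_pos h3, if_pos (c3.1 h3)]
    · rw [if_neg h3, if_neg (fun h => h3 (c3.2 h))]
      have c4 : μ' = -1 / (M.lam * μ) :=
        (((mass_cases hlam hμ hμ').resolve_left c1).resolve_left c2).resolve_left h3
      congr 2
      rw [c4]
      push_cast
      field_simp
      ring
  simpa only [hsymm] using hlast

/-- Use the preceding relation at x and at iβ/μ - x: the two multipliers agree, and
cross-multiplication removes them. -/
theorem eventually_f_mul_phiSq_mul_phiSq (hr : 0 < M.r) (ha : 0 < M.a) (hbeta : 0 < M.beta)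
    (hlam : M.lam ≠ 0) (hG : ∀ α : ℂ, α.re ≠ 0 → IsGammaFunction M.s α (fun x => G x α))
    {μ μ' : ℝ} (hμ : μ ∈ M.masses) (hμ' : μ' ∈ M.masses) :
    ∀ᶠ x in residual ℂ,
      M.f 1 x μ μ' * (M.phiSq G x μ μ' * M.phiSq G (-x) μ μ') =
        M.f (-1) (x - Complex.I * M.beta / μ) μ μ' *
          (M.phiSq G (x - Complex.I * M.beta / μ) μ μ' *
            M.phiSq G (-(x - Complex.I * M.beta / μ)) μ μ') ∧
      M.f 1 x μ μ' * (M.phiSq G x μ' μ * M.phiSq G (-x) μ' μ) =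
        M.f (-1) (x - Complex.I * M.beta / μ) μ μ' *
          (M.phiSq G (x - Complex.I * M.beta / μ) μ' μ *
            M.phiSq G (-(x - Complex.I * M.beta / μ)) μ' μ) := by
  have key : ∀ φ κ : ℂ → ℂ, (∀ x, κ (-(x - Complex.I * M.beta / μ)) = κ x) →
      (∀ᶠ x in residual ℂ, M.f 1 x μ μ' * φ x = κ x * φ (x - Complex.I * M.beta / μ)) →
      ∀ᶠ x in residual ℂ, M.f 1 x μ μ' * (φ x * φ (-x)) =
        M.f (-1) (x - Complex.I * M.beta / μ) μ μ' *
          (φ (x - Complex.I * M.beta / μ) * φ (-(x - Complex.I * M.beta / μ))) := by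
    intro φ κ hκ h
    have h' := (tendsto_residual_affine (a := -1) (by norm_num)
      (Complex.I * M.beta / μ)).eventually h
    filter_upwards [h, h'] with x hx hx'
    have e1 : -1 * x + Complex.I * M.beta / μ = -(x - Complex.I * M.beta / μ) := by ring
    have e2 : -(x - Complex.I * M.beta / μ) - Complex.I * M.beta / μ = -x := by ring
    rw [e1, e2, hκ] at hx'
    rw [f_neg_one]
    linear_combination φ (-x) * hx - φ (x - Complex.I * M.beta / μ) * hx'
  obtain ⟨⟨κ, hκ, h⟩, ⟨κ', hκ', h'⟩⟩ := eventually_f_mul_phiSq hr ha hbeta hlam hG hμ hμ'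
  exact (key _ κ hκ h).and (key _ κ' hκ' h')

end Koornwinder.Model

/-! ### Detailed balance and the coefficient identity at regular points. -/

namespace Koornwinder

/-- If the values differed, they would differ on a neighbourhood, which meets the dense set where
the functions agree. -/
theorem eq_of_eventually_residual {E : Type*} [TopologicalSpace E] [BaireSpace E] {f g : E → ℂ}
    {x : E} (hf : ContinuousAt f x) (hg : ContinuousAt g x)
    (h : ∀ᶠ y in residual E, f y = g y) : f x = g x := by
  by_contra hne
  have h1 : ∀ᶠ y in 𝓝 x, f y ≠ g y := by
    have := (hf.sub hg).eventually_ne (sub_ne_zero.2 hne)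
    filter_upwards [this] with y hy
    exact sub_ne_zero.1 hy
  obtain ⟨y, hy1, hy2⟩ := (dense_of_mem_residual h).inter_nhds_nonempty h1
  exact hy2 hy1

namespace Model

variable {N : ℕ} {M : Model} {m : Fin N → ℝ} {G : ℂ → ℂ → ℂ}

theorem V_one_eq (J : Fin N) (X : Fin N → ℂ) :
    M.V m 1 J X = M.ext (m J) (X J) * ∏ K ∈ Finset.univ.erase J,
      (M.f 1 (X J + X K) (m J) (m K) * M.f 1 (X J - X K) (m J) (m K)) := by
  unfold V ext
  congr 1
  · simp
  · refine Finset.prod_congr rfl fun K _ => ?_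
    rw [Finset.prod_pair (by norm_num)]
    simp [sub_eq_add_neg]

theorem V_neg_one_eq (J : Fin N) (X : Fin N → ℂ) :
    M.V m (-1) J X = M.ext (m J) (-X J) * ∏ K ∈ Finset.univ.erase J,
      (M.f (-1) (X J + X K) (m J) (m K) * M.f (-1) (X J - X K) (m J) (m K)) := by
  rw [V_neg_one, V_one_eq]
  simp only [f_neg_one, Pi.neg_apply]
  congr 1
  refine Finset.prod_congr rfl fun K _ => ?_
  congr 2 <;> ring

theorem shift_apply_self (ε : ℤ) (J : Fin N) (X : Fin N → ℂ) :
    M.shift m ε J X J = X J - ε * Complex.I * M.beta / m J := by simp [shift]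

theorem shift_apply_of_ne (ε : ℤ) {J K : Fin N} (h : K ≠ J) (X : Fin N → ℂ) :
    M.shift m ε J X K = X K := by simp [shift, h]

theorem shift_neg_shift (ε : ℤ) (J : Fin N) (X : Fin N → ℂ) :
    M.shift m (-ε) J (M.shift m ε J X) = X := by
  funext K
  by_cases h : K = J
  · subst h
    rw [shift_apply_self, shift_apply_self]
    push_cast
    ring
  · rw [shift_apply_of_ne _ h, shift_apply_of_ne _ h]

theorem continuous_shift (ε : ℤ) (J : Fin N) : Continuous (M.shift m ε J) := by
  unfold shift
  fun_prop

/-- Both sides split into a one-particle factor for J, factors for pairs containing J, and factors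
unaffected by the move; the generic one- and two-particle relations are multiplied together. -/
theorem eventually_detailed_balance (hr : 0 < M.r) (ha : 0 < M.a) (hbeta : 0 < M.beta)
    (hlam : M.lam ≠ 0) (hG : ∀ α : ℂ, α.re ≠ 0 → IsGammaFunction M.s α (fun x => G x α))
    (hm : ∀ J, m J ∈ M.masses) (J : Fin N) :
    ∀ᶠ X in residual (Fin N → ℂ), M.V m 1 J X * M.PhiSq m G X =
      M.V m (-1) J (M.shift m 1 J X) * M.PhiSq m G (M.shift m 1 J X) := by
  have h1 := (tendsto_residual_coord one_ne_zero J 0).eventually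
    (eventually_ext_mul_psiSq hr ha hbeta hG (mass_ne_zero hlam (hm J)))
  have h2 : ∀ a : ℂ, ∀ᶠ X in residual (Fin N → ℂ), ∀ K, K ≠ J → _ := fun a =>
    Filter.eventually_all.2 fun K => by
      by_cases hK : K = J
      · exact Filter.Eventually.of_forall fun X h => absurd hK h
      · exact ((tendsto_residual_coord_add hK one_ne_zero a 0).eventually
          (eventually_f_mul_phiSq_mul_phiSq hr ha hbeta hlam hG (hm J) (hm K))).mono
            fun X hX _ => hX
  filter_upwards [h1, h2 1, h2 (-1)] with X hX1 hX2 hX3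
  set Y := M.shift m 1 J X with hY
  have hYJ : Y J = X J - Complex.I * M.beta / m J := by
    rw [hY, shift_apply_self]
    push_cast
    ring
  have hYK : ∀ K, K ≠ J → Y K = X K := fun K hK => shift_apply_of_ne 1 hK X
  rw [one_mul, add_zero, ← hYJ] at hX1
  have hadd : ∀ K, K ≠ J → Y J + Y K = X J + X K - Complex.I * M.beta / m J := fun K hK => by
    rw [hYJ, hYK K hK]; ring
  have hsub : ∀ K, K ≠ J → Y J - Y K = X J - X K - Complex.I * M.beta / m J := fun K hK => by
    rw [hYJ, hYK K hK]; ring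
  have hpair : ∀ (Z : Fin N → ℂ) (K L : Fin N), (∏ ε ∈ ({1, -1} : Finset ℤ),
      ∏ ε' ∈ ({1, -1} : Finset ℤ), M.phiSq G (ε * Z K + ε' * Z L) (m K) (m L)) =
      M.phiSq G (Z K + Z L) (m K) (m L) * M.phiSq G (-(Z K + Z L)) (m K) (m L) *
      (M.phiSq G (Z K - Z L) (m K) (m L) * M.phiSq G (-(Z K - Z L)) (m K) (m L)) := by
    intro Z K L
    rw [Finset.prod_pair (by norm_num), Finset.prod_pair (by norm_num),
      Finset.prod_pair (by norm_num)]
    have e1 : ((-1 : ℤ) : ℂ) * Z K + ((1 : ℤ) : ℂ) * Z L = -(Z K - Z L) := by push_cast; ring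
    have e2 : ((-1 : ℤ) : ℂ) * Z K + ((-1 : ℤ) : ℂ) * Z L = -(Z K + Z L) := by push_cast; ring
    have e3 : ((1 : ℤ) : ℂ) * Z K + ((1 : ℤ) : ℂ) * Z L = Z K + Z L := by push_cast; ring
    have e4 : ((1 : ℤ) : ℂ) * Z K + ((-1 : ℤ) : ℂ) * Z L = Z K - Z L := by push_cast; ring
    rw [e1, e2, e3, e4]
    ring
  have hprod := prod_pairs_mul (u := fun K => M.f 1 (X J + X K) (m J) (m K) *
      M.f 1 (X J - X K) (m J) (m K)) (u' := fun K => M.f (-1) (Y J + Y K) (m J) (m K) *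
      M.f (-1) (Y J - Y K) (m J) (m K)) (g := fun K L => ∏ ε ∈ ({1, -1} : Finset ℤ),
      ∏ ε' ∈ ({1, -1} : Finset ℤ), M.phiSq G (ε * X K + ε' * X L) (m K) (m L))
      (g' := fun K L => ∏ ε ∈ ({1, -1} : Finset ℤ),
      ∏ ε' ∈ ({1, -1} : Finset ℤ), M.phiSq G (ε * Y K + ε' * Y L) (m K) (m L)) J
      (fun K L hK hL => by simp only [hYK K hK, hYK L hL])
      (fun K hK => by
        obtain ⟨a, -⟩ := hX2 K hK.ne'
        obtain ⟨b, -⟩ := hX3 K hK.ne'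
        simp only [one_mul, add_zero, neg_one_mul, ← sub_eq_add_neg] at a b
        rw [← hadd K hK.ne'] at a
        rw [← hsub K hK.ne'] at b
        simp only [hpair]
        linear_combination M.f 1 (X J - X K) (m J) (m K) * (M.phiSq G (X J - X K) (m J) (m K) *
          M.phiSq G (-(X J - X K)) (m J) (m K)) * a + M.f (-1) (Y J + Y K) (m J) (m K) *
          (M.phiSq G (Y J + Y K) (m J) (m K) * M.phiSq G (-(Y J + Y K)) (m J) (m K)) * b)
      (fun K hK => by
        obtain ⟨-, a⟩ := hX2 K hK.ne
        obtain ⟨-, b⟩ := hX3 K hK.ne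
        simp only [one_mul, add_zero, neg_one_mul, ← sub_eq_add_neg] at a b
        rw [← hadd K hK.ne] at a
        rw [← hsub K hK.ne] at b
        have c1 : ∀ Z : Fin N → ℂ, Z K + Z J = Z J + Z K := fun Z => add_comm _ _
        have c2 : ∀ Z : Fin N → ℂ, Z K - Z J = -(Z J - Z K) := fun Z => by ring
        simp only [hpair]
        rw [c1 X, c1 Y, c2 X, c2 Y, neg_neg, neg_neg]
        linear_combination M.f 1 (X J - X K) (m J) (m K) * (M.phiSq G (X J - X K) (m K) (m J) *
          M.phiSq G (-(X J - X K)) (m K) (m J)) * a + M.f (-1) (Y J + Y K) (m J) (m K) *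
          (M.phiSq G (Y J + Y K) (m K) (m J) * M.phiSq G (-(Y J + Y K)) (m K) (m J)) * b)
  have hpsi : ∏ K ∈ Finset.univ.erase J, M.psiSq G (Y K) (m K) =
      ∏ K ∈ Finset.univ.erase J, M.psiSq G (X K) (m K) :=
    Finset.prod_congr rfl fun K hK => by rw [hYK K (Finset.ne_of_mem_erase hK)]
  rw [V_one_eq, V_neg_one_eq, PhiSq, PhiSq, ← Finset.mul_prod_erase _ _ (Finset.mem_univ J),
    ← Finset.mul_prod_erase Finset.univ (fun K => M.psiSq G (Y K) (m K)) (Finset.mem_univ J), hpsi]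
  have := congrArg₂ (· * ·) hX1 hprod
  linear_combination (∏ K ∈ Finset.univ.erase J, M.psiSq G (X K) (m K)) * this

theorem detailed_balance (hr : 0 < M.r) (ha : 0 < M.a) (hbeta : 0 < M.beta)
    (hlam : M.lam ≠ 0) (hG : ∀ α : ℂ, α.re ≠ 0 → IsGammaFunction M.s α (fun x => G x α))
    (hm : ∀ J, m J ∈ M.masses) (J : Fin N) {X : Fin N → ℂ} (h1 : ContinuousAt (M.V m 1 J) X)
    (h2 : ContinuousAt (M.PhiSq m G) X) (h3 : ContinuousAt (M.V m (-1) J) (M.shift m 1 J X))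
    (h4 : ContinuousAt (M.PhiSq m G) (M.shift m 1 J X)) :
    M.V m 1 J X * M.PhiSq m G X =
      M.V m (-1) J (M.shift m 1 J X) * M.PhiSq m G (M.shift m 1 J X) := by
  have hc : ContinuousAt (M.shift m 1 J) X := (continuous_shift 1 J).continuousAt
  exact eq_of_eventually_residual (h1.mul h2)
    ((ContinuousAt.comp (f := M.shift m 1 J) h3 hc).mul (ContinuousAt.comp h4 hc))
    (eventually_detailed_balance hr ha hbeta hlam hG hm J)

/-- Zeros of s lie in Ω, and doubling a zero of this form would put i(1-λ)β into Ω. -/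
theorem s_half_omega_sub_add_ne_zero (hr : 0 < M.r) (ha : 0 < M.a)
    (hV0 : Complex.I * (1 - M.lam) * M.beta ∉ M.Omega) {μ ν : ℕ} (hμ : μ ≤ M.kind.rho)
    (hν : ν ≤ M.kind.rho) :
    M.s ((M.omega ν - M.omega μ) / 2 + Complex.I * (1 - M.lam) * M.beta / 2) ≠ 0 := by
  intro h0
  have h1 := mem_Omega_of_s_eq_zero hr ha h0
  apply hV0
  have h2 : Complex.I * (1 - M.lam) * M.beta =
      ((M.omega ν - M.omega μ) / 2 + Complex.I * (1 - M.lam) * M.beta / 2) +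
      ((M.omega ν - M.omega μ) / 2 + Complex.I * (1 - M.lam) * M.beta / 2) -
      (M.omega ν - M.omega μ) := by ring
  rw [h2]
  exact M.Omega.sub_mem (M.Omega.add_mem h1 h1)
    (M.Omega.sub_mem (omega_mem_Omega hν) (omega_mem_Omega hμ))

/-- Differences involving a particle node are nonconstant affine functions of X, hence generically
not zeros of s. Differences of half-period nodes do not depend on X: within a family they are
incongruent half-periods, and between the families the assumption on i(1-λ)β applies. -/
theorem eventually_node_sub_ne_zero (hr : 0 < M.r) (ha : 0 < M.a)
    (hV0 : Complex.I * (1 - M.lam) * M.beta ∉ M.Omega) :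
    ∀ᶠ X in residual (Fin N → ℂ), ∀ i ∈ M.nodeIndex N, ∀ j ∈ M.nodeIndex N, i ≠ j →
      M.s (M.node m X i - M.node m X j) ≠ 0 := by
  have hs := eventually_s_ne_zero hr ha
  have hcoord : ∀ (a : ℂ), a ≠ 0 → ∀ (J : Fin N) (b : ℂ),
      ∀ᶠ X in residual (Fin N → ℂ), M.s (a * X J + b) ≠ 0 := fun a ha J b =>
    (tendsto_residual_coord ha J b).eventually hs
  have hpair : ∀ (a a' : ℂ), a ≠ 0 → ∀ (J K : Fin N), K ≠ J → ∀ (b : ℂ),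
      ∀ᶠ X in residual (Fin N → ℂ), M.s (a * X J + a' * X K + b) ≠ 0 := fun a a' ha J K hJK b =>
    (tendsto_residual_coord_add hJK ha a' b).eventually hs
  refine (Filter.eventually_all_finset _).2 fun i hi => (Filter.eventually_all_finset _).2
    fun j hj => ?_
  by_cases hij : i = j
  · exact Filter.Eventually.of_forall fun X h => absurd hij h
  suffices h : ∀ᶠ X in residual (Fin N → ℂ), M.s (M.node m X i - M.node m X j) ≠ 0 from
    h.mono fun X hX _ => hX
  have hcongr : ∀ (ℓ : (Fin N → ℂ) → ℂ), (∀ᶠ X in residual (Fin N → ℂ), M.s (ℓ X) ≠ 0) →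
      (∀ X, M.node m X i - M.node m X j = ℓ X) →
      ∀ᶠ X in residual (Fin N → ℂ), M.s (M.node m X i - M.node m X j) ≠ 0 := fun ℓ hℓ h => by
    simpa only [h] using hℓ
  have hle : ∀ ν ∈ Finset.range (M.kind.rho + 1), ν ≤ M.kind.rho := fun ν hν =>
    Nat.lt_succ_iff.1 (Finset.mem_range.1 hν)
  rcases i with (ν | ν) | (J | J) <;> rcases j with (μ | μ) | (K | K) <;>
    simp only [nodeIndex, Finset.inl_mem_disjSum, Finset.inr_mem_disjSum] at hi hj
  · refine Filter.Eventually.of_forall fun X => ?_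
    convert s_half_omega_sub_ne_zero hr ha (hle _ hj) (hle _ hi) (by simpa using hij) using 2
    simp only [node, Sum.elim_inl]
    ring
  · refine Filter.Eventually.of_forall fun X => ?_
    convert s_half_omega_sub_add_ne_zero hr ha hV0 (hle _ hj) (hle _ hi) using 2
    simp only [node, Sum.elim_inl, Sum.elim_inr]
    ring
  · exact hcongr _ (hcoord (-1) (by norm_num) K (M.omega ν / 2 -
      Complex.I * (M.lam - 1) * M.beta / 4 + M.nodeShift (m K)))
      fun X => by simp only [node, Sum.elim_inl, Sum.elim_inr]; ring
  · exact hcongr _ (hcoord 1 (by norm_num) K (M.omega ν / 2 -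
      Complex.I * (M.lam - 1) * M.beta / 4 + M.nodeShift (m K)))
      fun X => by simp only [node, Sum.elim_inl, Sum.elim_inr]; ring
  · refine Filter.Eventually.of_forall fun X => ?_
    rw [← neg_sub, s_neg, neg_ne_zero]
    convert s_half_omega_sub_add_ne_zero hr ha hV0 (hle _ hi) (hle _ hj) using 2
    simp only [node, Sum.elim_inl, Sum.elim_inr]
    ring
  · refine Filter.Eventually.of_forall fun X => ?_
    convert s_half_omega_sub_ne_zero hr ha (hle _ hj) (hle _ hi) (by simpa using hij) using 2
    simp only [node, Sum.elim_inl, Sum.elim_inr]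
    ring
  · exact hcongr _ (hcoord (-1) (by norm_num) K (M.omega ν / 2 +
      Complex.I * (M.lam - 1) * M.beta / 4 + M.nodeShift (m K)))
      fun X => by simp only [node, Sum.elim_inl, Sum.elim_inr]; ring
  · exact hcongr _ (hcoord 1 (by norm_num) K (M.omega ν / 2 +
      Complex.I * (M.lam - 1) * M.beta / 4 + M.nodeShift (m K)))
      fun X => by simp only [node, Sum.elim_inl, Sum.elim_inr]; ring
  · exact hcongr _ (hcoord 1 (by norm_num) J (-(M.omega μ / 2 -
      Complex.I * (M.lam - 1) * M.beta / 4) - M.nodeShift (m J)))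
      fun X => by simp only [node, Sum.elim_inl, Sum.elim_inr]; ring
  · exact hcongr _ (hcoord 1 (by norm_num) J (-(M.omega μ / 2 +
      Complex.I * (M.lam - 1) * M.beta / 4) - M.nodeShift (m J)))
      fun X => by simp only [node, Sum.elim_inl, Sum.elim_inr]; ring
  · have hJK : K ≠ J := fun h => hij (by rw [h])
    exact hcongr _ (hpair 1 (-1) (by norm_num) J K hJK (M.nodeShift (m K) - M.nodeShift (m J)))
      fun X => by simp only [node, Sum.elim_inl, Sum.elim_inr]; ring
  · by_cases hJK : K = J
    · subst hJK
      exact hcongr _ (hcoord 2 (by norm_num) K 0)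
        fun X => by simp only [node, Sum.elim_inl, Sum.elim_inr]; ring
    · exact hcongr _ (hpair 1 1 (by norm_num) J K hJK (M.nodeShift (m K) - M.nodeShift (m J)))
        fun X => by simp only [node, Sum.elim_inl, Sum.elim_inr]; ring
  · exact hcongr _ (hcoord (-1) (by norm_num) J (-(M.omega μ / 2 -
      Complex.I * (M.lam - 1) * M.beta / 4) - M.nodeShift (m J)))
      fun X => by simp only [node, Sum.elim_inl, Sum.elim_inr]; ring
  · exact hcongr _ (hcoord (-1) (by norm_num) J (-(M.omega μ / 2 +
      Complex.I * (M.lam - 1) * M.beta / 4) - M.nodeShift (m J)))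
      fun X => by simp only [node, Sum.elim_inl, Sum.elim_inr]; ring
  · by_cases hJK : K = J
    · subst hJK
      exact hcongr _ (hcoord (-2) (by norm_num) K 0)
        fun X => by simp only [node, Sum.elim_inl, Sum.elim_inr]; ring
    · exact hcongr _ (hpair (-1) (-1) (by norm_num) J K hJK
        (M.nodeShift (m K) - M.nodeShift (m J)))
        fun X => by simp only [node, Sum.elim_inl, Sum.elim_inr]; ring
  · have hJK : K ≠ J := fun h => hij (by rw [h])
    exact hcongr _ (hpair (-1) 1 (by norm_num) J K hJK (M.nodeShift (m K) - M.nodeShift (m J)))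
      fun X => by simp only [node, Sum.elim_inr]; ring

theorem sum_V_add_V0_of_continuousAt (hr : 0 < M.r) (ha : 0 < M.a) (hlam : M.lam ≠ 0)
    (hV0 : Complex.I * (1 - M.lam) * M.beta ∉ M.Omega)
    (hm : ∀ J, m J ∈ M.masses) (hbal : M.kind ≠ .elliptic ∨ M.balance m = 0) {X : Fin N → ℂ}
    (h0 : ContinuousAt (M.V0 m) X) (h1 : ∀ J, ContinuousAt (M.V m 1 J) X)
    (h2 : ∀ J, ContinuousAt (M.V m (-1) J) X) :
    ∑ J, M.s (Complex.I * M.lam * m J * M.beta) * (M.V m 1 J X + M.V m (-1) J X) + M.V0 m X =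
      M.eigenvalue m := by
  refine eq_of_eventually_residual (f := fun X => ∑ J, M.s (Complex.I * M.lam * m J * M.beta) *
    (M.V m 1 J X + M.V m (-1) J X) + M.V0 m X) (g := fun _ => M.eigenvalue m) ?_
    continuousAt_const ?_
  · exact (tendsto_finsetSum _ fun J _ => ((h1 J).add (h2 J)).const_mul _).add h0
  · filter_upwards [eventually_node_sub_ne_zero (m := m) hr ha hV0] with X hX
    exact sum_V_add_V0 hr ha hlam hm hbal X hX

end Model

end Koornwinder

/-! ### The source identity in the balanced and the non-elliptic cases. -/

namespace Koornwinder.Model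

variable {N : ℕ} {M : Model} {m : Fin N → ℝ} {G : ℂ → ℂ → ℂ} {U : Set (Fin N → ℂ)}

theorem shift_shift_neg (ε : ℤ) (J : Fin N) (X : Fin N → ℂ) :
    M.shift m ε J (M.shift m (-ε) J X) = X := by
  simpa using M.shift_neg_shift (m := m) (-ε) J X

theorem detailed_balance_of_regular (hr : 0 < M.r) (ha : 0 < M.a) (hbeta : 0 < M.beta)
    (hlam : M.lam ≠ 0) (hG : ∀ α : ℂ, α.re ≠ 0 → IsGammaFunction M.s α (fun x => G x α))
    (hm : ∀ J, m J ∈ M.masses) (hreg : ∀ X ∈ U, M.Regular m G X) (J : Fin N) {X : Fin N → ℂ}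
    (hX : X ∈ U ∪ M.shift m 1 J '' U) :
    M.V m 1 J (M.shift m (-1) J X) * M.PhiSq m G (M.shift m (-1) J X) =
      M.V m (-1) J X * M.PhiSq m G X := by
  rcases hX with hX | ⟨Y, hY, rfl⟩
  · have h := hreg X hX
    have e := M.shift_shift_neg (m := m) 1 J X
    have := detailed_balance (X := M.shift m (-1) J X) hr ha hbeta hlam hG hm J
      (by simpa using h.coeff_shift J (-1) (by simp)) (h.phi_shift J (-1) (by simp)).1
      (by rw [e]; exact h.coeff J (-1) (by simp)) (by rw [e]; exact h.phi.1)
    rwa [e] at this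
  · have h := hreg Y hY
    rw [shift_neg_shift]
    exact detailed_balance hr ha hbeta hlam hG hm J (h.coeff J 1 (by simp)) h.phi.1
      (h.coeff_shift J 1 (by simp)) (h.phi_shift J 1 (by simp)).1

theorem union_shift_subset_shiftClosure (J : Fin N) :
    U ∪ M.shift m 1 J '' U ⊆ M.shiftClosure m U :=
  Set.union_subset_union_right _ fun _ hX => Set.mem_iUnion.2 ⟨J, Or.inl hX⟩

theorem union_shift_neg_subset_shiftClosure (J : Fin N) :
    U ∪ M.shift m (-1) J '' U ⊆ M.shiftClosure m U :=
  Set.union_subset_union_right _ fun _ hX => Set.mem_iUnion.2 ⟨J, Or.inr hX⟩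

theorem shift_neg_mem_of_mem {J : Fin N} {X : Fin N → ℂ} (hX : X ∈ U ∪ M.shift m 1 J '' U) :
    M.shift m (-1) J X ∈ U ∪ M.shift m (-1) J '' U := by
  rcases hX with hX | ⟨Y, hY, rfl⟩
  · exact Or.inr ⟨X, hX, rfl⟩
  · rw [shift_neg_shift]
    exact Or.inl hY

theorem sourceIdentity_of_balance (hr : 0 < M.r) (ha : 0 < M.a) (hbeta : 0 < M.beta)
    (hlam : M.lam ≠ 0) (hV0 : Complex.I * (1 - M.lam) * M.beta ∉ M.Omega)
    (hG : ∀ α : ℂ, α.re ≠ 0 → IsGammaFunction M.s α (fun x => G x α))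
    (hm : ∀ J, m J ∈ M.masses) (hreg : ∀ X ∈ U, M.Regular m G X) {Φ : (Fin N → ℂ) → ℂ}
    (hΦ : IsSqrtBranch (M.PhiSq m G) (M.shiftClosure m U) Φ) {Rp : Fin N → (Fin N → ℂ) → ℂ}
    (hRp : ∀ J, IsSqrtBranch (M.V m 1 J) (U ∪ M.shift m (-1) J '' U) (Rp J))
    (hbal : M.kind ≠ .elliptic ∨ M.balance m = 0) : M.SourceIdentity m U Φ Rp := by
  have hne : ∀ J, ∀ X ∈ U ∪ M.shift m 1 J '' U, Φ X ≠ 0 := by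
    intro J X hX h0
    have hsq := hΦ.2 X (union_shift_subset_shiftClosure J hX)
    rw [h0, zero_pow two_ne_zero] at hsq
    rcases hX with hX | ⟨Y, hY, rfl⟩
    · exact (hreg X hX).phi.2 hsq.symm
    · exact ((hreg Y hY).phi_shift J 1 (by simp)).2 hsq.symm
  -- Detailed balance dictates this branch: its square is V_J^-, it is continuous because Φ has no
  -- zero there, and it turns the hopping terms into V_J^± Φ.
  refine ⟨fun J X => Rp J (M.shift m (-1) J X) * Φ (M.shift m (-1) J X) / Φ X, fun J => ⟨?_, ?_⟩,
    ?_⟩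
  · have hmaps : Set.MapsTo (M.shift m (-1) J) (U ∪ M.shift m 1 J '' U)
      (U ∪ M.shift m (-1) J '' U) := fun X hX => shift_neg_mem_of_mem hX
    have hc : ContinuousOn (M.shift m (-1) J) (U ∪ M.shift m 1 J '' U) :=
      (continuous_shift (-1) J).continuousOn
    exact (((hRp J).1.comp hc hmaps).mul ((hΦ.1.mono (union_shift_neg_subset_shiftClosure J)).comp
      hc hmaps)).div (hΦ.1.mono (union_shift_subset_shiftClosure J)) (hne J)
  · intro X hX
    have hY := shift_neg_mem_of_mem hX
    have h1 := detailed_balance_of_regular hr ha hbeta hlam hG hm hreg J hX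
    rw [← hΦ.2 X (union_shift_subset_shiftClosure J hX),
      ← hΦ.2 _ (union_shift_neg_subset_shiftClosure J hY), ← (hRp J).2 _ hY] at h1
    have := hne J X hX
    rw [div_pow, mul_pow, div_eq_iff (pow_ne_zero 2 this), h1]
  · intro X hX
    have h := hreg X hX
    have hΦX : Φ X ≠ 0 := by
      intro h0
      have := hΦ.2 X (Or.inl hX)
      rw [h0, zero_pow two_ne_zero] at this
      exact h.phi.2 this.symm
    have hterm : ∀ J, Rp J X * (Rp J (M.shift m (-1) J (M.shift m 1 J X)) *
        Φ (M.shift m (-1) J (M.shift m 1 J X)) / Φ (M.shift m 1 J X) * Φ (M.shift m 1 J X)) +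
        Rp J (M.shift m (-1) J X) * Φ (M.shift m (-1) J X) / Φ X *
          (Rp J (M.shift m (-1) J X) * Φ (M.shift m (-1) J X)) =
        (M.V m 1 J X + M.V m (-1) J X) * Φ X := by
      intro J
      have hX1 : X ∈ U ∪ M.shift m 1 J '' U := Or.inl hX
      have hS := hne J (M.shift m 1 J X) (Or.inr ⟨X, hX, rfl⟩)
      have hY := shift_neg_mem_of_mem hX1
      have h1 := detailed_balance_of_regular hr ha hbeta hlam hG hm hreg J hX1
      rw [← hΦ.2 X (Or.inl hX), ← hΦ.2 _ (union_shift_neg_subset_shiftClosure J hY),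
        ← (hRp J).2 _ hY] at h1
      rw [shift_neg_shift, div_mul_cancel₀ _ hS, ← (hRp J).2 X (Or.inl hX)]
      field_simp
      linear_combination h1
    have hsum := sum_V_add_V0_of_continuousAt hr ha hlam hV0 hm hbal h.potential
      (fun J => h.coeff J 1 (by simp)) (fun J => h.coeff J (-1) (by simp))
    simp only [H, hterm]
    rw [← hsum, sub_eq_zero, add_mul, Finset.sum_mul]
    simp only [mul_assoc]

/-! ### Behaviour of the elliptic coefficients under translation by ia. -/

/-- Translation of the `J`-th variable by the period `i a`. -/
noncomputable def periodShift (M : Model) (J : Fin N) (X : Fin N → ℂ) : Fin N → ℂ :=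
  Function.update X J (X J + Complex.I * M.a)

theorem periodShift_self (J : Fin N) (X : Fin N → ℂ) :
    M.periodShift J X J = X J + Complex.I * M.a := by simp [periodShift]

theorem periodShift_of_ne {J K : Fin N} (h : K ≠ J) (X : Fin N → ℂ) :
    M.periodShift J X K = X K := by simp [periodShift, h]

theorem periodShift_neg_periodShift (J : Fin N) (X : Fin N → ℂ) :
    M.periodShift J (-M.periodShift J X) = -X := by
  funext K
  by_cases h : K = J
  · subst h
    rw [periodShift_self, Pi.neg_apply, periodShift_self, Pi.neg_apply]
    ring
  · rw [periodShift_of_ne h, Pi.neg_apply, periodShift_of_ne h, Pi.neg_apply]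

section Elliptic

variable (h : M.kind = .elliptic)
include h

/-- The multiplier of s is exponential in its argument, so in a quotient its dependence on u
cancels. -/
theorem s_sub_div_s_add_period (u w : ℂ) :
    M.s (u + Complex.I * M.a - w) / M.s (u + Complex.I * M.a) =
      Complex.exp (2 * Complex.I * M.r * w) * (M.s (u - w) / M.s u) := by
  have e : u + Complex.I * M.a - w = u - w + Complex.I * M.a := by ring
  have e2 : Complex.exp (M.r * M.a - 2 * Complex.I * M.r * (u - w)) =
      Complex.exp (2 * Complex.I * M.r * w) * Complex.exp (M.r * M.a - 2 * Complex.I * M.r * u) := by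
    rw [← Complex.exp_add]
    congr 1
    ring
  rw [e, s_add_I_mul h, s_add_I_mul h, e2, mul_div_mul_comm, neg_div_neg_eq,
    mul_div_cancel_right₀ _ (Complex.exp_ne_zero _)]

theorem s_sub_div_s_sub_period (u w : ℂ) :
    M.s (u - Complex.I * M.a - w) / M.s (u - Complex.I * M.a) =
      Complex.exp (-(2 * Complex.I * M.r * w)) * (M.s (u - w) / M.s u) := by
  have := s_sub_div_s_add_period h (u - Complex.I * M.a) w
  rw [sub_add_cancel] at this
  rw [this, ← mul_assoc, ← Complex.exp_add, neg_add_cancel, Complex.exp_zero, one_mul]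

theorem f_one_add_period (x : ℂ) (μ μ' : ℝ) :
    M.f 1 (x + Complex.I * M.a) μ μ' =
      Complex.exp (-(2 * M.r * M.lam * μ' * M.beta)) * M.f 1 x μ μ' := by
  unfold f
  have := s_sub_div_s_add_period h
    (x - ((1 : ℤ) : ℂ) * Complex.I * (μ - μ') * (M.lam * μ * μ' - 1) * M.beta / (4 * μ * μ'))
    (((1 : ℤ) : ℂ) * Complex.I * M.lam * μ' * M.beta)
  have e : (2 * Complex.I * M.r * (((1 : ℤ) : ℂ) * Complex.I * M.lam * μ' * M.beta) : ℂ) =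
      -(2 * M.r * M.lam * μ' * M.beta) := by
    push_cast
    linear_combination (2 * M.r * M.lam * μ' * M.beta : ℂ) * Complex.I_sq
  rw [e] at this
  rw [← this]
  congr 2 <;> ring

theorem f_one_sub_period (x : ℂ) (μ μ' : ℝ) :
    M.f 1 (x - Complex.I * M.a) μ μ' =
      Complex.exp (2 * M.r * M.lam * μ' * M.beta) * M.f 1 x μ μ' := by
  have := f_one_add_period h (x - Complex.I * M.a) μ μ'
  rw [sub_add_cancel] at this
  rw [this, ← mul_assoc, ← Complex.exp_add, add_neg_cancel, Complex.exp_zero, one_mul]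

/-- The eight numerator factors advance by one period and the two denominator factors by two
periods. A double translation has four times the linear exponent in its argument, itself about 2x,
so the dependence on x cancels: 16 = 8 + 8. -/
theorem ext_add_period (x : ℂ) (μ : ℝ) :
    M.ext μ (x + Complex.I * M.a) =
      Complex.exp (-(2 * M.r * M.beta * (∑ ν, (M.d (M.g ν) μ : ℂ) - 2 / μ))) * M.ext μ x := by
  have hnum : ∏ ν, M.s (x + Complex.I * M.a - Complex.I * M.d (M.g ν) μ * M.beta) =
      Complex.exp (8 * M.r * M.a - 16 * Complex.I * M.r * x -
        2 * M.r * M.beta * ∑ ν, (M.d (M.g ν) μ : ℂ)) *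
        ∏ ν, M.s (x - Complex.I * M.d (M.g ν) μ * M.beta) := by
    have e : ∀ ν, M.s (x + Complex.I * M.a - Complex.I * M.d (M.g ν) μ * M.beta) =
        -1 * Complex.exp (M.r * M.a - 2 * Complex.I * M.r * x - 2 * M.r * M.beta * M.d (M.g ν) μ) *
          M.s (x - Complex.I * M.d (M.g ν) μ * M.beta) := by
      intro ν
      have e1 : x + Complex.I * M.a - Complex.I * M.d (M.g ν) μ * M.beta =
        x - Complex.I * M.d (M.g ν) μ * M.beta + Complex.I * M.a := by ring
      rw [e1, s_add_I_mul h, neg_one_mul]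
      congr 3
      linear_combination (2 * M.r * M.d (M.g ν) μ * M.beta : ℂ) * Complex.I_sq
    simp only [e]
    rw [Finset.prod_mul_distrib, Finset.prod_mul_distrib, Finset.prod_const, Finset.card_univ,
      Fintype.card_fin, ← Complex.exp_sum, Finset.sum_sub_distrib, Finset.sum_const,
      Finset.card_univ, Fintype.card_fin, ← Finset.mul_sum]
    have e3 : 2 * M.kind.rho + 2 = 8 := by simp [h, Kind.rho]
    generalize ∑ ν, (M.d (M.g ν) μ : ℂ) = D
    rw [show (-1 : ℂ) ^ (2 * M.kind.rho + 2) = 1 by rw [e3]; norm_num,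
      show (2 * M.kind.rho + 2) • ((M.r : ℂ) * M.a - 2 * Complex.I * M.r * x) =
        8 * M.r * M.a - 16 * Complex.I * M.r * x by rw [e3, nsmul_eq_mul]; push_cast; ring, one_mul]
  have hden : ∀ y : ℂ, M.s (y + 2 * (Complex.I * M.a)) =
      Complex.exp (4 * M.r * M.a - 4 * Complex.I * M.r * y) * M.s y := by
    intro y
    have e1 : y + 2 * (Complex.I * M.a) = y + Complex.I * M.a + Complex.I * M.a := by ring
    rw [e1, s_add_I_mul h, s_add_I_mul h, ← mul_assoc, neg_mul_neg, ← Complex.exp_add]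
    congr 2
    linear_combination (-2 * M.r * M.a : ℂ) * Complex.I_sq
  have e1 : 2 * (x + Complex.I * M.a) = 2 * x + 2 * (Complex.I * M.a) := by ring
  have e2 : 2 * x + 2 * (Complex.I * M.a) - Complex.I * M.beta / μ =
    2 * x - Complex.I * M.beta / μ + 2 * (Complex.I * M.a) := by ring
  unfold ext
  rw [hnum, e1, e2, hden, hden]
  have e3 : Complex.exp (8 * M.r * M.a - 16 * Complex.I * M.r * x -
        2 * M.r * M.beta * ∑ ν, (M.d (M.g ν) μ : ℂ)) =
      Complex.exp (-(2 * M.r * M.beta * (∑ ν, (M.d (M.g ν) μ : ℂ) - 2 / μ))) *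
      (Complex.exp (4 * M.r * M.a - 4 * Complex.I * M.r * (2 * x)) *
      Complex.exp (4 * M.r * M.a - 4 * Complex.I * M.r * (2 * x - Complex.I * M.beta / μ))) := by
    rw [← Complex.exp_add, ← Complex.exp_add]
    congr 1
    linear_combination (-4 * M.r * M.beta / μ : ℂ) * Complex.I_sq
  have key : ∀ Q E1 E2 P A B : ℂ, E1 ≠ 0 → E2 ≠ 0 →
      Q * (E1 * E2) * P / (E1 * A * (E2 * B)) = Q * (P / (A * B)) := by
    intro Q E1 E2 P A B h1 h2
    rw [mul_mul_mul_comm E1, mul_right_comm, mul_comm (Q * P),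
      mul_div_mul_left _ _ (mul_ne_zero h1 h2), mul_div_assoc]
  rw [e3]
  exact key _ _ _ _ _ _ (Complex.exp_ne_zero _) (Complex.exp_ne_zero _)

/-- The external couplings and the interactions contribute constant multipliers; the formula for d
on Λ makes the total exponent -2rβB, whatever the mass of the moved particle. -/
theorem V_one_periodShift_self (hlam : M.lam ≠ 0) (hm : ∀ J, m J ∈ M.masses) (J : Fin N)
    (X : Fin N → ℂ) : M.V m 1 J (M.periodShift J X) =
      Complex.exp (-(2 * M.r * M.beta * M.balance m)) * M.V m 1 J X := by
  have hf : ∏ K ∈ Finset.univ.erase J,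
      (M.f 1 (M.periodShift J X J + M.periodShift J X K) (m J) (m K) *
        M.f 1 (M.periodShift J X J - M.periodShift J X K) (m J) (m K)) =
      Complex.exp (-(4 * M.r * M.lam * M.beta * ∑ K ∈ Finset.univ.erase J, (m K : ℂ))) *
      ∏ K ∈ Finset.univ.erase J,
        (M.f 1 (X J + X K) (m J) (m K) * M.f 1 (X J - X K) (m J) (m K)) := by
    rw [Finset.mul_sum, ← Finset.sum_neg_distrib, Complex.exp_sum, ← Finset.prod_mul_distrib]
    refine Finset.prod_congr rfl fun K hK => ?_
    have e1 : X J + Complex.I * M.a + X K = X J + X K + Complex.I * M.a := by ring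
    have e2 : X J + Complex.I * M.a - X K = X J - X K + Complex.I * M.a := by ring
    have e3 : Complex.exp (-(4 * M.r * M.lam * M.beta * m K)) =
        Complex.exp (-(2 * M.r * M.lam * m K * M.beta)) *
          Complex.exp (-(2 * M.r * M.lam * m K * M.beta)) := by
      rw [← Complex.exp_add]
      congr 1
      ring
    rw [periodShift_self, periodShift_of_ne (Finset.ne_of_mem_erase hK), e1, e2,
      f_one_add_period h, f_one_add_period h, e3]
    ring
  rw [V_one_eq, V_one_eq, hf, periodShift_self, ext_add_period h]
  have hsum : (m J : ℂ) + ∑ K ∈ Finset.univ.erase J, (m K : ℂ) = ∑ K, (m K : ℂ) :=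
    Finset.add_sum_erase _ (fun K => (m K : ℂ)) (Finset.mem_univ J)
  have hd : ∑ ν, (M.d (M.g ν) (m J) : ℂ) =
      ∑ ν, (M.g ν : ℂ) + 2 * (M.lam * m J + 1 / m J) - 2 * (M.lam + 1) := by
    simp only [d_eq hlam (hm J)]
    push_cast
    rw [Finset.sum_sub_distrib, Finset.sum_add_distrib, Finset.sum_const, Finset.sum_const,
      Finset.card_univ, Fintype.card_fin]
    have e3 : 2 * M.kind.rho + 2 = 8 := by simp [h, Kind.rho]
    rw [show ∀ z : ℂ, (2 * M.kind.rho + 2) • z = 8 * z by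
      intro z; rw [e3, nsmul_eq_mul]; norm_num]
    rw [show ∀ z : ℂ, (2 * M.kind.rho + 2) • z = 8 * z by
      intro z; rw [e3, nsmul_eq_mul]; norm_num]
    ring
  have hexp : Complex.exp (-(2 * M.r * M.beta * M.balance m)) =
      Complex.exp (-(2 * M.r * M.beta * (∑ ν, (M.d (M.g ν) (m J) : ℂ) - 2 / m J))) *
      Complex.exp (-(4 * M.r * M.lam * M.beta * ∑ K ∈ Finset.univ.erase J, (m K : ℂ))) := by
    rw [← Complex.exp_add]
    congr 1
    have hrho : (M.kind.rho : ℂ) = 3 := by simp [h, Kind.rho]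
    unfold balance
    push_cast
    rw [← hsum, hrho, hd]
    ring
  rw [hexp]
  ring

/-- The factors in X_K + X_J and X_K - X_J acquire reciprocal multipliers. -/
theorem V_one_periodShift_of_ne {J K : Fin N} (hJK : K ≠ J) (X : Fin N → ℂ) :
    M.V m 1 K (M.periodShift J X) = M.V m 1 K X := by
  rw [V_one_eq, V_one_eq, periodShift_of_ne hJK]
  congr 1
  refine Finset.prod_congr rfl fun L _ => ?_
  by_cases hL : L = J
  · subst hL
    rw [periodShift_self, ← add_assoc, ← sub_sub, f_one_add_period h, f_one_sub_period h,
      mul_mul_mul_comm, ← Complex.exp_add, neg_add_cancel, Complex.exp_zero, one_mul]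
  · rw [periodShift_of_ne hL]

theorem V_neg_one_periodShift_self (hlam : M.lam ≠ 0) (hm : ∀ J, m J ∈ M.masses) (J : Fin N)
    (X : Fin N → ℂ) : Complex.exp (-(2 * M.r * M.beta * M.balance m)) *
      M.V m (-1) J (M.periodShift J X) = M.V m (-1) J X := by
  rw [V_neg_one, V_neg_one, ← V_one_periodShift_self h hlam hm, periodShift_neg_periodShift]

theorem V_neg_one_periodShift_of_ne {J K : Fin N} (hJK : K ≠ J) (X : Fin N → ℂ) :
    M.V m (-1) K (M.periodShift J X) = M.V m (-1) K X := by
  rw [V_neg_one, V_neg_one, ← V_one_periodShift_of_ne h hJK, periodShift_neg_periodShift]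

theorem prod_sign_periodShift (J : Fin N) (X : Fin N → ℂ) (c w : Fin N → ℂ) :
    (∏ δ ∈ ({1, -1} : Finset ℤ), ∏ K,
      M.s (δ * M.periodShift J X K + c K - w K) / M.s (δ * M.periodShift J X K + c K)) =
    ∏ δ ∈ ({1, -1} : Finset ℤ), ∏ K, M.s (δ * X K + c K - w K) / M.s (δ * X K + c K) := by
  rw [Finset.prod_comm, Finset.prod_comm (s := {1, -1})]
  refine Finset.prod_congr rfl fun K _ => ?_
  rw [Finset.prod_pair (by norm_num), Finset.prod_pair (by norm_num)]
  by_cases hK : K = J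
  · subst hK
    have e1 : ((1 : ℤ) : ℂ) * (X K + Complex.I * M.a) + c K =
      ((1 : ℤ) : ℂ) * X K + c K + Complex.I * M.a := by push_cast; ring
    have e2 : ((-1 : ℤ) : ℂ) * (X K + Complex.I * M.a) + c K =
      ((-1 : ℤ) : ℂ) * X K + c K - Complex.I * M.a := by push_cast; ring
    rw [periodShift_self, e1, e2, s_sub_div_s_add_period h, s_sub_div_s_sub_period h,
      mul_mul_mul_comm, ← Complex.exp_add, add_neg_cancel, Complex.exp_zero, one_mul]
  · rw [periodShift_of_ne hK]

theorem V0_periodShift (J : Fin N) (X : Fin N → ℂ) :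
    M.V0 m (M.periodShift J X) = M.V0 m X := by
  unfold V0
  congr 1
  refine Finset.sum_congr rfl fun ν _ => ?_
  congr 1
  have h1 := prod_sign_periodShift h J X (fun K => M.omega ν / 2 +
    Complex.I / 4 * (M.lam * (m K - 1) + 1 / m K + 1) * M.beta)
    (fun K => Complex.I * M.lam * m K * M.beta)
  have h2 := prod_sign_periodShift h J X (fun K => M.omega ν / 2 +
    Complex.I / 4 * (M.lam * (m K + 1) + 1 / m K - 1) * M.beta)
    (fun K => Complex.I * M.lam * m K * M.beta)
  simp only [← add_assoc (_ * _)] at h1 h2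
  rw [h1, h2]

end Elliptic

/-! ### Meromorphy along a single variable. -/

section Meromorphic

variable (hr : 0 < M.r) (ha : 0 < M.a)
include hr ha

theorem meromorphicAt_s_comp {g : ℂ → ℂ} {t : ℂ} (hg : AnalyticAt ℂ g t) :
    MeromorphicAt (fun t => M.s (g t)) t :=
  (((differentiable_s hr ha).analyticAt (g t)).comp hg).meromorphicAt

omit hr ha in
theorem analyticAt_update (X : Fin N → ℂ) (J K : Fin N) (t : ℂ) :
    AnalyticAt ℂ (fun t => Function.update X J t K) t := by
  by_cases hK : K = J
  · subst hK
    simp only [Function.update_self]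
    exact analyticAt_id
  · simpa [hK] using analyticAt_const

theorem meromorphicAt_V (ε : ℤ) (K J : Fin N) (X : Fin N → ℂ) (t : ℂ) :
    MeromorphicAt (fun t => M.V m ε K (Function.update X J t)) t := by
  have hu := fun K => analyticAt_update X J K t
  unfold V f
  refine MeromorphicAt.fun_mul (MeromorphicAt.fun_div (MeromorphicAt.fun_prod fun ν _ => ?_)
    (MeromorphicAt.fun_mul ?_ ?_)) (MeromorphicAt.fun_prod fun L _ => MeromorphicAt.fun_prod
      fun δ _ => MeromorphicAt.fun_div ?_ ?_)
  all_goals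
    refine meromorphicAt_s_comp hr ha ?_
    have h1 := hu K
  · fun_prop
  · fun_prop
  · fun_prop
  all_goals
    have h2 := hu L
    fun_prop

theorem meromorphicAt_V0 (J : Fin N) (X : Fin N → ℂ) (t : ℂ) :
    MeromorphicAt (fun t => M.V0 m (Function.update X J t)) t := by
  have hu := fun K => analyticAt_update X J K t
  unfold V0
  refine MeromorphicAt.fun_mul (MeromorphicAt.const _ _) (MeromorphicAt.fun_sum fun ν _ =>
    MeromorphicAt.fun_mul (MeromorphicAt.const _ _) (MeromorphicAt.fun_add
      (MeromorphicAt.fun_mul (MeromorphicAt.const _ _) ?_)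
      (MeromorphicAt.fun_mul (MeromorphicAt.const _ _) ?_)))
  all_goals
    refine MeromorphicAt.fun_prod fun δ _ => MeromorphicAt.fun_prod fun L _ =>
      MeromorphicAt.fun_div (meromorphicAt_s_comp hr ha ?_) (meromorphicAt_s_comp hr ha ?_)
  all_goals
    have h2 := hu L
    fun_prop

end Meromorphic

end Koornwinder.Model

/-! ### Necessity of the balancing condition. -/

namespace Koornwinder

/-- A meromorphic function on the plane with a non-isolated zero vanishes near every point, up to
the point itself. -/
theorem eventually_eq_zero_of_frequently {F : ℂ → ℂ} (hF : Meromorphic F) {t₀ : ℂ}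
    (h : ∃ᶠ t in 𝓝[≠] t₀, F t = 0) (t : ℂ) : ∀ᶠ z in 𝓝[≠] t, F z = 0 := by
  by_contra hne
  have h1 : meromorphicOrderAt F t ≠ ⊤ := by rwa [ne_eq, meromorphicOrderAt_eq_top_iff]
  have h2 := hF.exists_meromorphicOrderAt_ne_top_iff_forall.1 ⟨t, h1⟩ t₀
  rw [ne_eq, meromorphicOrderAt_eq_top_iff] at h2
  exact h2 ((hF t₀).frequently_zero_iff_eventuallyEq_zero.1 h)

/-- The three terms have multipliers q, 1/q and 1; these are distinct, so the system is of
Vandermonde type. -/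
theorem eq_zero_of_quasiperiodic_sum {q A B C B₁ B₂ : ℂ} (hq : q ≠ 1) (hq' : q ^ 2 ≠ 1)
    (h₁ : q * B₁ = B) (h₂ : q * B₂ = B₁) (e₀ : A + B + C = 0) (e₁ : q * A + B₁ + C = 0)
    (e₂ : q * (q * A) + B₂ + C = 0) : A = 0 := by
  have hq1 : 1 - q ≠ 0 := sub_ne_zero.2 hq.symm
  have f₁ : A = q * B₂ := mul_left_cancel₀ hq1 (by linear_combination e₀ - e₁ + h₁ + (q - 1) * h₂)
  have f₂ : B₂ = q * A := mul_left_cancel₀ hq1 (by linear_combination e₂ - e₁ - h₂)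
  refine mul_left_cancel₀ (sub_ne_zero.2 hq') ?_
  linear_combination -f₁ - q * f₂

theorem exists_sign_mul_eq {a b : ℂ} (h : a ^ 2 = b ^ 2) : ∃ σ : ℤˣ, a = ((σ : ℤ) : ℂ) * b := by
  rcases sq_eq_sq_iff_eq_or_eq_neg.1 h with h | h
  · exact ⟨1, by simp [h]⟩
  · exact ⟨-1, by simp [h]⟩

namespace Model

variable {N : ℕ} {M : Model} {m : Fin N → ℝ} {G : ℂ → ℂ → ℂ} {U : Set (Fin N → ℂ)}

/-- For a mass μ, 1/(λμ) is again a mass, and iλμβ is the shift iβ/μ' for μ' = 1/(λμ). -/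
theorem s_coupling_ne_zero (hr : 0 < M.r) (ha : 0 < M.a) (hlam : M.lam ≠ 0)
    (hperiod : ∀ μ ∈ M.masses, ∀ n : ℤ, n ≠ 0 → n * (Complex.I * M.beta / μ) ∉ M.Omega)
    {μ : ℝ} (hμ : μ ∈ M.masses) : M.s (Complex.I * M.lam * μ * M.beta) ≠ 0 := by
  intro h0
  have hmem : 1 / (M.lam * μ) ∈ M.masses := by
    rcases hμ with rfl | rfl | rfl | rfl <;> simp [masses, hlam] <;> field_simp <;> simp
  refine hperiod _ hmem 1 one_ne_zero ?_
  have e : ((1 : ℤ) : ℂ) * (Complex.I * M.beta / ((1 / (M.lam * μ) : ℝ) : ℂ)) =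
      Complex.I * M.lam * μ * M.beta := by
    push_cast
    rw [one_mul, div_div_eq_mul_div, div_one]
    ring
  rw [e]
  exact mem_Omega_of_s_eq_zero hr ha h0

theorem eventually_V_one_ne_zero (hr : 0 < M.r) (ha : 0 < M.a) (J : Fin N) :
    ∀ᶠ X in residual (Fin N → ℂ), M.V m 1 J X ≠ 0 := by
  have hs := eventually_s_ne_zero hr ha
  have hc : ∀ a : ℂ, a ≠ 0 → ∀ b : ℂ, ∀ᶠ X in residual (Fin N → ℂ), M.s (a * X J + b) ≠ 0 :=
    fun a ha b => (tendsto_residual_coord ha J b).eventually hs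
  have hp : ∀ K, K ≠ J → ∀ a' b : ℂ,
      ∀ᶠ X in residual (Fin N → ℂ), M.s (1 * X J + a' * X K + b) ≠ 0 :=
    fun K hK a' b => (tendsto_residual_coord_add hK one_ne_zero a' b).eventually hs
  have hf : ∀ K ∈ Finset.univ.erase J, ∀ a' : ℂ,
      ∀ᶠ X in residual (Fin N → ℂ), M.f 1 (X J + a' * X K) (m J) (m K) ≠ 0 := by
    intro K hK a'
    have hK := Finset.ne_of_mem_erase hK
    filter_upwards [hp K hK a' (-(((1 : ℤ) : ℂ) * Complex.I * (m J - m K) *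
        (M.lam * m J * m K - 1) * M.beta / (4 * m J * m K))),
      hp K hK a' (-(((1 : ℤ) : ℂ) * Complex.I * (m J - m K) *
        (M.lam * m J * m K - 1) * M.beta / (4 * m J * m K)) -
        ((1 : ℤ) : ℂ) * Complex.I * M.lam * m K * M.beta)] with X h1 h2
    rw [one_mul, ← sub_eq_add_neg] at h1
    rw [one_mul, ← add_sub_assoc, ← sub_eq_add_neg] at h2
    exact div_ne_zero h2 h1
  have hg : ∀ᶠ X in residual (Fin N → ℂ), ∀ ν,
      M.s (1 * X J + -(Complex.I * M.d (M.g ν) (m J) * M.beta)) ≠ 0 :=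
    Filter.eventually_all.2 fun ν => hc 1 one_ne_zero _
  have hf1 : ∀ᶠ X in residual (Fin N → ℂ), ∀ K ∈ Finset.univ.erase J,
      M.f 1 (X J + 1 * X K) (m J) (m K) ≠ 0 :=
    (Filter.eventually_all_finset _).2 fun K hK => hf K hK 1
  have hf2 : ∀ᶠ X in residual (Fin N → ℂ), ∀ K ∈ Finset.univ.erase J,
      M.f 1 (X J + -1 * X K) (m J) (m K) ≠ 0 :=
    (Filter.eventually_all_finset _).2 fun K hK => hf K hK (-1)
  filter_upwards [hg, hf1, hf2, hc 2 two_ne_zero 0,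
    hc 2 two_ne_zero (-(Complex.I * M.beta / m J))] with X h1 h2 h3 h4 h5
  rw [V_one_eq]
  refine mul_ne_zero (div_ne_zero (Finset.prod_ne_zero_iff.2 fun ν _ => ?_) (mul_ne_zero ?_ ?_))
    (Finset.prod_ne_zero_iff.2 fun K hK => mul_ne_zero ?_ ?_)
  · simpa [sub_eq_add_neg] using h1 ν
  · simpa using h4
  · simpa [sub_eq_add_neg] using h5
  · simpa using h2 K hK
  · simpa [sub_eq_add_neg] using h3 K hK

/-- The source identity divided by `Φ`, with arbitrary signs of the products of square roots. -/
noncomputable def signedSum (M : Model) (m : Fin N → ℝ) (σ τ : Fin N → ℤˣ) (X : Fin N → ℂ) : ℂ :=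
  ∑ J, M.s (Complex.I * M.lam * m J * M.beta) *
    (((σ J : ℤ) : ℂ) * M.V m 1 J X + ((τ J : ℤ) : ℂ) * M.V m (-1) J X) + M.V0 m X - M.eigenvalue m

/-- Arbitrary branches of the roots of V_J^- are allowed, so detailed balance fixes only the square
of each hopping term. The resulting signs may depend on X. -/
theorem exists_signedSum_eq_zero (hr : 0 < M.r) (ha : 0 < M.a) (hbeta : 0 < M.beta)
    (hlam : M.lam ≠ 0)
    (hG : ∀ α : ℂ, α.re ≠ 0 → IsGammaFunction M.s α (fun x => G x α))
    (hm : ∀ J, m J ∈ M.masses) (hreg : ∀ X ∈ U, M.Regular m G X) {Φ : (Fin N → ℂ) → ℂ}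
    (hΦ : IsSqrtBranch (M.PhiSq m G) (M.shiftClosure m U) Φ) {Rp : Fin N → (Fin N → ℂ) → ℂ}
    (hRp : ∀ J, IsSqrtBranch (M.V m 1 J) (U ∪ M.shift m (-1) J '' U) (Rp J))
    (hid : M.SourceIdentity m U Φ Rp) {X : Fin N → ℂ} (hX : X ∈ U) :
    ∃ p : (Fin N → ℤˣ) × (Fin N → ℤˣ), M.signedSum m p.1 p.2 X = 0 := by
  obtain ⟨Rm, hRm, hH⟩ := hid
  have hΦX : Φ X ≠ 0 := by
    intro h0
    have := hΦ.2 X (Or.inl hX)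
    rw [h0, zero_pow two_ne_zero] at this
    exact (hreg X hX).phi.2 this.symm
  have hσ : ∀ J, ∃ σ : ℤˣ, Rp J X * (Rm J (M.shift m 1 J X) * Φ (M.shift m 1 J X)) =
      ((σ : ℤ) : ℂ) * (M.V m 1 J X * Φ X) := by
    intro J
    refine exists_sign_mul_eq ?_
    have hS : M.shift m 1 J X ∈ U ∪ M.shift m 1 J '' U := Or.inr ⟨X, hX, rfl⟩
    have hb := detailed_balance_of_regular hr ha hbeta hlam hG hm hreg J hS
    rw [shift_neg_shift] at hb
    rw [mul_pow, mul_pow, (hRp J).2 X (Or.inl hX), (hRm J).2 _ hS,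
      hΦ.2 _ (union_shift_subset_shiftClosure J hS), ← hb, mul_pow, hΦ.2 X (Or.inl hX)]
    ring
  have hτ : ∀ J, ∃ τ : ℤˣ, Rm J X * (Rp J (M.shift m (-1) J X) * Φ (M.shift m (-1) J X)) =
      ((τ : ℤ) : ℂ) * (M.V m (-1) J X * Φ X) := by
    intro J
    refine exists_sign_mul_eq ?_
    have hS : X ∈ U ∪ M.shift m 1 J '' U := Or.inl hX
    have hb := detailed_balance_of_regular hr ha hbeta hlam hG hm hreg J hS
    have hY := shift_neg_mem_of_mem hS
    rw [mul_pow, mul_pow, (hRm J).2 X hS, (hRp J).2 _ hY,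
      hΦ.2 _ (union_shift_neg_subset_shiftClosure J hY), hb, mul_pow, hΦ.2 X (Or.inl hX)]
    ring
  choose σ hσ using hσ
  choose τ hτ using hτ
  refine ⟨(σ, τ), mul_right_cancel₀ hΦX ?_⟩
  have h := hH X hX
  simp only [H, hσ, hτ] at h
  rw [zero_mul, ← h, signedSum, sub_mul, add_mul, Finset.sum_mul]
  congr 2
  exact Finset.sum_congr rfl fun J _ => by ring

theorem meromorphic_signedSum (hr : 0 < M.r) (ha : 0 < M.a) (σ τ : Fin N → ℤˣ) (J : Fin N)
    (X : Fin N → ℂ) : Meromorphic fun t => M.signedSum m σ τ (Function.update X J t) := by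
  intro t
  unfold signedSum
  exact MeromorphicAt.fun_sub (MeromorphicAt.fun_add (MeromorphicAt.fun_sum fun K _ =>
    MeromorphicAt.fun_mul (MeromorphicAt.const _ _) (MeromorphicAt.fun_add
      (MeromorphicAt.fun_mul (MeromorphicAt.const _ _) (meromorphicAt_V hr ha 1 K J X t))
      (MeromorphicAt.fun_mul (MeromorphicAt.const _ _) (meromorphicAt_V hr ha (-1) K J X t))))
    (meromorphicAt_V0 hr ha J X t)) (MeromorphicAt.const _ _)

/-- The translates may leave U and the signs may vary on U. Since there are finitely many sign
patterns, one of them recurs arbitrarily close to the base point on a complex line; meromorphic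
continuation then makes that signed sum vanish along the line off a discrete set. -/
theorem exists_signedSum_periodShift_eq_zero (hr : 0 < M.r) (ha : 0 < M.a) (hU : IsOpen U)
    (hsum : ∀ X ∈ U, ∃ p : (Fin N → ℤˣ) × (Fin N → ℤˣ), M.signedSum m p.1 p.2 X = 0) (J : Fin N)
    {X : Fin N → ℂ} (hX : X ∈ U) (hc : ContinuousAt (M.V m 1 J) X) (hne : M.V m 1 J X ≠ 0) :
    ∃ (σ τ : Fin N → ℤˣ) (Y : Fin N → ℂ), M.V m 1 J Y ≠ 0 ∧ M.signedSum m σ τ Y = 0 ∧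
      M.signedSum m σ τ (M.periodShift J Y) = 0 ∧
      M.signedSum m σ τ (M.periodShift J (M.periodShift J Y)) = 0 := by
  have hline : Filter.Tendsto (fun t => Function.update X J t) (𝓝 (X J)) (𝓝 X) := by
    have : ContinuousAt (fun t => Function.update X J t) (X J) := by fun_prop
    simpa [ContinuousAt] using this
  have hline' := hline.mono_left (nhdsWithin_le_nhds (s := {X J}ᶜ))
  have hfreq : ∃ᶠ t in 𝓝[≠] (X J), ∃ p : (Fin N → ℤˣ) × (Fin N → ℤˣ),
      M.signedSum m p.1 p.2 (Function.update X J t) = 0 :=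
    ((hline'.eventually (hU.mem_nhds hX)).mono fun t ht => hsum _ ht).frequently
  obtain ⟨⟨σ, τ⟩, hp⟩ := Filter.frequently_exists.1 hfreq
  have hzero := eventually_eq_zero_of_frequently (meromorphic_signedSum hr ha σ τ J X) hp
  have htrans : ∀ w : ℂ, ∀ᶠ t in 𝓝[≠] (X J),
      M.signedSum m σ τ (Function.update X J (t + w)) = 0 := by
    intro w
    have h1 : Filter.Tendsto (fun t => t + w) (𝓝[≠] (X J)) (𝓝[≠] (X J + w)) :=
      tendsto_nhdsWithin_of_tendsto_nhds_of_eventually_within _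
        (((continuous_id.add continuous_const).tendsto (X J)).mono_left nhdsWithin_le_nhds)
        (eventually_mem_nhdsWithin.mono fun t ht => by simpa using ht)
    exact h1.eventually (hzero (X J + w))
  obtain ⟨t, h1, h2, h3, h4⟩ := ((hline'.eventually (hc.eventually_ne hne)).and
    ((hzero (X J)).and ((htrans (Complex.I * M.a)).and
      (htrans (Complex.I * M.a + Complex.I * M.a))))).exists
  have e : ∀ w : ℂ, M.periodShift J (Function.update X J w) =
      Function.update X J (w + Complex.I * M.a) := by
    intro w
    simp [periodShift]
  refine ⟨σ, τ, Function.update X J t, h1, h2, ?_, ?_⟩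
  · rw [e]
    exact h3
  · rw [e, e, add_assoc]
    exact h4

theorem signedSum_eq (σ τ : Fin N → ℤˣ) (J : Fin N) (X : Fin N → ℂ) :
    M.signedSum m σ τ X = M.s (Complex.I * M.lam * m J * M.beta) * ((σ J : ℤ) : ℂ) * M.V m 1 J X +
      M.s (Complex.I * M.lam * m J * M.beta) * ((τ J : ℤ) : ℂ) * M.V m (-1) J X +
      (∑ K ∈ Finset.univ.erase J, M.s (Complex.I * M.lam * m K * M.beta) *
        (((σ K : ℤ) : ℂ) * M.V m 1 K X + ((τ K : ℤ) : ℂ) * M.V m (-1) K X) + M.V0 m X -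
        M.eigenvalue m) := by
  rw [signedSum, ← Finset.add_sum_erase _ _ (Finset.mem_univ J)]
  ring

theorem signedSum_periodShift (h : M.kind = .elliptic) (σ τ : Fin N → ℤˣ) (J : Fin N)
    (X : Fin N → ℂ) : M.signedSum m σ τ (M.periodShift J X) =
      M.s (Complex.I * M.lam * m J * M.beta) * ((σ J : ℤ) : ℂ) * M.V m 1 J (M.periodShift J X) +
      M.s (Complex.I * M.lam * m J * M.beta) * ((τ J : ℤ) : ℂ) *
        M.V m (-1) J (M.periodShift J X) +
      (∑ K ∈ Finset.univ.erase J, M.s (Complex.I * M.lam * m K * M.beta) *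
        (((σ K : ℤ) : ℂ) * M.V m 1 K X + ((τ K : ℤ) : ℂ) * M.V m (-1) K X) + M.V0 m X -
        M.eigenvalue m) := by
  rw [signedSum_eq σ τ J, V0_periodShift h]
  congr 3
  refine Finset.sum_congr rfl fun K hK => ?_
  rw [V_one_periodShift_of_ne h (Finset.ne_of_mem_erase hK),
    V_neg_one_periodShift_of_ne h (Finset.ne_of_mem_erase hK)]

theorem balance_eq_zero_of_sourceIdentity (h : M.kind = .elliptic) (hr : 0 < M.r) (ha : 0 < M.a)
    (hbeta : 0 < M.beta) (hlam : M.lam ≠ 0)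
    (hperiod : ∀ μ ∈ M.masses, ∀ n : ℤ, n ≠ 0 → n * (Complex.I * M.beta / μ) ∉ M.Omega)
    (hG : ∀ α : ℂ, α.re ≠ 0 → IsGammaFunction M.s α (fun x => G x α))
    (hm : ∀ J, m J ∈ M.masses) (hU : IsOpen U) (hne : U.Nonempty)
    (hreg : ∀ X ∈ U, M.Regular m G X) {Φ : (Fin N → ℂ) → ℂ}
    (hΦ : IsSqrtBranch (M.PhiSq m G) (M.shiftClosure m U) Φ) {Rp : Fin N → (Fin N → ℂ) → ℂ}
    (hRp : ∀ J, IsSqrtBranch (M.V m 1 J) (U ∪ M.shift m (-1) J '' U) (Rp J)) (J : Fin N)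
    (hid : M.SourceIdentity m U Φ Rp) : M.balance m = 0 := by
  by_contra hbal
  obtain ⟨X, hXU, hVX⟩ := (dense_of_mem_residual
    (eventually_V_one_ne_zero (m := m) hr ha J)).inter_open_nonempty U hU hne
  obtain ⟨σ, τ, Y, hY, e₀, e₁, e₂⟩ := exists_signedSum_periodShift_eq_zero hr ha hU
    (fun X hX => exists_signedSum_eq_zero hr ha hbeta hlam hG hm hreg hΦ hRp hid hX) J hXU
    ((hreg X hXU).coeff J 1 (by simp)) hVX
  set q : ℂ := Complex.exp (-(2 * M.r * M.beta * M.balance m)) with hq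
  -- The exponent is real and nonzero, so q is a positive real number other than 1 and no positive
  -- power of it is 1.
  have hexp : ∀ n : ℕ, n ≠ 0 → q ^ n ≠ 1 := by
    intro n hn h1
    have e : q ^ n = ((Real.exp (n * -(2 * M.r * M.beta * M.balance m)) : ℝ) : ℂ) := by
      rw [hq, ← Complex.exp_nat_mul]
      push_cast
      rfl
    rw [e] at h1
    have h2 : Real.exp (n * -(2 * M.r * M.beta * M.balance m)) = 1 := by exact_mod_cast h1
    rw [Real.exp_eq_one_iff] at h2
    have : (n : ℝ) ≠ 0 := by exact_mod_cast hn
    simp [this, hr.ne', hbeta.ne', hbal] at h2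
  rw [signedSum_eq σ τ J] at e₀
  rw [signedSum_periodShift h, V_one_periodShift_self h hlam hm] at e₁
  rw [signedSum_periodShift h, V_one_periodShift_self h hlam hm,
    V_one_periodShift_self h hlam hm, V0_periodShift h] at e₂
  simp only [← hq] at e₁ e₂
  have hrest : ∀ K ∈ Finset.univ.erase J, M.s (Complex.I * M.lam * m K * M.beta) *
      (((σ K : ℤ) : ℂ) * M.V m 1 K (M.periodShift J Y) +
        ((τ K : ℤ) : ℂ) * M.V m (-1) K (M.periodShift J Y)) =
      M.s (Complex.I * M.lam * m K * M.beta) *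
      (((σ K : ℤ) : ℂ) * M.V m 1 K Y + ((τ K : ℤ) : ℂ) * M.V m (-1) K Y) := by
    intro K hK
    rw [V_one_periodShift_of_ne h (Finset.ne_of_mem_erase hK),
      V_neg_one_periodShift_of_ne h (Finset.ne_of_mem_erase hK)]
  rw [Finset.sum_congr rfl hrest] at e₂
  have b₁ := V_neg_one_periodShift_self h hlam hm J Y
  have b₂ := V_neg_one_periodShift_self h hlam hm J (M.periodShift J Y)
  rw [← hq] at b₁ b₂
  set c : ℂ := M.s (Complex.I * M.lam * m J * M.beta) * ((τ J : ℤ) : ℂ)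
  have hA := eq_zero_of_quasiperiodic_sum (B₁ := c * M.V m (-1) J (M.periodShift J Y))
    (B₂ := c * M.V m (-1) J (M.periodShift J (M.periodShift J Y)))
    (by simpa using hexp 1 one_ne_zero) (hexp 2 two_ne_zero)
    (by rw [mul_left_comm, b₁]) (by rw [mul_left_comm, b₂]) e₀
    (by rw [← e₁]; ring) (by rw [← e₂]; ring)
  have hσ : ((σ J : ℤ) : ℂ) ≠ 0 := by exact_mod_cast (σ J).ne_zero
  exact mul_ne_zero (mul_ne_zero (s_coupling_ne_zero hr ha hlam hperiod (hm J)) hσ) hY hA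

theorem balance_eq_of_elliptic (h : M.kind = .elliptic) :
    M.balance m = 2 * M.lam * ∑ J, m J + ∑ ν, M.g ν - 2 * (M.lam + 1) := by
  have hrho : (M.kind.rho : ℝ) = 3 := by simp [h, Kind.rho]
  rw [balance, hrho]
  ring

end Model

end Koornwinder

theorem theorem1 (M : Koornwinder.Model)
    (hr : 0 < M.r) (ha : 0 < M.a) (hbeta : 0 < M.beta) (hlam : M.lam ≠ 0)
    (hperiod : ∀ μ ∈ M.masses, ∀ n : ℤ, n ≠ 0 → n * (Complex.I * M.beta / μ) ∉ M.Omega)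
    (hV0 : Complex.I * (1 - M.lam) * M.beta ∉ M.Omega)
    (G : ℂ → ℂ → ℂ)
    (hG : ∀ α : ℂ, α.re ≠ 0 → Koornwinder.IsGammaFunction M.s α (fun x => G x α))
    (N : ℕ) (m : Fin N → ℝ) (hm : ∀ J, m J ∈ M.masses)
    (U : Set (Fin N → ℂ)) (hU : IsOpen U) (hne : U.Nonempty)
    (hreg : ∀ X ∈ U, M.Regular m G X)
    (Φ : (Fin N → ℂ) → ℂ)
    (hΦ : Koornwinder.IsSqrtBranch (M.PhiSq m G) (M.shiftClosure m U) Φ)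
    (Rp : Fin N → (Fin N → ℂ) → ℂ)
    (hRp : ∀ J, Koornwinder.IsSqrtBranch (M.V m 1 J) (U ∪ M.shift m (-1) J '' U) (Rp J)) :
    (M.kind ≠ Koornwinder.Kind.elliptic → M.SourceIdentity m U Φ Rp) ∧
    (M.kind = Koornwinder.Kind.elliptic →
      ((2 * M.lam * ∑ J, m J + ∑ ν, M.g ν - 2 * (M.lam + 1) = 0 →
          M.SourceIdentity m U Φ Rp) ∧
        (1 ≤ N → M.SourceIdentity m U Φ Rp →
          2 * M.lam * ∑ J, m J + ∑ ν, M.g ν - 2 * (M.lam + 1) = 0))) := by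
  refine ⟨fun h => Koornwinder.Model.sourceIdentity_of_balance hr ha hbeta hlam hV0 hG hm hreg hΦ
    hRp (Or.inl h), fun h => ?_⟩
  rw [← Koornwinder.Model.balance_eq_of_elliptic h]
  exact ⟨fun hbal => Koornwinder.Model.sourceIdentity_of_balance hr ha hbeta hlam hV0 hG hm hreg hΦ
    hRp (Or.inr hbal), fun hN hid => Koornwinder.Model.balance_eq_zero_of_sourceIdentity h hr ha
      hbeta hlam hperiod hG hm hU hne hreg hΦ hRp ⟨0, hN⟩ hid⟩
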